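/- **Model.** All tiles are two-dimensional. Fix an alphabet of glues, each glue $g$ with a strength $\mathrm{str}(g)\in\mathbb N$. A *tile* is a unit square of fixed orientation, with at most one glue on each of its four sides and with a label, which is a finite string. An *assembly* is a finite set of tiles placed at distinct points of $\mathbb Z^2$. Two tiles at neighbouring points bind with strength $\mathrm{str}(g)$ if their touching sides carry the same glue $g$, and with strength $0$ otherwise. An assembly is *$\tau$-stable* if every partition of it into two nonempty parts cuts bonds of total strength at least $\tau$. A *tile system* $\Gamma=(T,S,\tau)$ consists of a finite set $T$ of tiles, an integer $\tau\ge 1$ and a $\tau$-stable assembly $S$, the seed. We write $A\to A'$ if $A'$ is $\tau$-stable and arises from $A$ by placing a copy of some tile of $T$ at an empty point. An assembly is *producible* if it arises from $S$ by finitely many such attachments, and *terminal* if it is producible and no tile of $T$ can attach to it. $\Gamma$ *uniquely assembles* $A$ if $A$ is its only terminal assembly. One *parallel step* turns a producible assembly $A$ into the union of $A$ and all producible $B$ with $A\to B$. The *(parallel) run time* of $\Gamma$ is the least number of parallel steps that lead from $S$ to the unique terminal assembly. Let $T$ contain exactly one tile $t_0$ with label "0" and exactly one tile $t_1$ with label "1".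 An *$m$-bit input template* over $T$ consists of an assembly $R$ of tiles from $T\setminus\{t_0,t_1\}$ and $m$ distinct points $B(1),\dots,B(m)\in\mathbb Z^2$ not occupied by $R$. For $b\in\{0,1\}^m$, the assembly $U_b$ is $R$ together with a copy of $t_{b_i}$ at $B(i)$ for each $i$. A *tile assembly computer* (TAC) consists of $T$, $\tau$, an $m$-bit input template all of whose instances $U_b$ are $\tau$-stable, and points $C(1),\dots,C(k)\in\mathbb Z^2$. It *computes* $f:\{0,1\}^m\to\{0,1\}^k$ if for every $b$ the system $(T,U_b,\tau)$ uniquely assembles an assembly whose tile at $C(i)$ has label $f(b)_i$, for all $i$. Its run time on $b$ is the run time of $(T,U_b,\tau)$. It is an *$n$-bit adder* if it computes the map $\{0,1\}^{2n}\to\{0,1\}^{n+1}$ that sends $r_1\dots r_{2n}$ to the binary expansion of the sum of the numbers with binary expansions $r_1\dots r_n$ and $r_{n+1}\dots r_{2n}$, the most significant bit first. **Theorem.** There are a finite tile set $T$ (with glue strengths) and a temperature $\tau$, both independent of $n$, such that for every $n\ge 1$ there is a two-dimensional $n$-bit adder TAC with tile set $T$ and temperature $\tau$ whose run times satisfy the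 following: the average run time over a uniformly random input in $\{0,1\}^{2n}$ is $O(\log n)$ and the worst-case run time over all inputs is $O(\sqrt n)$, as $n\to\infty$. -/

import Mathlib

namespace TileAssembly

/-- A two-dimensional tile (a unit square of fixed orientation) over the glue alphabet `G`: at most
one glue on each face, together with a label, which is a finite string over the two symbols `0`
(written `false`) and `1` (written `true`). Thus the label consisting of the single symbol `0` is
`[false]`, the one consisting of `1` is `[true]`, and the empty label is `[]`. -/
structure Tile (G : Type) where
  north : Option G
  east : Option G
  south : Option G
  west : Option G
  label : List Bool

/-- An assembly: finitely many tiles at points of the integer lattice, no two of them at the same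
point. `tile p = some t` says that a translate of `t` sits at the point `p`, and `tile p = none`
that no tile sits there. -/
@[ext]
structure Assembly (G : Type) where
  tile : ℤ × ℤ → Option (Tile G)
  finite : {p | tile p ≠ none}.Finite

section Bonds

variable {G : Type} [DecidableEq G]

/-- The strength with which two touching faces bind: only equal glues interact. -/
def contact (str : G → ℕ) : Option G → Option G → ℕ
  | some g, some h => if g = h then str g else 0
  | _, _ => 0

/-- The weight of the edge between the tiles at `p` and `q` in the bond graph of `A`. -/
def bond (str : G → ℕ) (A : Assembly G) (p q : ℤ × ℤ) : ℕ :=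
  match A.tile p, A.tile q with
  | some t, some u =>
    if q = p + (0, 1) then contact str t.north u.south
    else if q = p + (1, 0) then contact str t.east u.west
    else if q = p + (0, -1) then contact str t.south u.north
    else if q = p + (-1, 0) then contact str t.west u.east
    else 0
  | _, _ => 0

/-- `A` is `τ`-stable: every cut of its bond graph into two nonempty parts has weight at
least `τ`. -/
def Assembly.IsStable (str : G → ℕ) (τ : ℕ) (A : Assembly G) : Prop :=
  ∀ X Y : Finset (ℤ × ℤ), X.Nonempty → Y.Nonempty → Disjoint X Y →
    (∀ p, A.tile p ≠ none ↔ p ∈ X ∨ p ∈ Y) → τ ≤ ∑ p ∈ X, ∑ q ∈ Y, bond str A p q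

end Bonds

/-- A tile system: a finite tile set over an alphabet of glues with strengths, a positive integer
temperature, and a seed assembly that is stable at this temperature. -/
structure TileSystem (G : Type) [DecidableEq G] where
  str : G → ℕ
  tiles : Finset (Tile G)
  temp : ℕ
  temp_pos : 0 < temp
  seed : Assembly G
  seed_stable : seed.IsStable str temp

namespace TileSystem

variable {G : Type} [DecidableEq G] (S : TileSystem G)

/-- `A'` arises from `A` by the attachment of one tile of the tile set at an empty point. -/
def Attach (A A' : Assembly G) : Prop :=
  ∃ t ∈ S.tiles, ∃ p, A.tile p = none ∧ A'.tile = Function.update A.tile p (some t) ∧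
    A'.IsStable S.str S.temp

/-- The assemblies that grow from the seed by finitely many attachments. -/
def producible : Set (Assembly G) :=
  {A | Relation.ReflTransGen S.Attach S.seed A}

/-- The producible assemblies to which no tile can attach. -/
def terminal : Set (Assembly G) :=
  {A | A ∈ S.producible ∧ ∀ A', ¬ S.Attach A A'}

/-- `A` is the one and only terminal assembly. -/
def UniquelyAssembles (A : Assembly G) : Prop :=
  S.terminal = {A}

/-- `A'` is `A` together with all the tiles that can attach to `A`, as sets of placed tiles. (If
different tiles can attach to `A` at the same point, then there is no such assembly `A'`.) -/
def ParallelStep (A A' : Assembly G) : Prop :=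
  ∀ p t, A'.tile p = some t ↔
    A.tile p = some t ∨ ∃ B ∈ S.producible, S.Attach A B ∧ B.tile p = some t

/-- The parallel run time is `k`: after `k` parallel steps from the seed, and no sooner, the unique
terminal assembly is reached. -/
def HasParallelRunTime (k : ℕ) : Prop :=
  IsLeast {j | ∃ A : ℕ → Assembly G, A 0 = S.seed ∧
    (∀ i < j, S.ParallelStep (A i) (A (i + 1))) ∧ S.UniquelyAssembles (A j)} k

end TileSystem

/-- An `m`-bit input template over the tile set `T`, in which `zero` is the only tile with label `0`
and `one` the only tile with label `1`: an assembly `frame` over the other tiles of `T` and `m`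
distinct wildcard positions outside `frame`. -/
structure InputTemplate {G : Type} (T : Finset (Tile G)) (m : ℕ) where
  zero : Tile G
  one : Tile G
  zero_mem : zero ∈ T
  one_mem : one ∈ T
  label_zero : ∀ t ∈ T, t.label = [false] ↔ t = zero
  label_one : ∀ t ∈ T, t.label = [true] ↔ t = one
  frame : Assembly G
  frame_over : ∀ p t, frame.tile p = some t → t ∈ T ∧ t ≠ zero ∧ t ≠ one
  wild : Fin m → ℤ × ℤ
  wild_injective : Function.Injective wild
  frame_wild : ∀ i, frame.tile (wild i) = none

/-- The template filled in with the bit string `b`: the frame together with a copy of `zero` or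
`one`, according to the bit `b i`, at each wildcard position `wild i`. -/
noncomputable def InputTemplate.fill {G : Type} {T : Finset (Tile G)} {m : ℕ}
    (U : InputTemplate T m) (b : Fin m → Bool) : Assembly G where
  tile := Function.extend U.wild (fun i => some (if b i then U.one else U.zero)) U.frame.tile
  finite := by
    refine ((Set.finite_range U.wild).union U.frame.finite).subset ?_
    intro p hp
    by_cases h : ∃ i, U.wild i = p
    · exact Or.inl h
    · refine Or.inr ?_
      change Function.extend _ _ _ p ≠ none at hp
      rw [Function.extend_apply' _ _ _ h] at hp
      exact hp

/-- A two-dimensional tile assembly computer with `m` input bits and `k` output bits: a tile set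
with glue strengths, a temperature, an input template all of whose instances are stable at this
temperature (and so are seeds), and an output template, which is a sequence of `k` points. -/
structure TAC (G : Type) [DecidableEq G] (m k : ℕ) where
  str : G → ℕ
  tiles : Finset (Tile G)
  temp : ℕ
  temp_pos : 0 < temp
  input : InputTemplate tiles m
  input_stable : ∀ b, (input.fill b).IsStable str temp
  output : Fin k → ℤ × ℤ

/-- The tile at the `i`-th point of `V` has label `c i`, for all `i`. -/
def Assembly.Represents {G : Type} {k : ℕ} (A : Assembly G) (V : Fin k → ℤ × ℤ)
    (c : Fin k → Bool) : Prop :=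
  ∀ i, ∃ t, A.tile (V i) = some t ∧ t.label = [c i]

/-- The natural number with binary expansion `x`, the first bit being the most significant. -/
def bitsValue {n : ℕ} (x : Fin n → Bool) : ℕ :=
  ∑ i, (x i).toNat * 2 ^ (i.rev : ℕ)

/-- The `(n + 1)`-bit sum of the two `n`-bit numbers that form the two halves of `r`, the first bit
being the most significant. -/
def addBits (n : ℕ) (r : Fin (n + n) → Bool) : Fin (n + 1) → Bool :=
  fun i => (bitsValue (fun j : Fin n => r (Fin.castAdd n j)) +
    bitsValue (fun j : Fin n => r (Fin.natAdd n j))).testBit (i.rev : ℕ)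

namespace TAC

variable {G : Type} [DecidableEq G] {m k : ℕ}

/-- The tile system of the tile assembly computer `M` on input `b`. -/
noncomputable def system (M : TAC G m k) (b : Fin m → Bool) : TileSystem G where
  str := M.str
  tiles := M.tiles
  temp := M.temp
  temp_pos := M.temp_pos
  seed := M.input.fill b
  seed_stable := M.input_stable b

/-- `M` computes `f`. -/
def Computes (M : TAC G m k) (f : (Fin m → Bool) → (Fin k → Bool)) : Prop :=
  ∀ b, ∃ A, (M.system b).UniquelyAssembles A ∧ A.Represents M.output (f b)

/-- `M` is an `n`-bit adder. -/
def IsAdder {n : ℕ} (M : TAC G (n + n) (n + 1)) : Prop :=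
  M.Computes (addBits n)

end TAC

/-- The average of `time b` over a uniformly random `m`-bit string `b`. -/
noncomputable def averageTime {m : ℕ} (time : (Fin m → Bool) → ℕ) : ℝ :=
  (∑ b, (time b : ℝ)) / Fintype.card (Fin m → Bool)

/-- The largest value of `time b` over all `m`-bit strings `b`. -/
def worstTime {m : ℕ} (time : (Fin m → Bool) → ℕ) : ℕ :=
  Finset.univ.sup time

end TileAssembly

/-! The construction is a carry-skip adder laid out in the plane. A position where the two digits
agree generates a carry; one where they differ propagates the carry into it. The positions are
divided among `L = Nat.sqrt n + 1` hairpins, stacked on top of each other. Each has a lower arm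
running east and an upper arm running back west, with `L` positions per arm. Two lanes run through a
hairpin. The outer lane transports the carry relative to the start of the hairpin, which is `none`
as long as every position so far propagates. This lane starts afresh behind each generating
position, in all hairpins at once. The inner lane transports the absolute carry and has to wait for
the carry into the hairpin only while the relative carry is `none`. Since a hairpin ends at the
western edge where it began, the incoming carry can climb that edge past a hairpin that propagates
throughout in a bounded number of steps. If the relative carry out of the hairpin is known, it is
handed upwards without any waiting.

Let `M` bound all runs of propagating positions of length at most `2 * L`. A lane then waits `O(M)`
steps, and at most `M` hairpins in succession are skipped, so everything is filled in time `O(M)`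
(`relTimeAt_le`, `entryTime_le`, `time_bitLayout_le`). Always `M = 2 * L` will do, which gives the
worst case. A run of length `k` starts at a given position for at most a fraction `1 / 2 ^ k` of the
inputs, so `M` can be taken of order `log n` except on a fraction `1 / (2 * n)` of them, where the
trivial bound adds only a constant to the average (`pow_mul_card_isRun_le`, `sum_runBound_le`).

At temperature 3, waiting is a matter of strengths. A tile that needs two signals is held by bonds
of strength 2 and 1; one that may ignore the second signal is held by a single bond of strength 3.
Only one tile may carry each of the labels `0` and `1`, so an output bit is the same tile as an
input bit, and a helper tile supplies the strength 2 that the sum bit alone does not give.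

Unique assembly is reduced to local conditions (`TileSystem.Certificate`). In any producible
assembly each tile is accompanied by those that held it when it attached. So an empty place sees
only glues of neighbours that do not depend on it. There are finitely many kinds of places, and the
kernel checks that no wrong tile reaches strength 3 (`unambiguous_of_mem`), that the intended tile
fits and misses none of its supports (`tight_of_mem`), and that adjacent places match (the lemmas on
`meets`). The times increase along each dependency, so they bound parallel growth from above. -/

namespace TileAssembly

/-! ### Stability under the attachment of one tile. -/

section Attachment

variable {G : Type} [DecidableEq G]

theorem contact_comm (str : G → ℕ) (a b : Option G) : contact str a b = contact str b a := by
  cases a <;> cases b <;> simp only [contact]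
  split_ifs with h h' h' <;> simp_all

theorem contact_none_right (str : G → ℕ) (a : Option G) : contact str a none = 0 := by
  cases a <;> rfl

theorem contact_self (str : G → ℕ) (g : G) : contact str (some g) (some g) = str g := by
  simp [contact]

/-- The total strength with which the tile `t` would bind at `p` to its neighbours in `A`. -/
def weight (str : G → ℕ) (A : ℤ × ℤ → Option (Tile G)) (p : ℤ × ℤ) (t : Tile G) : ℕ :=
  contact str t.north ((A (p + (0, 1))).bind Tile.south) +
  contact str t.east ((A (p + (1, 0))).bind Tile.west) +
  contact str t.south ((A (p + (0, -1))).bind Tile.north) +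
  contact str t.west ((A (p + (-1, 0))).bind Tile.east)

/-- The four offsets are distinct, so the nested conditional is a sum with at most one nonzero term.
In this form sums over neighbours split by direction. -/
theorem bond_eq (str : G → ℕ) (A : Assembly G) {p : ℤ × ℤ} {t : Tile G} (h : A.tile p = some t)
    (q : ℤ × ℤ) : bond str A p q =
      (if q = p + (0, 1) then contact str t.north ((A.tile q).bind Tile.south) else 0) +
      (if q = p + (1, 0) then contact str t.east ((A.tile q).bind Tile.west) else 0) +
      (if q = p + (0, -1) then contact str t.south ((A.tile q).bind Tile.north) else 0) +
      (if q = p + (-1, 0) then contact str t.west ((A.tile q).bind Tile.east) else 0) := by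
  unfold bond
  rw [h]
  cases hq : A.tile q with
  | none => simp [contact_none_right]
  | some u =>
    obtain ⟨x, y⟩ := p
    obtain ⟨x', y'⟩ := q
    simp only [Option.bind_some, Prod.mk_add_mk, Prod.mk.injEq]
    split_ifs <;> omega

theorem bond_eq_zero_left (str : G → ℕ) (A : Assembly G) {p : ℤ × ℤ} (h : A.tile p = none)
    (q : ℤ × ℤ) : bond str A p q = 0 := by
  unfold bond
  rw [h]

theorem bond_eq_zero_right (str : G → ℕ) (A : Assembly G) (p : ℤ × ℤ) {q : ℤ × ℤ}
    (h : A.tile q = none) : bond str A p q = 0 := by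
  unfold bond
  rw [h]
  cases A.tile p <;> rfl

theorem bond_comm (str : G → ℕ) (A : Assembly G) (p q : ℤ × ℤ) :
    bond str A p q = bond str A q p := by
  cases hp : A.tile p with
  | none => rw [bond_eq_zero_left str A hp, bond_eq_zero_right str A q hp]
  | some t =>
    cases hq : A.tile q with
    | none => rw [bond_eq_zero_left str A hq, bond_eq_zero_right str A p hq]
    | some u =>
      rw [bond_eq str A hp, bond_eq str A hq, hp, hq]
      obtain ⟨x, y⟩ := p
      obtain ⟨x', y'⟩ := q
      simp only [Option.bind_some, Prod.mk_add_mk, Prod.mk.injEq]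
      rw [contact_comm str u.north, contact_comm str u.east, contact_comm str u.south,
        contact_comm str u.west]
      split_ifs <;> omega

theorem bond_congr (str : G → ℕ) {A B : Assembly G} {p q : ℤ × ℤ} (hp : A.tile p = B.tile p)
    (hq : A.tile q = B.tile q) : bond str A p q = bond str B p q := by
  unfold bond
  rw [hp, hq]

theorem sum_bond_eq_weight (str : G → ℕ) {A B : Assembly G} {p : ℤ × ℤ} {t : Tile G}
    (hB : B.tile = Function.update A.tile p (some t)) {Y : Finset (ℤ × ℤ)}
    (hY : ∀ q, A.tile q ≠ none ↔ q ∈ Y) :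
    ∑ q ∈ Y, bond str B p q = weight str A.tile p t := by
  have hBp : B.tile p = some t := by rw [hB]; simp
  have key : ∀ (q : ℤ × ℤ) (f : Tile G → Option G) (a : Option G), q ≠ p →
      (∑ z ∈ Y, if z = q then contact str a ((B.tile z).bind f) else 0) =
        contact str a ((A.tile q).bind f) := by
    intro q f a hq
    rw [Finset.sum_ite_eq']
    have hBq : B.tile q = A.tile q := by rw [hB]; simp [hq]
    split_ifs with hm
    · rw [hBq]
    · rw [← hY, not_not] at hm
      rw [hm]
      simp [contact_none_right]
  have hne : ∀ v : ℤ × ℤ, v ≠ 0 → p + v ≠ p := fun v hv h => hv (by simpa using h)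
  simp only [bond_eq str B hBp, Finset.sum_add_distrib]
  rw [key _ _ _ (hne _ (by decide)), key _ _ _ (hne _ (by decide)), key _ _ _ (hne _ (by decide)),
    key _ _ _ (hne _ (by decide))]
  rfl

omit [DecidableEq G] in
theorem Assembly.exists_support (A : Assembly G) :
    ∃ Y : Finset (ℤ × ℤ), ∀ q, A.tile q ≠ none ↔ q ∈ Y :=
  ⟨A.finite.toFinset, fun q => by simp⟩

/-- The cut that isolates the new tile costs exactly its bonds. It is a cut into two nonempty parts
only if `A` is not empty. -/
theorem Assembly.IsStable.le_weight {str : G → ℕ} {τ : ℕ} {A B : Assembly G} {p : ℤ × ℤ}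
    {t : Tile G} (hp : A.tile p = none) (hB : B.tile = Function.update A.tile p (some t))
    (hA : ∃ q, A.tile q ≠ none) (h : B.IsStable str τ) : τ ≤ weight str A.tile p t := by
  obtain ⟨Y, hY⟩ := A.exists_support
  have hpY : p ∉ Y := by rw [← hY]; simpa using hp
  rw [← sum_bond_eq_weight str hB hY]
  obtain ⟨q, hq⟩ := hA
  have := h {p} Y ⟨p, by simp⟩ ⟨q, (hY q).1 hq⟩ (by simpa using hpY) (by
    intro z
    rw [hB, ← hY]
    by_cases hz : z = p
    · subst hz; simp
    · simp [hz])
  simpa using this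

/-- A cut of the enlarged assembly either isolates the new tile and costs its weight, or it also
cuts the old assembly, where the new tile can only add to the cost. With `le_weight`, attachment
becomes a local question. -/
theorem Assembly.IsStable.attach {str : G → ℕ} {τ : ℕ} {A B : Assembly G} {p : ℤ × ℤ}
    {t : Tile G} (hp : A.tile p = none) (hB : B.tile = Function.update A.tile p (some t))
    (h : A.IsStable str τ) (hw : τ ≤ weight str A.tile p t) : B.IsStable str τ := by
  have main : ∀ X Y : Finset (ℤ × ℤ), X.Nonempty → Y.Nonempty → Disjoint X Y →
      (∀ q, B.tile q ≠ none ↔ q ∈ X ∨ q ∈ Y) → p ∈ X →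
      τ ≤ ∑ a ∈ X, ∑ b ∈ Y, bond str B a b := by
    intro X Y hX hY hXY hdom hpX
    have hpY : p ∉ Y := fun hh => (Finset.disjoint_left.1 hXY) hpX hh
    have hBA : ∀ q, q ≠ p → B.tile q = A.tile q := by
      intro q hq; rw [hB]; simp [hq]
    by_cases hX1 : X.erase p = ∅
    · have hXp : X = {p} := by
        rw [Finset.erase_eq_empty_iff] at hX1
        rcases hX1 with h1 | h1
        · simp [h1] at hX
        · exact h1
      subst hXp
      rw [Finset.sum_singleton, sum_bond_eq_weight str hB]
      · exact hw
      · intro q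
        by_cases hq : q = p
        · subst hq; simp [hp, hpY]
        · rw [← hBA q hq, hdom]; simp [hq]
    · have := h (X.erase p) Y (Finset.nonempty_iff_ne_empty.2 hX1) hY
        (Finset.disjoint_of_subset_left (Finset.erase_subset _ _) hXY) (by
          intro q
          by_cases hq : q = p
          · subst hq; simp [hp, hpY]
          · rw [← hBA q hq, hdom]; simp [hq])
      refine this.trans ?_
      have hle : ∑ a ∈ X.erase p, ∑ b ∈ Y, bond str A a b =
          ∑ a ∈ X.erase p, ∑ b ∈ Y, bond str B a b := by
        refine Finset.sum_congr rfl fun a ha => Finset.sum_congr rfl fun b hb => ?_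
        refine bond_congr str (hBA a (Finset.ne_of_mem_erase ha)).symm (hBA b ?_).symm
        rintro rfl
        exact hpY hb
      rw [hle]
      exact Finset.sum_le_sum_of_subset (Finset.erase_subset _ _)
  intro X Y hX hY hXY hdom
  have hpXY : p ∈ X ∨ p ∈ Y := (hdom p).1 (by rw [hB]; simp)
  rcases hpXY with hx | hy
  · exact main X Y hX hY hXY hdom hx
  · rw [Finset.sum_comm]
    simp only [bond_comm str B]
    have := main Y X hY hX hXY.symm (fun q => (hdom q).trans or_comm) hy
    simpa only [bond_comm str B] using this

/-- `A` is a subassembly of `F`. -/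
def Sub (A F : ℤ × ℤ → Option (Tile G)) : Prop := ∀ p t, A p = some t → F p = some t

theorem contact_bind_mono (str : G → ℕ) {A F : ℤ × ℤ → Option (Tile G)} (h : Sub A F)
    (a : Option G) (q : ℤ × ℤ) (f : Tile G → Option G) :
    contact str a ((A q).bind f) ≤ contact str a ((F q).bind f) := by
  cases hq : A q with
  | none => simp [contact_none_right]
  | some u => rw [h q u hq]

theorem weight_mono (str : G → ℕ) {A F : ℤ × ℤ → Option (Tile G)} (h : Sub A F) (p : ℤ × ℤ)
    (t : Tile G) : weight str A p t ≤ weight str F p t := by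
  unfold weight
  gcongr <;> exact contact_bind_mono str h _ _ _

end Attachment

/-! ### From a local certificate to unique assembly and a bound on the run time. -/

section Growth

variable {G : Type} [DecidableEq G]

/-- With the tile at `q`, `A` contains a tile at each point `p` with `dep q p`. -/
def Closed (dep : ℤ × ℤ → ℤ × ℤ → Prop) (A : ℤ × ℤ → Option (Tile G)) : Prop :=
  ∀ q p, A q ≠ none → dep q p → A p ≠ none

/-- A certificate that the tile system `S` assembles `F`. The relation `dep q p` says that a tile
attaches at `q` only after one at `p`. As long as this is so, no tile but that of `F` fits at a
point outside the seed, and it does so only if the tiles on which it depends are there; and each of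
the tiles of `F` fits as soon as the tiles of smaller `time` are there. -/
structure TileSystem.Certificate (S : TileSystem G) (F : Assembly G) (time : ℤ × ℤ → ℕ)
    (dep : ℤ × ℤ → ℤ × ℤ → Prop) : Prop where
  nonempty : ∃ q, S.seed.tile q ≠ none
  seed_sub : Sub S.seed.tile F.tile
  seed_of_time : ∀ p t, F.tile p = some t → time p = 0 → S.seed.tile p = some t
  not_dep_seed : ∀ q p, S.seed.tile q ≠ none → ¬ dep q p
  unique : ∀ A : ℤ × ℤ → Option (Tile G), Sub S.seed.tile A → Sub A F.tile → Closed dep A →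
    ∀ p, A p = none → ∀ t ∈ S.tiles, S.temp ≤ weight S.str A p t →
      F.tile p = some t ∧ ∀ p', dep p p' → A p' ≠ none
  mem : ∀ p t, F.tile p = some t → t ∈ S.tiles
  ready : ∀ p t, S.seed.tile p = none → F.tile p = some t → ∀ A : ℤ × ℤ → Option (Tile G),
    (∀ q u, F.tile q = some u → time q < time p → A q = some u) → S.temp ≤ weight S.str A p t

namespace TileSystem

variable {S : TileSystem G} {F : Assembly G} {time : ℤ × ℤ → ℕ}
  {dep : ℤ × ℤ → ℤ × ℤ → Prop}

theorem seed_sub_of_producible {A : Assembly G} (hA : A ∈ S.producible) :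
    Sub S.seed.tile A.tile := by
  induction hA with
  | refl => exact fun _ _ h => h
  | tail _ h ih =>
    obtain ⟨t, _, p, hp, hu, _⟩ := h
    intro q u hq
    have := ih q u hq
    rw [hu]
    have hqp : q ≠ p := by rintro rfl; rw [hp] at this; cases this
    simp [hqp, this]

theorem stable_of_producible {A : Assembly G} (hA : A ∈ S.producible) :
    A.IsStable S.str S.temp := by
  cases hA with
  | refl => exact S.seed_stable
  | tail _ h => obtain ⟨t, _, p, _, _, h⟩ := h; exact h

namespace Certificate

theorem exists_of_producible (C : S.Certificate F time dep) {A : Assembly G}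
    (hA : A ∈ S.producible) : ∃ q, A.tile q ≠ none := by
  obtain ⟨q, hq⟩ := C.nonempty
  obtain ⟨t, ht⟩ := Option.ne_none_iff_exists'.1 hq
  exact ⟨q, by rw [seed_sub_of_producible hA q t ht]; simp⟩

/-- The two invariants need a joint induction. Uniqueness of the fitting tile uses closedness, which
excludes tiles that depend on an empty point; closedness survives because `unique` also yields the
tiles on which the new one depends. -/
theorem sub_closed_of_producible (C : S.Certificate F time dep) {A : Assembly G}
    (hA : A ∈ S.producible) : Sub A.tile F.tile ∧ Closed dep A.tile := by
  induction hA with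
  | refl => exact ⟨C.seed_sub, fun q p hq h => absurd h (C.not_dep_seed q p hq)⟩
  | tail hA h ih =>
    obtain ⟨t, ht, p, hp, hu, hs⟩ := h
    obtain ⟨hF, hdep⟩ := C.unique _ (seed_sub_of_producible hA) ih.1 ih.2 p hp t ht
      (hs.le_weight hp hu (C.exists_of_producible hA))
    rw [hu]
    refine ⟨fun q u hq => ?_, fun q p' hq h => ?_⟩
    · by_cases hqp : q = p
      · subst hqp
        rw [Function.update_self] at hq
        rw [← hq, hF]
      · rw [Function.update_of_ne hqp] at hq
        exact ih.1 q u hq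
    · by_cases hp' : p' = p
      · subst hp'; simp
      rw [Function.update_of_ne hp']
      by_cases hqp : q = p
      · subst hqp
        exact hdep p' h
      · rw [Function.update_of_ne hqp] at hq
        exact ih.2 q p' hq h

theorem sub_of_producible (C : S.Certificate F time dep) {A : Assembly G}
    (hA : A ∈ S.producible) : Sub A.tile F.tile :=
  (C.sub_closed_of_producible hA).1

theorem eq_of_attach (C : S.Certificate F time dep) {A B : Assembly G} (hA : A ∈ S.producible)
    {t : Tile G} (ht : t ∈ S.tiles) {p : ℤ × ℤ} (hp : A.tile p = none)
    (hB : B.tile = Function.update A.tile p (some t)) (hs : B.IsStable S.str S.temp) :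
    F.tile p = some t :=
  (C.unique _ (seed_sub_of_producible hA) (C.sub_of_producible hA)
    (C.sub_closed_of_producible hA).2 p hp t ht (hs.le_weight hp hB (C.exists_of_producible hA))).1

theorem attach_part (C : S.Certificate F time dep) {A : Assembly G} (hA : A ∈ S.producible)
    {p : ℤ × ℤ} {t : Tile G} (hp : A.tile p = none) (hF : F.tile p = some t)
    (hw : S.temp ≤ weight S.str A.tile p t) :
    ∃ B : Assembly G, B.tile = Function.update A.tile p (some t) ∧ S.Attach A B ∧
      B ∈ S.producible := by
  let B : Assembly G := ⟨Function.update A.tile p (some t), by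
    refine (A.finite.union (Set.finite_singleton p)).subset fun q hq => ?_
    by_cases hqp : q = p
    · exact Or.inr hqp
    · left
      simpa [hqp] using hq⟩
  have hAB : S.Attach A B :=
    ⟨t, C.mem p t hF, p, hp, rfl, (stable_of_producible hA).attach hp rfl hw⟩
  exact ⟨B, rfl, hAB, Relation.ReflTransGen.tail hA hAB⟩

/-- Tiles that fit one by one can all be attached. -/
theorem producible_union (C : S.Certificate F time dep) {A : Assembly G} (hA : A ∈ S.producible)
    (N : Finset (ℤ × ℤ)) (hN : ∀ p ∈ N, A.tile p = none ∧ ∃ t, F.tile p = some t ∧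
      S.temp ≤ weight S.str A.tile p t) :
    ∃ B ∈ S.producible, ∀ p, B.tile p = if p ∈ N then F.tile p else A.tile p := by
  induction N using Finset.induction_on with
  | empty => exact ⟨A, hA, fun p => by simp⟩
  | insert p N hpN ih =>
    obtain ⟨B, hB, hBt⟩ := ih fun q hq => hN q (Finset.mem_insert_of_mem hq)
    obtain ⟨hp, t, hF, hw⟩ := hN p (Finset.mem_insert_self _ _)
    have hAB : Sub A.tile B.tile := by
      intro q u hq
      rw [hBt]
      split_ifs with h
      · exact C.sub_of_producible hA q u hq
      · exact hq
    have hBp : B.tile p = none := by rw [hBt, if_neg hpN, hp]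
    -- Weights only grow as tiles are added, so what fitted `A` still fits `B`.
    obtain ⟨B', hB't, -, hB'⟩ := C.attach_part hB hBp hF (hw.trans (weight_mono _ hAB p t))
    refine ⟨B', hB', fun q => ?_⟩
    rw [hB't]
    by_cases hq : q = p
    · subst hq; simp [hF]
    · simp [hq, hBt]

/-- Only tiles of `F` can attach, so no two compete for a point and the union of all one-tile
extensions is an assembly. Attaching the new tiles one by one shows that it is producible. -/
theorem exists_parallelStep (C : S.Certificate F time dep) {A : Assembly G}
    (hA : A ∈ S.producible) : ∃ B ∈ S.producible, S.ParallelStep A B ∧ Sub A.tile B.tile ∧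
      ∀ p t, F.tile p = some t → S.temp ≤ weight S.str A.tile p t → B.tile p = some t := by
  classical
  obtain ⟨Y, hY⟩ := F.exists_support
  let N := Y.filter fun p => A.tile p = none ∧ ∃ t, F.tile p = some t ∧
      S.temp ≤ weight S.str A.tile p t
  obtain ⟨B, hB, hBt⟩ := C.producible_union hA N fun p hp => (Finset.mem_filter.1 hp).2
  have hAF := C.sub_of_producible hA
  have hnew : ∀ p t, F.tile p = some t → S.temp ≤ weight S.str A.tile p t →
      B.tile p = some t := by
    intro p t hF hw
    rw [hBt]
    split_ifs with h
    · exact hF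
    · cases hAp : A.tile p with
      | some u => rw [← hF, hAF p u hAp]
      | none =>
        exact absurd (Finset.mem_filter.2 ⟨(hY p).1 (by simp [hF]), hAp, t, hF, hw⟩) h
  have hAB : Sub A.tile B.tile := by
    intro q u hq
    rw [hBt]
    split_ifs with h
    · exact hAF q u hq
    · exact hq
  refine ⟨B, hB, fun p t => ⟨fun h => ?_, ?_⟩, hAB, hnew⟩
  · rw [hBt] at h
    split_ifs at h with hN
    · right
      obtain ⟨hp, u, hu, hw⟩ := (Finset.mem_filter.1 hN).2
      rw [h] at hu
      cases hu
      obtain ⟨D, hDt, hAD, hD⟩ := C.attach_part hA hp h hw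
      exact ⟨D, hD, hAD, by rw [hDt]; simp⟩
    · exact Or.inl h
  · rintro (h | ⟨D, hD, ⟨u, hu, q, hq, hDt, hs⟩, hDp⟩)
    · exact hAB p t h
    · rw [hDt] at hDp
      by_cases hpq : p = q
      · subst hpq
        rw [Function.update_self] at hDp
        cases hDp
        exact hnew p t (C.eq_of_attach hA hu hq hDt hs)
          (hs.le_weight hq hDt (C.exists_of_producible hA))
      · rw [Function.update_of_ne hpq] at hDp
        exact hAB p t hDp

omit [DecidableEq G] in
theorem ext_of_sub {A F : Assembly G} (h : Sub A.tile F.tile) (h' : Sub F.tile A.tile) :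
    A = F := by
  ext1
  funext p
  cases hp : F.tile p with
  | some t => exact h' p t hp
  | none =>
    cases hA : A.tile p with
    | none => rfl
    | some t => rw [h p t hA] at hp; cases hp

/-- A missing tile of least `time` would have all its supports and could attach. -/
theorem eq_of_terminal (C : S.Certificate F time dep) {A : Assembly G} (hA : A ∈ S.terminal) :
    A = F := by
  have hAF := C.sub_of_producible hA.1
  refine ext_of_sub hAF ?_
  have main : ∀ k p t, time p = k → F.tile p = some t → A.tile p = some t := by
    intro k
    induction k using Nat.strong_induction_on with
    | _ k ih =>
      intro p t hk hF
      cases hs : S.seed.tile p with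
      | some u =>
        have := seed_sub_of_producible hA.1 p u hs
        rw [this, ← hAF p u this, hF]
      | none =>
        cases hAp : A.tile p with
        | some u => rw [← hF, hAF p u hAp]
        | none =>
          have hw := C.ready p t hs hF A.tile fun q v hq hlt =>
            ih (time q) (hk ▸ hlt) q v rfl hq
          obtain ⟨B, -, hAB, -⟩ := C.attach_part hA.1 hAp hF hw
          exact absurd hAB (hA.2 B)
  exact fun p t => main _ p t rfl

/-- The times are only upper bounds: a place may be filled earlier, but after `i` steps all places
of time at most `i` are filled, because by `ready` those of time `i + 1` fit next. -/
theorem exists_run (C : S.Certificate F time dep) : ∃ A : ℕ → Assembly G, A 0 = S.seed ∧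
    (∀ i, S.ParallelStep (A i) (A (i + 1))) ∧ (∀ i, A i ∈ S.producible) ∧
    ∀ i p t, F.tile p = some t → time p ≤ i → (A i).tile p = some t := by
  classical
  choose f hf hstep hsub hnew using fun A : S.producible => C.exists_parallelStep A.2
  let A : ℕ → S.producible := fun i => Nat.rec ⟨S.seed, Relation.ReflTransGen.refl⟩
    (fun _ B => ⟨f B, hf B⟩) i
  refine ⟨fun i => (A i).1, rfl, fun i => ?_, ?_, ?_⟩
  · exact hstep (A i)
  · exact fun i => (A i).2
  · intro i
    induction i with
    | zero => exact fun p t hF ht => C.seed_of_time p t hF (by omega)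
    | succ i ih =>
      intro p t hF ht
      change (f (A i)).tile p = some t
      rcases Nat.lt_or_ge i (time p) with hlt | hle
      · cases hs : S.seed.tile p with
        | some u =>
          have h1 := seed_sub_of_producible (A i).2 p u hs
          have h2 := C.sub_of_producible (A i).2 p u h1
          rw [hF] at h2
          cases h2
          exact hsub _ p t h1
        | none =>
          exact hnew _ p t hF (C.ready p t hs hF _ fun q u hq hlt' => ih q u hq (by omega))
      · exact hsub _ p t (ih p t hF hle)

theorem uniquelyAssembles (C : S.Certificate F time dep) : S.UniquelyAssembles F := by
  obtain ⟨A, -, -, hprod, htime⟩ := C.exists_run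
  obtain ⟨Y, hY⟩ := F.exists_support
  have hF : A (Y.sup time) = F := by
    refine ext_of_sub (C.sub_of_producible (hprod _)) fun p t hp => ?_
    exact htime _ p t hp (Finset.le_sup ((hY p).1 (by simp [hp])))
  have hFprod : F ∈ S.producible := hF ▸ hprod _
  refine Set.eq_singleton_iff_unique_mem.2 ⟨⟨hFprod, ?_⟩, fun A hA => C.eq_of_terminal hA⟩
  rintro B ⟨t, ht, p, hp, hB, hs⟩
  rw [C.eq_of_attach hFprod ht hp hB hs] at hp
  cases hp

theorem exists_runTime (C : S.Certificate F time dep) {T : ℕ}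
    (hT : ∀ p, F.tile p ≠ none → time p ≤ T) : ∃ k ≤ T, S.HasParallelRunTime k := by
  obtain ⟨A, h0, hstep, hprod, htime⟩ := C.exists_run
  have hF : A T = F :=
    ext_of_sub (C.sub_of_producible (hprod _)) fun p t hp => htime _ p t hp (hT p (by simp [hp]))
  have hmem : T ∈ {j | ∃ A : ℕ → Assembly G, A 0 = S.seed ∧
    (∀ i < j, S.ParallelStep (A i) (A (i + 1))) ∧ S.UniquelyAssembles (A j)} :=
    ⟨A, h0, fun i _ => hstep i, by rw [hF]; exact C.uniquelyAssembles⟩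
  exact ⟨sInf _, Nat.sInf_le hmem, Nat.sInf_mem ⟨T, hmem⟩, fun j hj => Nat.sInf_le hj⟩

end Certificate

end TileSystem

end Growth


/-! ### Glues, tiles and kinds of places of the adder. -/

namespace Adder

/-- The glues of the adder. The first argument of the glues of a lane tells the arm of the hairpin
to which the lane belongs: `false` for the arm that runs east, `true` for the one that runs west. A
value of type `Option Bool` is a carry relative to the start of the hairpin: `none` means that it
equals the carry into the hairpin. -/
inductive Glue
  | frame
  | anchor
  | bit (b : Bool)
  | guide (d : Bool)
  | first (d a : Bool)
  | lift (d : Bool) (k : Fin 6)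
  | type (d : Bool) (t : Option Bool)
  | rel (d : Bool) (s : Option Bool)
  | relDown (d : Bool) (s : Option Bool)
  | mode (d : Bool) (h : Fin 3)
  | link (d : Bool) (k : Bool)
  | carry (d c : Bool)
  | help (d : Bool)
  | relTurn (k : Fin 14) (s : Option Bool)
  | relEnter (s : Option Bool)
  | carryTurn (k : Fin 14) (c : Bool)
  | column (k : Fin 14) (c : Bool)
  | exit (s : Option Bool)
  deriving DecidableEq

/-- The strengths of the glues. -/
def strength : Glue → ℕ
  | .frame => 3
  | .anchor => 2
  | .bit _ => 1
  | .guide _ => 2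
  | .first _ _ => 2
  -- A lane tile takes 2 from the outside and 1 from its predecessor in the lane. The tile `start`,
  -- held by `lift false 4`, has no predecessor.
  | .lift _ k => if k = 4 then 3 else 2
  | .type _ t => if t = none then 2 else 3
  | .rel _ _ => 1
  | .relDown _ s => if s = none then 2 else 3
  | .mode _ _ => 2
  | .link _ _ => 2
  | .carry _ _ => 1
  | .help _ => 3
  | .relTurn _ _ => 3
  | .relEnter _ => 3
  | .carryTurn _ _ => 3
  -- Below `skip` the climbing carry contributes only 1. It is needed beside `exit none`, of
  -- strength 2, and superfluous beside `exit (some _)`, of strength 3.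
  | .column k _ => if k = 10 then 1 else 3
  | .exit s => if s = none then 2 else 3

/-- The tile with the given outer, inner, back and front faces in the arm `d`: in the arm that runs
east, the outer face is the southern one. -/
def orient (d : Bool) (outer inner back front : Option Glue) : Tile Glue :=
  match d with
  | false => ⟨inner, front, outer, back, []⟩
  | true => ⟨outer, back, inner, front, []⟩

/-- The tile that stands for an input or output bit. -/
def bitTile (b : Bool) : Tile Glue :=
  ⟨some (.bit b), some .anchor, some (.bit b), some .anchor, [b]⟩

/-- Whether the neighbours beyond the northern, eastern, southern and western face of a place
come before it. -/
structure Faces where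
  north : Bool
  east : Bool
  south : Bool
  west : Bool

/-- The faces with the given outer, inner, back and front flags. -/
def Faces.orient (d outer inner back front : Bool) : Faces :=
  match d with
  | false => ⟨inner, front, outer, back⟩
  | true => ⟨outer, back, inner, front⟩

/-- The kinds of places in the final assembly, with the values that flow through them. -/
inductive Site
  | frame (n e s w : Bool)
  | foot
  | lift (d : Bool) (k : Fin 6)
  | pad (d : Bool)
  | source
  | input (b : Bool)
  | half (d a : Bool)
  | pair (d a b : Bool)
  | wire (d : Bool) (k : Fin 3) (s : Option Bool)
  | start
  | finish (s : Option Bool)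
  | relBend (s : Option Bool)
  | relTurn (k : Fin 14) (s : Option Bool)
  | relUnbend (s : Option Bool)
  | enter (s : Option Bool)
  | relBit (d : Bool) (t s : Option Bool)
  | node (d : Bool) (s : Option Bool) (c : Bool)
  | pass (d c : Bool)
  | sum (d : Bool) (h : Fin 3) (c : Bool)
  | helper (d : Bool)
  | out (d b : Bool)
  | carryBend (c : Bool)
  | carryTurn (k : Fin 14) (c : Bool)
  | carryUnbend (c : Bool)
  | column (k : Fin 14) (c : Bool)
  | skip (s : Option Bool) (c : Bool)
  | void
  | voidAnchor (d : Bool)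
  | voidBit (d b : Bool)
  | voidCarry (d : Bool) (c : Bool)
  deriving DecidableEq

namespace Site

/-- Whether a bit of the given mode is the sum of two different bits. -/
def flip (h : Fin 3) : Bool := h ≠ 0

/-- The glue that a flag puts on a face of a frame tile. -/
def frameFace (f : Bool) : Option Glue := if f then some .frame else none

/-- The tile at a place, if any. -/
def tile : Site → Option (Tile Glue)
  | frame n e s w => some ⟨frameFace n, frameFace e, frameFace s, frameFace w, []⟩
  | foot => some ⟨some .frame, some .anchor, some .frame, some .anchor, []⟩
  | lift d k => some (orient d (some .frame) (some (.lift d k)) none (some (.guide d)))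
  | pad d => some (orient d (some .frame) (some (.bit false)) none none)
  | source => some ⟨some (.column 0 false), some .frame, none, none, []⟩
  | input b => some (bitTile b)
  | half d a =>
    some (orient d (some (.bit a)) (some (.lift d 1)) (some (.guide d)) (some (.first d a)))
  | pair d a b => some (orient d (some (.bit b))
      (some (.type d (if a = b then some a else none))) (some (.first d a)) none)
  | wire d k s => some (orient d (some (.lift d k.castSucc.castSucc.castSucc))
      (some (if k = 0 then .relDown d s else .link d (k = 1))) (some (.rel d s)) (some (.rel d s)))
  | start => some (orient false (some (.lift false 4)) (some (.relDown false none)) none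
      (some (.rel false none)))
  | finish s => some (orient true (some (.lift true 5)) none (some (.rel true s)) (some (.exit s)))
  | relBend s => some (orient false (some (.lift false 3)) (some (.relTurn 4 s))
      (some (.rel false s)) none)
  | relTurn k s => some ⟨some (.relTurn (k + 1) s), none, some (.relTurn k s), none, []⟩
  | relUnbend s => some ⟨none, none, some (.relTurn 10 s), some (.relEnter s), []⟩
  | enter s => some ⟨none, some (.relEnter s), none, some (.rel true s), []⟩
  | relBit d t s => some (orient d (some (.type d t))
      (some (.mode d (if t = none then if s = none then 2 else 1 else 0)))
      (if t = none then some (.rel d s) else none) (some (.rel d (t.or s))))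
  | node d s c => some (orient d (some (.relDown d s)) none
      (if s = none then some (.carry d c) else none) (some (.carry d (s.getD c))))
  | pass d c => some (orient d (some (.link d true)) (some (.help d)) (some (.carry d c))
      (some (.carry d c)))
  | sum d h c => some (orient d (some (.mode d h)) (some (.bit (flip h ^^ c)))
      (some (.carry d c)) (if h = 2 then some (.carry d c) else none))
  | helper d => some (orient d (some (.help d)) none none (some .anchor))
  | out _ b => some (bitTile b)
  | carryBend c => some (orient false (some (.link false false)) (some (.carryTurn 5 c))
      (some (.carry false c)) none)
  | carryTurn k c => some ⟨some (.carryTurn (k + 1) c), none, some (.carryTurn k c), none, []⟩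
  | carryUnbend c => some ⟨none, none, some (.carryTurn 9 c), some (.carry true c), []⟩
  | column k c => some ⟨some (.column (k + 1) c), if k = 4 then some (.carry false c) else none,
      some (.column k c), none, []⟩
  | skip s c => some ⟨some (.column 11 (s.getD c)), some (.exit s),
      if s = none then some (.column 10 c) else none, none, []⟩
  | void => none
  | voidAnchor _ => none
  | voidBit _ _ => none
  | voidCarry _ _ => none

/-- The places of the seed. -/
def IsSeed : Site → Bool
  | frame _ _ _ _ => true
  | foot => true
  | lift _ _ => true
  | pad _ => true
  | source => true
  | input _ => true
  | _ => false

/-- The faces through which the tile at a place is held when it attaches. -/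
def ins : Site → Faces
  | half d _ => .orient d true false true false
  | pair d _ _ => .orient d true false true false
  | wire d _ _ => .orient d true false true false
  | start => .orient false true false false false
  | finish _ => .orient true true false true false
  | relBend _ => .orient false true false true false
  | relTurn _ _ => ⟨false, false, true, false⟩
  | relUnbend _ => ⟨false, false, true, false⟩
  | enter _ => ⟨false, true, false, false⟩
  | relBit d t _ => .orient d true false (t = none) false
  | node d s _ => .orient d true false (s = none) false
  | pass d _ => .orient d true false true false
  | sum d _ _ => .orient d true false true false
  | helper d => .orient d true false false false
  | out d _ => .orient d true false true false
  | carryBend _ => .orient false true false true false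
  | carryTurn _ _ => ⟨false, false, true, false⟩
  | carryUnbend _ => ⟨false, false, true, false⟩
  | column _ _ => ⟨false, false, true, false⟩
  | skip s _ => ⟨false, true, s = none, false⟩
  | _ => ⟨false, false, false, false⟩

/-- The glue that a place shows through a face by which it is held. -/
def held (f : Bool) (g : Option Glue) : Option Glue := if f then g else none

/-- The faces of the tile at a place by which it is held. -/
def grip (σ : Site) : Tile Glue :=
  match σ.tile with
  | none => ⟨none, none, none, none, []⟩
  | some t => ⟨held σ.ins.north t.north, held σ.ins.east t.east, held σ.ins.south t.south,
      held σ.ins.west t.west, []⟩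

/-- The glues that the neighbours of a place may show to it before its tile is there. -/
def view (σ : Site) : Tile Glue :=
  match σ with
  | relBit d t s => orient d (some (.type d t)) none (some (.rel d s)) none
  | node d s c => orient d (some (.relDown d s)) none (some (.carry d c)) none
  -- Stray glues of the seed to the east of the column: the feet in rows 1 and 12, and the last
  -- `lift` tile of the upper arm in row 11. Each has strength 2 only.
  | column k c => ⟨none, if k = 1 ∨ k = 12 then some .anchor else
      if k = 11 then some (.guide true) else none, some (.column k c), none, []⟩
  | skip s c => ⟨none, some (.exit s), some (.column 10 c), none, []⟩
  | voidAnchor d => orient d none none (some .anchor) none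
  | voidBit d b => orient d (some (.bit b)) none none none
  | voidCarry d c => orient d none none (some (.carry d c)) none
  | σ => σ.grip

/-- All bits. -/
def bools : List Bool := [false, true]
/-- All relative carries. -/
def carries : List (Option Bool) := [none, some false, some true]

/-- The places that occur: the columns and turns only at rows where they do not branch off. -/
def all : List Site :=
  (bools.flatMap fun n => bools.flatMap fun e => bools.flatMap fun s => bools.map fun w =>
    frame n e s w) ++ [foot, source, start, void] ++
  (bools.flatMap fun d => (List.finRange 6).map fun k => lift d k) ++
  bools.map pad ++ bools.map input ++
  (bools.flatMap fun d => bools.map fun a => half d a) ++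
  (bools.flatMap fun d => bools.flatMap fun a => bools.map fun b => pair d a b) ++
  (bools.flatMap fun d => (List.finRange 3).flatMap fun k => carries.map fun s => wire d k s) ++
  carries.map finish ++ carries.map relBend ++
  ([4, 5, 6, 7, 8, 9].flatMap fun k => carries.map fun s => relTurn k s) ++
  carries.map relUnbend ++ carries.map enter ++
  (bools.flatMap fun d => carries.flatMap fun t => carries.map fun s => relBit d t s) ++
  (bools.flatMap fun d => carries.flatMap fun s => bools.map fun c => node d s c) ++
  (bools.flatMap fun d => bools.map fun c => pass d c) ++
  (bools.flatMap fun d => (List.finRange 3).flatMap fun h => bools.map fun c => sum d h c) ++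
  bools.map helper ++ (bools.flatMap fun d => bools.map fun c => out d c) ++
  bools.map carryBend ++
  ([5, 6, 7, 8].flatMap fun k => bools.map fun s => carryTurn k s) ++
  bools.map carryUnbend ++
  ([0, 1, 2, 3, 4, 5, 6, 7, 8, 9, 11, 12, 13].flatMap fun k => bools.map fun c => column k c) ++
  (carries.flatMap fun s => bools.map fun c => skip s c) ++
  bools.map voidAnchor ++ (bools.flatMap fun d => bools.map fun c => voidBit d c) ++
  (bools.flatMap fun d => bools.map fun c => voidCarry d c)

/-- The strength with which `t` fits at a place whose neighbours show the glues of `v`. -/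
def fit (v t : Tile Glue) : ℕ :=
  contact strength t.north v.north + contact strength t.east v.east +
  contact strength t.south v.south + contact strength t.west v.west

end Site

instance : DecidableEq (Tile Glue) := fun s t =>
  decidable_of_iff (s.north = t.north ∧ s.east = t.east ∧ s.south = t.south ∧ s.west = t.west ∧
    s.label = t.label) (by cases s; cases t; simp)

/-! ### Finite checks on the kinds of places. -/

namespace Site

/-- The view of a place without the neighbours beyond the faces that are not flagged. -/
def mask (f : Faces) (v : Tile Glue) : Tile Glue :=
  ⟨held f.north v.north, held f.east v.east, held f.south v.south, held f.west v.west, []⟩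

/-- Outside the seed, no tile but the intended one fits. -/
def Unambiguous (σ τ : Site) : Bool :=
  match τ.tile with
  | none => true
  | some t => σ.IsSeed || decide (fit σ.view t < 3) || decide (σ.tile = some t)

/-- The faces by which the tile at a place is held suffice, and none of them can be missed. -/
def Tight (σ : Site) : Bool :=
  match σ.tile with
  | none => true
  | some t => σ.IsSeed || (decide (3 ≤ fit σ.grip t) &&
    (!σ.ins.north || decide (fit (mask ⟨false, true, true, true⟩ σ.view) t < 3)) &&
    (!σ.ins.east || decide (fit (mask ⟨true, false, true, true⟩ σ.view) t < 3)) &&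
    (!σ.ins.south || decide (fit (mask ⟨true, true, false, true⟩ σ.view) t < 3)) &&
    (!σ.ins.west || decide (fit (mask ⟨true, true, true, false⟩ σ.view) t < 3)))

/-- The columns and turns occur at the rows where nothing else happens. -/
def InRange : Site → Bool
  | relTurn k _ => 4 ≤ k && k ≤ 9
  | carryTurn k _ => 5 ≤ k && k ≤ 8
  | column k _ => k ≠ 10
  | _ => true

/-- The restriction on rows matters: a tile of `relTurn 10` would compete with `relUnbend`, and one
of `carryTurn 9` with `carryUnbend`. -/
theorem mem_all {σ : Site} (hσ : σ.InRange) : σ ∈ all := by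
  cases σ with
  | frame n e s w => revert n e s w; decide +kernel
  | foot => decide +kernel
  | lift d k => revert d k; decide +kernel
  | pad d => revert d; decide +kernel
  | source => decide +kernel
  | input b => revert b; decide +kernel
  | half d a => revert d a; decide +kernel
  | pair d a b => revert d a b; decide +kernel
  | wire d k s => revert d k s; decide +kernel
  | start => decide +kernel
  | finish s => revert s; decide +kernel
  | relBend s => revert s; decide +kernel
  | relTurn k s => revert k s; decide +kernel
  | relUnbend s => revert s; decide +kernel
  | enter s => revert s; decide +kernel
  | relBit d t s => revert d t s; decide +kernel
  | node d s c => revert d s c; decide +kernel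
  | pass d c => revert d c; decide +kernel
  | sum d h c => revert d h c; decide +kernel
  | helper d => revert d; decide +kernel
  | out d b => revert d b; decide +kernel
  | carryBend c => revert c; decide +kernel
  | carryTurn k c => revert k c; decide +kernel
  | carryUnbend c => revert c; decide +kernel
  | column k c => revert k c; decide +kernel
  | skip s c => revert s c; decide +kernel
  | void => decide +kernel
  | voidAnchor d => revert d; decide +kernel
  | voidBit d b => revert d b; decide +kernel
  | voidCarry d c => revert d c; decide +kernel

/-- The views reduce all possible surroundings of an empty place to one worst case, so errors are
excluded by a finite check over pairs: a place and the source of the tile that is tried there. -/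
theorem unambiguous_of_mem {σ τ : Site} (hσ : σ ∈ all) (hτ : τ ∈ all) : Unambiguous σ τ := by
  have h : (all.all fun σ => all.all fun τ => Unambiguous σ τ) = true := by decide +kernel
  simp only [List.all_eq_true] at h
  exact h σ hσ τ hτ

theorem tight_of_mem {σ : Site} (hσ : σ ∈ all) : Tight σ := by
  have h : (all.all fun σ => Tight σ) = true := by decide +kernel
  simp only [List.all_eq_true] at h
  exact h σ hσ

/-- The glue on a face of the tile at a place. -/
def face (f : Tile Glue → Option Glue) (σ : Site) : Option Glue := σ.tile.bind f

/-- The place `τ` can be next to `σ`, given the two touching faces `f` of `σ` and `g` of `τ` and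
whether their tiles are held by these. -/
def meets (f g : Tile Glue → Option Glue) (hf hg : Faces → Bool) (σ τ : Site) : Bool :=
  (σ.IsSeed || hg τ.ins || decide (face g τ = none) || decide (face g τ = f σ.view)) &&
  (τ.IsSeed || hf σ.ins || decide (face f σ = none) || decide (face f σ = g τ.view)) &&
  (!hf σ.ins || decide (face g τ = face f σ)) && (!hg τ.ins || decide (face f σ = face g τ))

/-- The place `τ`, filled at time `n`, can be to the east of `σ`, filled at time `m`. -/
structure MeetsEast (σ : Site) (m : ℕ) (τ : Site) (n : ℕ) : Prop where
  meets : meets Tile.east Tile.west Faces.east Faces.west σ τ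
  left : σ.ins.east → n < m
  right : τ.ins.west → m < n

/-- The place `τ`, filled at time `n`, can be to the north of `σ`, filled at time `m`. -/
structure MeetsNorth (σ : Site) (m : ℕ) (τ : Site) (n : ℕ) : Prop where
  meets : meets Tile.north Tile.south Faces.north Faces.south σ τ
  left : σ.ins.north → n < m
  right : τ.ins.south → m < n

end Site
/-- The values at one position of the addends: the two bits, the carry into this position, relative
to the start of the hairpin and absolute, and whether the position is beyond the input. -/
structure Datum where
  a : Bool
  b : Bool
  s : Option Bool
  c : Bool
  pad : Bool

namespace Datum

/-- The carry that a position generates, or `none` if it propagates the carry into it. -/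
def type (D : Datum) : Option Bool := if D.a = D.b then some D.a else none

/-- The sum bit. -/
def out (D : Datum) : Bool := (D.type = none) ^^ D.c

/-- The carries of `D'` are those out of `D`. -/
def Next (D D' : Datum) : Prop := D'.s = D.type.or D.s ∧ D'.c = D.type.getD D.c

/-- The two carries of `D` agree. -/
def Valid (D : Datum) : Prop := D.s.getD D.c = D.c

end Datum

open Site

/-- The place in row `v` (counted inwards) of the arm `d`, in column `j` of the three that belong to
a position with values `D`. The flag `e` marks the column next to the western end of the hairpin. -/
def armSite (d : Bool) (v j : ℕ) (e : Bool) (D : Datum) : Site :=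
  match v, j with
  | 0, _ => frame (!d) true d (!e)
  | 1, 0 => foot
  | 1, 1 => if D.pad then pad d else input D.a
  | 1, _ => if D.pad then pad d else input D.b
  | 2, 0 => lift d (if e then if d then 5 else 4 else 0)
  | 2, 1 => half d D.a
  | 2, _ => pair d D.a D.b
  | 3, 0 => if e then if d then finish D.s else start else wire d 0 D.s
  | 3, 1 => wire d 1 D.s
  | 3, _ => relBit d D.type D.s
  | 4, 0 => if e && d then if D.s = none then voidCarry d D.c else void else node d D.s D.c
  | 4, 1 => pass d D.c
  | 4, _ => sum d (if D.type = none then if D.s = none then 2 else 1 else 0) D.c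
  | 5, 0 => voidAnchor d
  | 5, 1 => helper d
  | 5, _ => out d D.out
  | 6, 2 => voidBit d D.out
  | _, _ => void

/-- The time at which the place `armSite d v j e D` is filled, if the relative and absolute carries
arrive there at times `m` and `n`. -/
def armTime (d : Bool) (v j : ℕ) (D : Datum) (m n : ℕ) : ℕ :=
  match v, j with
  | 2, 1 => 1
  | 2, 2 => 2
  | 3, 0 => m + if d then 11 else 0
  | 3, 1 => m + 1 + if d then 11 else 0
  | 3, 2 => if D.type = none then m + 2 + if d then 11 else 0 else 3
  | 4, 0 => n + if d then 11 else 0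
  | 4, 1 => n + 1 + if d then 11 else 0
  | 4, 2 => n + 2 + if d then 11 else 0
  | 5, 1 => n + 2 + if d then 11 else 0
  | 5, 2 => n + 3 + if d then 11 else 0
  | _, _ => 0

/-- The places to the west of a hairpin, where the carry `c` into the hairpin and the relative carry
`s` out of it meet. -/
def leftSite (k : ℕ) (s : Option Bool) (c : Bool) : Site :=
  if k < 10 then column (Fin.ofNat 14 k) c else if k = 10 then skip s c else
    column (Fin.ofNat 14 k) (s.getD c)

/-- The time at which `leftSite k s c` is filled, if the carry arrives at time `m` and the carry out
of the hairpin is known at time `n`. -/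
def leftTime (k m n : ℕ) : ℕ :=
  if k < 10 then m + k else n + (k - 10)

/-- The places at the turn of the hairpin where the carry changes its direction. -/
def carrySite (k : ℕ) (s : Option Bool) (c : Bool) : Site :=
  match k with
  | 0 => frame true true false true
  | 1 => frame true true true true
  | 2 => lift false 2
  | 3 => wire false 2 s
  | 4 => carryBend c
  | 5 => carryTurn 5 c
  | 6 => carryTurn 6 c
  | 7 => carryTurn 7 c
  | 8 => carryTurn 8 c
  | 9 => carryUnbend c
  | 10 => enter s
  | 11 => frame true true false true
  | 12 => frame true true true true
  | _ => frame false true true true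

/-- The time at which `carrySite k s c` is filled. -/
def carryTime (k m n : ℕ) : ℕ :=
  if k < 3 then 0 else if k = 3 then m + 1 else if k < 10 then n + (k - 3) else
    if k = 10 then m + 10 else 0

/-- The places at the turn of the hairpin where the relative carry changes its direction. -/
def relSite (k : ℕ) (s : Option Bool) : Site :=
  match k with
  | 0 => frame true true false true
  | 1 => frame true true true true
  | 2 => lift false 3
  | 3 => relBend s
  | 4 => relTurn 4 s
  | 5 => relTurn 5 s
  | 6 => relTurn 6 s
  | 7 => relTurn 7 s
  | 8 => relTurn 8 s
  | 9 => relTurn 9 s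
  | 10 => relUnbend s
  | 11 => frame true true false true
  | 12 => frame true true true true
  | _ => frame false true true true

/-- The time at which `relSite k s` is filled. -/
def relTime (k m : ℕ) : ℕ :=
  if k < 3 then 0 else if k < 11 then m + (k - 1) else 0

/-- The eastern wall of the frame. -/
def wallSite (k : ℕ) : Site :=
  if k < 3 ∨ 10 < k then frame true false true true else frame true false true false

/-- The front face of the arm `d`. -/
def Faces.front (d : Bool) (f : Faces) : Bool := if d then f.west else f.east

/-- The back face of the arm `d`. -/
def Faces.back (d : Bool) (f : Faces) : Bool := if d then f.east else f.west

/-- The inner face of the arm `d`. -/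
def Faces.inner (d : Bool) (f : Faces) : Bool := if d then f.south else f.north

/-- The outer face of the arm `d`. -/
def Faces.outer (d : Bool) (f : Faces) : Bool := if d then f.north else f.south

section Faces

variable (d o i b f : Bool)

@[simp] theorem Faces.front_orient : (Faces.orient d o i b f).front d = f := by cases d <;> rfl
@[simp] theorem Faces.back_orient : (Faces.orient d o i b f).back d = b := by cases d <;> rfl
@[simp] theorem Faces.inner_orient : (Faces.orient d o i b f).inner d = i := by cases d <;> rfl
@[simp] theorem Faces.outer_orient : (Faces.orient d o i b f).outer d = o := by cases d <;> rfl
@[simp] theorem Faces.front_false : Faces.front d ⟨false, false, false, false⟩ = false := by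
  cases d <;> rfl
@[simp] theorem Faces.back_false : Faces.back d ⟨false, false, false, false⟩ = false := by
  cases d <;> rfl
@[simp] theorem Faces.inner_false : Faces.inner d ⟨false, false, false, false⟩ = false := by
  cases d <;> rfl
@[simp] theorem Faces.outer_false : Faces.outer d ⟨false, false, false, false⟩ = false := by
  cases d <;> rfl

end Faces

/-- `meets` along the direction in which the arm `d` runs. -/
def meetsFront (d : Bool) (σ τ : Site) : Bool :=
  if d then meets Tile.east Tile.west Faces.east Faces.west τ σ
  else meets Tile.east Tile.west Faces.east Faces.west σ τ

/-- `meets` towards the inside of the arm `d`. -/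
def meetsInner (d : Bool) (σ τ : Site) : Bool :=
  if d then meets Tile.north Tile.south Faces.north Faces.south τ σ
  else meets Tile.north Tile.south Faces.north Faces.south σ τ

/-- Adjacency along the direction in which the arm `d` runs. -/
def MeetsFront (d : Bool) (σ : Site) (m : ℕ) (τ : Site) (n : ℕ) : Prop :=
  if d then MeetsEast τ n σ m else MeetsEast σ m τ n

/-- Adjacency towards the inside of the arm `d`. -/
def MeetsInner (d : Bool) (σ : Site) (m : ℕ) (τ : Site) (n : ℕ) : Prop :=
  if d then MeetsNorth τ n σ m else MeetsNorth σ m τ n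

theorem MeetsFront.mk {d : Bool} {σ τ : Site} {m n : ℕ} (h : meetsFront d σ τ)
    (hσ : σ.ins.front d → n < m) (hτ : τ.ins.back d → m < n) : MeetsFront d σ m τ n := by
  cases d
  · exact ⟨h, hσ, hτ⟩
  · exact ⟨h, hτ, hσ⟩

theorem MeetsInner.mk {d : Bool} {σ τ : Site} {m n : ℕ} (h : meetsInner d σ τ)
    (hσ : σ.ins.inner d → n < m) (hτ : τ.ins.outer d → m < n) : MeetsInner d σ m τ n := by
  cases d
  · exact ⟨h, hσ, hτ⟩
  · exact ⟨h, hτ, hσ⟩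

/-! ### Adjacent places inside an arm. -/

section Arm

variable {d e : Bool} {v j m n m' n' : ℕ} {D D' : Datum}

theorem inRange_armSite : (armSite d v j e D).InRange := by
  unfold armSite
  split <;> (try split_ifs) <;> rfl

/-- The matching of faces is a finite check over all values; only the order of the times needs
arithmetic. The other adjacency lemmas follow the same pattern. In the upper arm `e` marks the last
column, which has no successor in the arm, so the flag is admitted here only for the lower arm. -/
theorem meets_arm_zero_one (hv : v < 7) (he : e → d = false ∧ D.s = none) (hD : D.Valid)
    :
    MeetsFront d (armSite d v 0 e D) (armTime d v 0 D m n) (armSite d v 1 false D)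
      (armTime d v 1 D m n) := by
  have h : ∀ d e : Bool, ∀ v < 7, ∀ a b s c pad, (e → d = false ∧ s = none) →
    Option.getD s c = c →
    meetsFront d (armSite d v 0 e ⟨a, b, s, c, pad⟩) (armSite d v 1 false ⟨a, b, s, c, pad⟩) := by
    decide +kernel
  obtain ⟨a, b, s, c, pad⟩ := D
  refine .mk (h d e v hv a b s c pad he hD) ?_ ?_ <;> clear h <;>
    interval_cases v <;> simp only [armSite, armTime] <;> (try split_ifs) <;>
    simp_all [ins]

theorem meets_arm_one_two (hv : v < 7) :
    MeetsFront d (armSite d v 1 false D) (armTime d v 1 D m n) (armSite d v 2 false D)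
      (armTime d v 2 D m n) := by
  have h : ∀ d : Bool, ∀ v < 7, ∀ a b s c pad,
    meetsFront d (armSite d v 1 false ⟨a, b, s, c, pad⟩)
      (armSite d v 2 false ⟨a, b, s, c, pad⟩) := by
    decide +kernel
  obtain ⟨a, b, s, c, pad⟩ := D
  refine .mk (h d v hv a b s c pad) ?_ ?_ <;> clear h <;>
    interval_cases v <;> simp only [armSite, armTime] <;> (try split_ifs) <;>
    simp_all [ins]

/-- This is the passage from one position to the next, where `Next` and the recursions of the
arrival times enter. The absolute arrival time matters only while the relative carry is `none`;
otherwise the next `node` is not held by its lane. -/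
theorem meets_arm_two_zero (hv : v < 7) (he : e → d = true) (hD : D.Next D')
    (hm' : m' = if D.type = none then m + 3 else 4) (hn' : D'.s = none → n' = n + 3) :
    MeetsFront d (armSite d v 2 false D) (armTime d v 2 D m n) (armSite d v 0 e D')
      (armTime d v 0 D' m' n') := by
  have h : ∀ d e : Bool, ∀ v < 7, ∀ a b s c a' b' pad, (e → d = true) →
    meetsFront d (armSite d v 2 false ⟨a, b, s, c, pad⟩)
      (armSite d v 0 e ⟨a', b', (Datum.mk a b s c pad).type.or s,
        (Datum.mk a b s c pad).type.getD c, pad⟩) := by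
    decide +kernel
  obtain ⟨a, b, s, c, pad⟩ := D
  obtain ⟨a', b', s', c', pad'⟩ := D'
  obtain ⟨h1, h2⟩ := hD
  dsimp only at h1 h2 hn'
  subst h1 h2
  -- Column 0 does not depend on the pad flag, so the finite check could use the same flag on both
  -- sides.
  have h' : meetsFront d (armSite d v 2 false ⟨a, b, s, c, pad⟩)
      (armSite d v 0 e ⟨a', b', (Datum.mk a b s c pad).type.or s,
        (Datum.mk a b s c pad).type.getD c, pad'⟩) := by
    have := h d e v hv a b s c a' b' pad he
    interval_cases v <;> exact this
  refine .mk h' ?_ ?_ <;> clear h h' <;>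
    interval_cases v <;> simp only [armSite, armTime] <;> (try split_ifs) <;>
    simp_all [ins]
  all_goals
    intro h1 h2
    rw [hn' h1 h2]
    omega

set_option synthInstance.maxSize 512 in
set_option synthInstance.maxHeartbeats 200000 in
theorem meets_arm_inner (hv : v < 6) (hj : j < 3)
    (he : e && !d → D.s = none) (hpad : D.pad → D.a = false ∧ D.b = false) (hm : 1 ≤ m)
    (hn : m < n) :
    MeetsInner d (armSite d v j e D) (armTime d v j D m n) (armSite d (v + 1) j e D)
      (armTime d (v + 1) j D m n) := by
  have h : ∀ d e : Bool, ∀ v < 6, ∀ j < 3, ∀ (a b : Bool) (s : Option Bool) (c pad : Bool),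
    (e && !d → s = none) ∧ (pad → a = false ∧ b = false) →
    meetsInner d (armSite d v j e ⟨a, b, s, c, pad⟩)
      (armSite d (v + 1) j e ⟨a, b, s, c, pad⟩) := by
    decide +kernel
  obtain ⟨a, b, s, c, pad⟩ := D
  refine .mk (h d e v hv j hj a b s c pad ⟨he, hpad⟩) ?_ ?_ <;> clear h <;>
    interval_cases v <;> interval_cases j <;> simp only [armSite, armTime] <;>
    (try split_ifs) <;> simp_all [ins] <;> omega

end Arm

/-! ### Adjacent places at the western column, the turn and the wall. -/

section Boundary

variable {k v j j' p q m n m' n' : ℕ} {e e' : Bool} {s s' : Option Bool} {c : Bool} {D D' : Datum}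

theorem inRange_leftSite (hk : k < 14) : (leftSite k s c).InRange := by
  unfold leftSite
  split_ifs with h1 h2
  · simp only [InRange, ne_eq, decide_eq_true_eq]
    intro h
    have := congrArg Fin.val h
    simp [Fin.ofNat] at this
    omega
  · rfl
  · simp only [InRange, ne_eq, decide_eq_true_eq]
    intro h
    have := congrArg Fin.val h
    simp [Fin.ofNat] at this
    omega

theorem inRange_carrySite : (carrySite k s c).InRange := by
  unfold carrySite
  split <;> rfl

theorem inRange_relSite : (relSite k s).InRange := by
  unfold relSite
  split <;> rfl

theorem inRange_wallSite : (wallSite k).InRange := by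
  unfold wallSite
  split_ifs <;> rfl

theorem meets_of_isSeed {f g : Tile Glue → Option Glue} {hf hg : Faces → Bool} {σ τ : Site}
    (h0 : hf ⟨false, false, false, false⟩ = false) (h1 : hg ⟨false, false, false, false⟩ = false)
    (hσ : σ.IsSeed) (hτ : τ.IsSeed) :
    meets f g hf hg σ τ ∧ hf σ.ins = false ∧ hg τ.ins = false := by
  have key : ∀ σ : Site, σ.IsSeed → σ.ins = ⟨false, false, false, false⟩ := by
    intro σ h; cases σ <;> first | rfl | cases h
  simp [meets, hσ, hτ, key, h0, h1]

theorem Site.MeetsEast.of_isSeed {σ τ : Site} (hσ : σ.IsSeed) (hτ : τ.IsSeed) :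
    MeetsEast σ m τ n := by
  obtain ⟨h, h1, h2⟩ := meets_of_isSeed (f := Tile.east) (g := Tile.west) (hf := Faces.east)
    (hg := Faces.west) rfl rfl hσ hτ
  exact ⟨h, by simp [h1], by simp [h2]⟩

theorem Site.MeetsNorth.of_isSeed {σ τ : Site} (hσ : σ.IsSeed) (hτ : τ.IsSeed) :
    MeetsNorth σ m τ n := by
  obtain ⟨h, h1, h2⟩ := meets_of_isSeed (f := Tile.north) (g := Tile.south) (hf := Faces.north)
    (hg := Faces.south) rfl rfl hσ hτ
  exact ⟨h, by simp [h1], by simp [h2]⟩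

theorem Site.MeetsEast.of_none {σ τ : Site} (hσ : face Tile.east σ = none)
    (hτ : face Tile.west τ = none) (hσ' : σ.ins.east = false) (hτ' : τ.ins.west = false) :
    MeetsEast σ m τ n :=
  ⟨by simp [Site.meets, hσ, hτ, hσ', hτ'], by simp [hσ'], by simp [hτ']⟩

theorem Site.MeetsNorth.of_none {σ τ : Site} (hσ : face Tile.north σ = none)
    (hτ : face Tile.south τ = none) (hσ' : σ.ins.north = false) (hτ' : τ.ins.south = false) :
    MeetsNorth σ m τ n :=
  ⟨by simp [Site.meets, hσ, hτ, hσ', hτ'], by simp [hσ'], by simp [hτ']⟩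

/-- Rows 0 to 9 transport the carry into the hairpin, the rows from 10 on the carry out of it. Only
for an undecided hairpin does `skip` wait for row 9, which is filled at time `m + 9`. -/
theorem meets_left_left (hk : k < 13) (hn : s = none → m + 9 < n) :
    MeetsNorth (leftSite k s c) (leftTime k m n) (leftSite (k + 1) s c)
      (leftTime (k + 1) m n) := by
  have h : ∀ k < 13, ∀ s c, Site.meets Tile.north Tile.south Faces.north Faces.south
    (leftSite k s c) (leftSite (k + 1) s c) := by decide +kernel
  refine ⟨h k hk s c, ?_, ?_⟩ <;> clear h <;>
    interval_cases k <;> simp_all [leftSite, leftTime, ins]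

/-- The row index is cyclic, `13 + 1 = 0` in `Fin 14`, so the column continues into the next hairpin
with the same tiles. -/
theorem meets_left_top (hn : n + 3 < m') :
    MeetsNorth (leftSite 13 s c) (leftTime 13 m n) (leftSite 0 s' (s.getD c))
      (leftTime 0 m' n') := by
  have h : ∀ s s' c, Site.meets Tile.north Tile.south Faces.north Faces.south
    (leftSite 13 s c) (leftSite 0 s' (s.getD c)) := by decide +kernel
  refine ⟨h s s' c, ?_, ?_⟩ <;> clear h <;> simp_all [leftSite, leftTime, ins]

/-- The carry branches off into the arm in row 4, which the column reaches at time `m + 4`. -/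
theorem meets_left_arm_false (hv : v < 7) (hs : D.s = none) (hc : D.c = c) (hq : m + 4 < q) :
    MeetsEast (leftSite v s c) (leftTime v m n) (armSite false v 0 true D)
      (armTime false v 0 D p q) := by
  have h : ∀ v < 7, ∀ s a b c pad, Site.meets Tile.east Tile.west Faces.east Faces.west
    (leftSite v s c) (armSite false v 0 true ⟨a, b, none, c, pad⟩) := by decide +kernel
  obtain ⟨a, b, s', c', pad⟩ := D
  dsimp only at hs hc
  subst hs hc
  refine ⟨h v hv s a b _ pad, ?_, ?_⟩ <;> clear h <;> interval_cases v <;>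
    simp_all [leftSite, leftTime, armSite, armTime, ins, Faces.orient]

theorem meets_left_arm_true (hv : v < 7) (hs : D.s = s) (hp : p + 11 < n) :
    MeetsEast (leftSite (13 - v) s c) (leftTime (13 - v) m n) (armSite true v 0 true D)
      (armTime true v 0 D p q) := by
  have h : ∀ v < 7, ∀ s a b c c' pad, Site.meets Tile.east Tile.west Faces.east Faces.west
    (leftSite (13 - v) s c) (armSite true v 0 true ⟨a, b, s, c', pad⟩) := by decide +kernel
  obtain ⟨a, b, s', c', pad⟩ := D
  dsimp only at hs
  subst hs
  refine ⟨h v hv _ a b c c' pad, ?_, ?_⟩ <;> clear h <;> interval_cases v <;>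
    simp only [leftSite, leftTime, armSite, armTime] <;> (try split_ifs) <;>
    simp_all [ins, Faces.orient]

/-- Validity enters because a `node` emits `s.getD c` whereas the bend expects `c`. -/
theorem meets_arm_false_carry (hv : v < 7) (hD : D.Valid) :
    MeetsEast (armSite false v 0 false D) (armTime false v 0 D m n) (carrySite v D.s D.c)
      (carryTime v m n) := by
  have h : ∀ v < 7, ∀ a b s c pad, Option.getD s c = c →
    Site.meets Tile.east Tile.west Faces.east Faces.west
    (armSite false v 0 false ⟨a, b, s, c, pad⟩) (carrySite v s c) := by decide +kernel
  obtain ⟨a, b, s, c, pad⟩ := D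
  refine ⟨h v hv a b s c pad hD, ?_, ?_⟩ <;> clear h <;> interval_cases v <;>
    simp_all [carrySite, carryTime, armSite, armTime, ins, Faces.orient]

theorem meets_arm_true_carry (hv : v < 7) :
    MeetsEast (armSite true v 0 false D) (armTime true v 0 D m n) (carrySite (13 - v) D.s D.c)
      (carryTime (13 - v) m n) := by
  have h : ∀ v < 7, ∀ a b s c pad,
    Site.meets Tile.east Tile.west Faces.east Faces.west
    (armSite true v 0 false ⟨a, b, s, c, pad⟩) (carrySite (13 - v) s c) := by decide +kernel
  obtain ⟨a, b, s, c, pad⟩ := D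
  refine ⟨h v hv a b s c pad, ?_, ?_⟩ <;> clear h <;> interval_cases v <;>
    simp_all [carrySite, carryTime, armSite, armTime, ins, Faces.orient]

theorem meets_carry_rel (hk : k < 14) :
    MeetsEast (carrySite k s c) (carryTime k m n) (relSite k s) (relTime k m) := by
  have h : ∀ k < 14, ∀ s c, Site.meets Tile.east Tile.west Faces.east Faces.west
    (carrySite k s c) (relSite k s) := by decide +kernel
  refine ⟨h k hk s c, ?_, ?_⟩ <;> clear h <;>
    interval_cases k <;> simp_all [carrySite, carryTime, relSite, relTime, ins, Faces.orient]

theorem meets_rel_wall (hk : k < 14) :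
    MeetsEast (relSite k s) m (wallSite k) n := by
  have h : ∀ k < 14, ∀ s, Site.meets Tile.east Tile.west Faces.east Faces.west
    (relSite k s) (wallSite k) := by decide +kernel
  refine ⟨h k hk s, ?_, ?_⟩ <;> clear h <;>
    interval_cases k <;> simp_all [relSite, wallSite, ins, Faces.orient]

theorem meets_carry_carry (hk : k < 13) (hn : m < n) :
    MeetsNorth (carrySite k s c) (carryTime k m n) (carrySite (k + 1) s c)
      (carryTime (k + 1) m n) := by
  have h : ∀ k < 13, ∀ s c, Site.meets Tile.north Tile.south Faces.north Faces.south
    (carrySite k s c) (carrySite (k + 1) s c) := by decide +kernel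
  refine ⟨h k hk s c, ?_, ?_⟩ <;> clear h <;>
    interval_cases k <;> simp_all [carrySite, carryTime, ins, Faces.orient]

theorem meets_rel_rel (hk : k < 13) :
    MeetsNorth (relSite k s) (relTime k m) (relSite (k + 1) s) (relTime (k + 1) m) := by
  have h : ∀ k < 13, ∀ s, Site.meets Tile.north Tile.south Faces.north Faces.south
    (relSite k s) (relSite (k + 1) s) := by decide +kernel
  refine ⟨h k hk s, ?_, ?_⟩ <;> clear h <;>
    interval_cases k <;> simp_all [relSite, relTime, ins, Faces.orient]

theorem isSeed_wallSite : (wallSite k).IsSeed := by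
  unfold wallSite
  split_ifs <;> rfl

/-- The innermost rows hold no tiles, so the two arms of a hairpin do not interact there. -/
theorem meets_arm_arm (hj : j < 3) (hj' : j' < 3) :
    MeetsNorth (armSite false 6 j e D) m (armSite true 6 j' e' D') n := by
  apply MeetsNorth.of_none <;> interval_cases j <;> interval_cases j' <;> rfl

end Boundary
/-- The parameters of an adder of `L` hairpins with arms of `L` positions each: the values at the
`i`-th position of the `r`-th hairpin and the times at which the relative and absolute carries
arrive there, the time at which the carry into the `r`-th hairpin arrives, and the time at which
the carry out of it is known. -/
structure Layout where
  L : ℕ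
  datum : ℕ → ℕ → Datum
  relArrival : ℕ → ℕ → ℕ
  arrival : ℕ → ℕ → ℕ
  entry : ℕ → ℕ
  known : ℕ → ℕ

/-! ### The stack of hairpins in the plane and its adjacencies. -/

namespace Layout

variable (P : Layout)

/-- The values and times of a layout fit together. -/
structure Coherent : Prop where
  pos : 0 < P.L
  valid : ∀ r i, (P.datum r i).Valid
  next : ∀ r i, i < 2 * P.L → (P.datum r i).Next (P.datum r (i + 1))
  start : ∀ r, (P.datum r 0).s = none
  pad : ∀ r i, (P.datum r i).pad → (P.datum r i).a = false ∧ (P.datum r i).b = false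
  carry : ∀ r, (P.datum (r + 1) 0).c = (P.datum r (2 * P.L)).s.getD (P.datum r 0).c
  zero : (P.datum 0 0).c = false
  relArrival_pos : ∀ r i, 1 ≤ P.relArrival r i
  relArrival_lt : ∀ r i, P.relArrival r i < P.arrival r i
  relArrival_succ : ∀ r i, i < 2 * P.L → P.relArrival r (i + 1) =
    if (P.datum r i).type = none then P.relArrival r i + 3 else 4
  arrival_succ : ∀ r i, i < 2 * P.L → (P.datum r (i + 1)).s = none →
    P.arrival r (i + 1) = P.arrival r i + 3
  entry_pos : 0 < P.entry 0
  entry_lt : ∀ r, P.entry r + 4 < P.arrival r 0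
  relArrival_lt_known : ∀ r, P.relArrival r (2 * P.L) + 11 < P.known r
  entry_lt_known : ∀ r, (P.datum r (2 * P.L)).s = none → P.entry r + 9 < P.known r
  known_lt : ∀ r, P.known r + 3 < P.entry (r + 1)

/-- The index of the position that occupies the `u`-th column of the arm `d`. -/
def index (d : Bool) (u : ℕ) : ℕ := (if d then P.L else 0) + u / 3

/-- The place in the `u`-th column of row `v` of the arm `d` of the `r`-th hairpin. -/
def arm (r : ℕ) (d : Bool) (v u : ℕ) : Site :=
  armSite d v (u % 3) (u = if d then 3 * P.L else 0) (P.datum r (P.index d u))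

/-- The time at which `P.arm r d v u` is filled. -/
def armAt (r : ℕ) (d : Bool) (v u : ℕ) : ℕ :=
  armTime d v (u % 3) (P.datum r (P.index d u)) (P.relArrival r (P.index d u))
    (P.arrival r (P.index d u))

/-- The place in column `x` and row `k` of the `r`-th hairpin. -/
def block (r k : ℕ) (x : ℤ) : Site :=
  if x = -1 then leftSite k (P.datum r (2 * P.L)).s (P.datum r 0).c
  else if 0 ≤ x ∧ x ≤ 3 * P.L then
    if k < 7 then P.arm r false k x.toNat else P.arm r true (13 - k) (3 * P.L - x).toNat
  else if x = 3 * P.L + 1 then carrySite k (P.datum r P.L).s (P.datum r P.L).c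
  else if x = 3 * P.L + 2 then relSite k (P.datum r P.L).s
  else if x = 3 * P.L + 3 then wallSite k
  else void

/-- The time at which `P.block r k x` is filled. -/
def blockAt (r k : ℕ) (x : ℤ) : ℕ :=
  if x = -1 then leftTime k (P.entry r) (P.known r)
  else if 0 ≤ x ∧ x ≤ 3 * P.L then
    if k < 7 then P.armAt r false k x.toNat else P.armAt r true (13 - k) (3 * P.L - x).toNat
  else if x = 3 * P.L + 1 then carryTime k (P.relArrival r P.L) (P.arrival r P.L)
  else if x = 3 * P.L + 2 then relTime k (P.relArrival r P.L)
  else 0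

/-- The place in column `x` of the row below or above all hairpins. -/
def cap (top : Bool) (x : ℤ) : Site :=
  if x = -1 then if top then frame false true false false else source
  else if 0 ≤ x ∧ x ≤ 3 * P.L + 2 then frame false true false true
  else if x = 3 * P.L + 3 then frame (!top) false top true
  else void

/-- The place at a point. -/
def site (x y : ℤ) : Site :=
  if y = -1 then P.cap false x
  else if y = 14 * P.L then P.cap true x
  else if 0 ≤ y ∧ y < 14 * P.L then P.block (y / 14).toNat (y % 14).toNat x
  else void

/-- The time at which the place at a point is filled. -/
def time (x y : ℤ) : ℕ :=
  if 0 ≤ y ∧ y < 14 * P.L then P.blockAt (y / 14).toNat (y % 14).toNat x else 0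

variable {P}

theorem inRange_site (x y : ℤ) : (P.site x y).InRange := by
  unfold site cap block arm
  split_ifs <;> first
    | rfl | exact inRange_leftSite (by omega) | exact inRange_armSite
    | exact inRange_carrySite | exact inRange_relSite | exact inRange_wallSite

theorem site_of_block {x y : ℤ} {r k : ℕ} (hr : r < P.L) (hk : k < 14) (hy : y = 14 * r + k) :
    P.site x y = P.block r k x := by
  have h1 : (y / 14).toNat = r := by omega
  have h2 : (y % 14).toNat = k := by omega
  unfold site
  rw [if_neg (by omega), if_neg (by omega), if_pos (by omega), h1, h2]

theorem time_of_block {x y : ℤ} {r k : ℕ} (hr : r < P.L) (hk : k < 14) (hy : y = 14 * r + k) :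
    P.time x y = P.blockAt r k x := by
  have h1 : (y / 14).toNat = r := by omega
  have h2 : (y % 14).toNat = k := by omega
  unfold time
  rw [if_pos (by omega), h1, h2]

theorem meets_arm_front (C : P.Coherent) (r : ℕ) (d : Bool) {v u : ℕ} (hv : v < 7)
    (hu : u < 3 * P.L) :
    MeetsFront d (P.arm r d v u) (P.armAt r d v u) (P.arm r d v (u + 1))
      (P.armAt r d v (u + 1)) := by
  obtain ⟨i, j, hj, rfl⟩ : ∃ i j, j < 3 ∧ u = 3 * i + j := ⟨u / 3, u % 3, by omega, by omega⟩
  have hC := C.pos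
  unfold arm armAt index
  interval_cases j
  · have h1 : (3 * i + 0) % 3 = 0 := by omega
    have h2 : (3 * i + 0 + 1) % 3 = 1 := by omega
    have h3 : (3 * i + 0) / 3 = i := by omega
    have h4 : (3 * i + 0 + 1) / 3 = i := by omega
    have h5 : decide (3 * i + 0 + 1 = if d then 3 * P.L else 0) = false := by
      cases d <;> grind
    rw [h1, h2, h3, h4, h5]
    refine meets_arm_zero_one hv (fun h => ?_) (C.valid _ _)
    cases d
    · simp only [decide_eq_true_eq] at h
      have : i = 0 := by simpa using h
      subst this
      exact ⟨rfl, C.start r⟩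
    · simp at h; omega
  · have h1 : (3 * i + 1) % 3 = 1 := by omega
    have h2 : (3 * i + 1 + 1) % 3 = 2 := by omega
    have h3 : (3 * i + 1) / 3 = i := by omega
    have h4 : (3 * i + 1 + 1) / 3 = i := by omega
    have h5 : decide (3 * i + 1 + 1 = if d then 3 * P.L else 0) = false := by
      cases d <;> grind
    have h6 : decide (3 * i + 1 = if d then 3 * P.L else 0) = false := by
      cases d <;> grind
    rw [h1, h2, h3, h4, h5, h6]
    exact meets_arm_one_two hv
  · have h1 : (3 * i + 2) % 3 = 2 := by omega
    have h2 : (3 * i + 2 + 1) % 3 = 0 := by omega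
    have h3 : (3 * i + 2) / 3 = i := by omega
    have h4 : (3 * i + 2 + 1) / 3 = i + 1 := by omega
    have h6 : decide (3 * i + 2 = if d then 3 * P.L else 0) = false := by
      cases d <;> grind
    rw [h1, h2, h3, h4, h6, ← add_assoc]
    have hi : (if d then P.L else 0) + i < 2 * P.L := by cases d <;> grind
    refine meets_arm_two_zero hv (fun h => ?_) (C.next _ _ hi) (C.relArrival_succ _ _ hi)
      (C.arrival_succ _ _ hi)
    cases d
    · simp at h
    · rfl

theorem meets_arm_in (C : P.Coherent) (r : ℕ) (d : Bool) {v u : ℕ} (hv : v < 6) :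
    MeetsInner d (P.arm r d v u) (P.armAt r d v u) (P.arm r d (v + 1) u)
      (P.armAt r d (v + 1) u) := by
  refine meets_arm_inner hv (by omega) (fun h => ?_) (C.pad _ _) (C.relArrival_pos _ _)
    (C.relArrival_lt _ _)
  cases d
  · simp at h
    subst h
    exact C.start r
  · simp at h

theorem block_left (r k : ℕ) :
    P.block r k (-1) = leftSite k (P.datum r (2 * P.L)).s (P.datum r 0).c ∧
      P.blockAt r k (-1) = leftTime k (P.entry r) (P.known r) :=
  ⟨rfl, rfl⟩

theorem block_arm_false (r : ℕ) {k u : ℕ} (hk : k < 7) (hu : u ≤ 3 * P.L) {x : ℤ} (hx : x = u) :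
    P.block r k x = P.arm r false k u ∧ P.blockAt r k x = P.armAt r false k u := by
  have h : x.toNat = u := by omega
  constructor
  · unfold block
    rw [if_neg (by omega), if_pos (by omega), if_pos hk, h]
  · unfold blockAt
    rw [if_neg (by omega), if_pos (by omega), if_pos hk, h]

theorem block_arm_true (r : ℕ) {k u : ℕ} (hk : 7 ≤ k) (hu : u ≤ 3 * P.L) {x : ℤ}
    (hx : x = 3 * P.L - u) :
    P.block r k x = P.arm r true (13 - k) u ∧ P.blockAt r k x = P.armAt r true (13 - k) u := by
  have h : (3 * P.L - x).toNat = u := by omega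
  constructor
  · unfold block
    rw [if_neg (by omega), if_pos (by omega), if_neg (by omega), h]
  · unfold blockAt
    rw [if_neg (by omega), if_pos (by omega), if_neg (by omega), h]

theorem block_carry (r k : ℕ) {x : ℤ} (hx : x = 3 * P.L + 1) :
    P.block r k x = carrySite k (P.datum r P.L).s (P.datum r P.L).c ∧
      P.blockAt r k x = carryTime k (P.relArrival r P.L) (P.arrival r P.L) := by
  constructor
  · unfold block
    rw [if_neg (by omega), if_neg (by omega), if_pos hx]
  · unfold blockAt
    rw [if_neg (by omega), if_neg (by omega), if_pos hx]

theorem block_rel (r k : ℕ) {x : ℤ} (hx : x = 3 * P.L + 2) :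
    P.block r k x = relSite k (P.datum r P.L).s ∧
      P.blockAt r k x = relTime k (P.relArrival r P.L) := by
  constructor
  · unfold block
    rw [if_neg (by omega), if_neg (by omega), if_neg (by omega), if_pos hx]
  · unfold blockAt
    rw [if_neg (by omega), if_neg (by omega), if_neg (by omega), if_pos hx]

theorem block_wall (r k : ℕ) {x : ℤ} (hx : x = 3 * P.L + 3) : P.block r k x = wallSite k := by
  unfold block
  rw [if_neg (by omega), if_neg (by omega), if_neg (by omega), if_neg (by omega), if_pos hx]

theorem block_eq_void {r k : ℕ} {x : ℤ} (h : x < -1 ∨ 3 * P.L + 3 < x) :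
    P.block r k x = void := by
  unfold block
  rw [if_neg (by omega), if_neg (by omega), if_neg (by omega), if_neg (by omega),
    if_neg (by omega)]

theorem meetsEast_block (C : P.Coherent) (r : ℕ) {k : ℕ} (hk : k < 14) (x : ℤ) :
    MeetsEast (P.block r k x) (P.blockAt r k x) (P.block r k (x + 1))
      (P.blockAt r k (x + 1)) := by
  have hC := C.pos
  rcases lt_or_ge x (-2) with h | h
  · rw [block_eq_void (x := x) (by omega), block_eq_void (x := x + 1) (by omega)]
    exact .of_none rfl rfl rfl rfl
  rcases eq_or_lt_of_le h with rfl | h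
  · rw [block_eq_void (by omega), show (-2 : ℤ) + 1 = -1 by rfl, (block_left r k).1]
    have hL : ∀ {s c}, face Tile.west (leftSite k s c) = none ∧
        (leftSite k s c).ins.west = false := by
      intro s c
      unfold leftSite
      split_ifs <;> simp [face, tile, ins]
    exact .of_none rfl hL.1 rfl hL.2
  rcases eq_or_lt_of_le (show -1 ≤ x by omega) with rfl | h
  · rw [(block_left r k).1, (block_left r k).2]
    rcases Nat.lt_or_ge k 7 with h7 | h7
    · obtain ⟨e1, e2⟩ := block_arm_false (P := P) r h7 (u := 0) (by omega) (x := -1 + 1) rfl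
      rw [e1, e2]
      have := meets_left_arm_false (s := (P.datum r (2 * P.L)).s) (m := P.entry r)
        (n := P.known r) (p := P.relArrival r 0) h7 (C.start r) rfl (C.entry_lt r)
      simpa [arm, armAt, index] using this
    · obtain ⟨e1, e2⟩ := block_arm_true (P := P) r h7 (u := 3 * P.L) (by omega) (x := -1 + 1)
        (by omega)
      rw [e1, e2]
      obtain ⟨v, hv, rfl⟩ : ∃ v, v < 7 ∧ k = 13 - v := ⟨13 - k, by omega, by omega⟩
      have hv' : 13 - (13 - v) = v := by omega
      -- The last column of the upper arm is column 0 of position `2 * P.L`, whose relative carry is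
      -- the one out of the hairpin.
      have hi : P.L + P.L = 2 * P.L := by omega
      have hj : 3 * P.L % 3 = 0 := by omega
      have := meets_left_arm_true (c := (P.datum r 0).c) (m := P.entry r)
        (q := P.arrival r (2 * P.L)) hv (D := P.datum r (2 * P.L)) rfl (C.relArrival_lt_known r)
      rw [hv']
      simpa [arm, armAt, index, hi, hj] using this
  rcases lt_or_ge x (3 * P.L) with h' | h'
  · rcases Nat.lt_or_ge k 7 with h7 | h7
    · obtain ⟨e1, e2⟩ := block_arm_false (P := P) r h7 (u := x.toNat) (by omega) (x := x)
        (by omega)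
      obtain ⟨e3, e4⟩ := block_arm_false (P := P) r h7 (u := x.toNat + 1) (by omega) (x := x + 1)
        (by omega)
      rw [e1, e2, e3, e4]
      have := meets_arm_front C r false h7 (u := x.toNat) (by omega)
      simpa [MeetsFront] using this
    · obtain ⟨e1, e2⟩ := block_arm_true (P := P) r h7 (u := (3 * P.L - (x + 1)).toNat + 1)
        (by omega) (x := x) (by omega)
      obtain ⟨e3, e4⟩ := block_arm_true (P := P) r h7 (u := (3 * P.L - (x + 1)).toNat)
        (by omega) (x := x + 1) (by omega)
      rw [e1, e2, e3, e4]
      have := meets_arm_front C r true (v := 13 - k) (by omega)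
        (u := (3 * P.L - (x + 1)).toNat) (by omega)
      simpa [MeetsFront] using this
  rcases eq_or_lt_of_le h' with rfl | h''
  · obtain ⟨e3, e4⟩ := block_carry (P := P) r k rfl
    rw [e3, e4]
    -- Both ends of the turn belong to position `P.L`: the lower arm ends with its column 0 and the
    -- upper arm begins with it.
    have hi : 3 * P.L / 3 = P.L := by omega
    have hj : 3 * P.L % 3 = 0 := by omega
    rcases Nat.lt_or_ge k 7 with h7 | h7
    · obtain ⟨e1, e2⟩ := block_arm_false (P := P) r h7 (u := 3 * P.L) (by omega)
        (x := 3 * P.L) (by omega)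
      rw [e1, e2]
      have := meets_arm_false_carry (m := P.relArrival r P.L) (n := P.arrival r P.L) h7
        (C.valid r P.L)
      have he : decide (P.L = 0) = false := by simpa using hC.ne'
      simpa [arm, armAt, index, hi, hj, he] using this
    · obtain ⟨e1, e2⟩ := block_arm_true (P := P) r h7 (u := 0) (by omega) (x := 3 * P.L)
        (by omega)
      rw [e1, e2]
      obtain ⟨v, hv, rfl⟩ : ∃ v, v < 7 ∧ k = 13 - v := ⟨13 - k, by omega, by omega⟩
      have hv' : 13 - (13 - v) = v := by omega
      have he : decide (P.L = 0) = false := by simpa using hC.ne'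
      have := meets_arm_true_carry (m := P.relArrival r P.L) (n := P.arrival r P.L)
        (D := P.datum r P.L) hv
      rw [hv']
      simpa [arm, armAt, index, he] using this
  rcases eq_or_lt_of_le (show 3 * P.L + 1 ≤ x by omega) with rfl | h3
  · obtain ⟨e1, e2⟩ := block_carry (P := P) r k rfl
    obtain ⟨e3, e4⟩ := block_rel (P := P) r k (x := 3 * P.L + 1 + 1) (by omega)
    rw [e1, e2, e3, e4]
    exact meets_carry_rel hk
  rcases eq_or_lt_of_le (show 3 * P.L + 2 ≤ x by omega) with rfl | h4
  · rw [(block_rel (P := P) r k rfl).1, block_wall (P := P) r k (x := 3 * P.L + 2 + 1) (by omega)]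
    exact meets_rel_wall hk
  rw [block_eq_void (x := x + 1) (by omega)]
  rcases eq_or_lt_of_le (show 3 * P.L + 3 ≤ x by omega) with rfl | h5
  · rw [block_wall r k rfl]
    have hW : face Tile.east (wallSite k) = none ∧ (wallSite k).ins.east = false := by
      unfold wallSite
      split_ifs <;> simp [face, tile, ins, frameFace]
    exact .of_none hW.1 rfl hW.2 rfl
  · rw [block_eq_void (by omega)]
    exact .of_none rfl rfl rfl rfl

theorem meetsNorth_block (C : P.Coherent) (r : ℕ) {k : ℕ} (hk : k < 13) (x : ℤ) :
    MeetsNorth (P.block r k x) (P.blockAt r k x) (P.block r (k + 1) x)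
      (P.blockAt r (k + 1) x) := by
  unfold block blockAt
  split_ifs with h1 h2 h3 h4 h5 h6 h7
  · exact meets_left_left hk (C.entry_lt_known r)
  · have := meets_arm_in C r false (v := k) (u := x.toNat) (by omega)
    simpa [MeetsInner] using this
  · obtain rfl : k = 6 := by omega
    exact meets_arm_arm (by omega) (by omega)
  · omega
  · have := meets_arm_in C r true (v := 13 - (k + 1)) (u := (3 * P.L - x).toNat) (by omega)
    have e : 13 - (k + 1) + 1 = 13 - k := by omega
    rw [e] at this
    simpa [MeetsInner] using this
  · exact meets_carry_carry hk (C.relArrival_lt r _)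
  · exact meets_rel_rel hk
  · exact .of_isSeed isSeed_wallSite isSeed_wallSite
  · exact .of_none rfl rfl rfl rfl

/-- The edge rows of a hairpin belong to the seed, but for the column of carries. -/
theorem isSeed_block {r k : ℕ} (hk : k = 0 ∨ k = 13) {x : ℤ} (h0 : 0 ≤ x) (h1 : x ≤ 3 * P.L + 3) :
    (P.block r k x).IsSeed := by
  unfold block
  split_ifs with h2 h3 h4 h5 h6 h7
  · omega
  · obtain rfl : k = 0 := by omega
    rfl
  · obtain rfl : k = 13 := by omega
    rfl
  · rcases hk with rfl | rfl <;> rfl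
  · rcases hk with rfl | rfl <;> rfl
  · exact isSeed_wallSite
  · omega

theorem cap_eq_void {t : Bool} {x : ℤ} (h : x < -1 ∨ 3 * P.L + 3 < x) : P.cap t x = void := by
  unfold cap
  rw [if_neg (by omega), if_neg (by omega), if_neg (by omega)]

theorem isSeed_cap {t : Bool} {x : ℤ} (h0 : -1 ≤ x) (h1 : x ≤ 3 * P.L + 3) :
    (P.cap t x).IsSeed := by
  unfold cap
  split_ifs <;> first | rfl | omega

theorem meetsEast (C : P.Coherent) (x y : ℤ) :
    MeetsEast (P.site x y) (P.time x y) (P.site (x + 1) y) (P.time (x + 1) y) := by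
  by_cases hy : 0 ≤ y ∧ y < 14 * P.L
  · obtain ⟨r, k, hr, hk, rfl⟩ : ∃ r k : ℕ, r < P.L ∧ k < 14 ∧ y = 14 * r + k :=
      ⟨(y / 14).toNat, (y % 14).toNat, by omega, by omega, by omega⟩
    rw [site_of_block hr hk rfl, site_of_block hr hk rfl, time_of_block hr hk rfl,
      time_of_block hr hk rfl]
    exact meetsEast_block C r hk x
  have hcap : ∀ t, MeetsEast (P.cap t x) (P.time x y) (P.cap t (x + 1)) (P.time (x + 1) y) := by
    intro t
    rcases lt_or_ge x (-2) with h | h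
    · rw [cap_eq_void (by omega), cap_eq_void (by omega)]
      exact .of_none rfl rfl rfl rfl
    rcases eq_or_lt_of_le h with h | h
    · subst h
      rw [cap_eq_void (by omega)]
      cases t <;> exact .of_none rfl rfl rfl rfl
    rcases lt_or_ge x (3 * P.L + 3) with h' | h'
    · exact .of_isSeed (isSeed_cap (by omega) (by omega)) (isSeed_cap (by omega) (by omega))
    rw [cap_eq_void (x := x + 1) (by omega)]
    rcases eq_or_lt_of_le h' with h' | h'
    · subst h'
      unfold cap
      rw [if_neg (by omega), if_neg (by omega), if_pos rfl]
      exact .of_none rfl rfl rfl rfl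
    · rw [cap_eq_void (by omega)]
      exact .of_none rfl rfl rfl rfl
  unfold site
  split_ifs with h1 h2
  · exact hcap _
  · exact hcap _
  · exact .of_none rfl rfl rfl rfl

theorem meetsNorth (C : P.Coherent) (x y : ℤ) :
    MeetsNorth (P.site x y) (P.time x y) (P.site x (y + 1)) (P.time x (y + 1)) := by
  have hC := C.pos
  by_cases hx : x < -1 ∨ 3 * P.L + 3 < x
  · have h : ∀ y, P.site x y = void := by
      intro y
      unfold site
      rw [cap_eq_void hx, cap_eq_void hx, block_eq_void hx]
      simp
    rw [h, h]
    exact .of_none rfl rfl rfl rfl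
  rcases lt_or_ge y (-1) with hy | hy
  · have h1 : P.site x y = void := by
      unfold site
      rw [if_neg (by omega), if_neg (by omega), if_neg (by omega)]
    rw [h1]
    rcases eq_or_ne y (-2) with rfl | hy'
    · have h2 : P.site x (-2 + 1) = P.cap false x := rfl
      rw [h2]
      unfold cap
      split_ifs <;> exact .of_none rfl rfl rfl rfl
    · have h1 : P.site x (y + 1) = void := by
        unfold site
        rw [if_neg (by omega), if_neg (by omega), if_neg (by omega)]
      rw [h1]
      exact .of_none rfl rfl rfl rfl
  rcases eq_or_lt_of_le hy with hy | hy
  · subst hy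
    have h2 : P.site x (-1) = P.cap false x := rfl
    rw [h2, site_of_block (y := -1 + 1) (r := 0) (k := 0) hC (by omega) (by simp)]
    rcases eq_or_ne x (-1) with rfl | hx'
    · have h3 : P.block 0 0 (-1) = column 0 false := by
        change column 0 (P.datum 0 0).c = _
        rw [C.zero]
      have h4 : P.blockAt 0 0 (-1) = P.entry 0 := rfl
      have h5 : P.cap false (-1) = source := rfl
      have h6 : P.time (-1) (-1) = 0 := rfl
      have h7 : P.time (-1) (-1 + 1) = P.entry 0 := by
        rw [time_of_block (r := 0) (k := 0) hC (by omega) (by simp), h4]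
      rw [h3, h7, h5, h6]
      exact ⟨by decide, by simp [ins], fun _ => C.entry_pos⟩
    · exact .of_isSeed (isSeed_cap (by omega) (by omega))
        (isSeed_block (Or.inl rfl) (by omega) (by omega))
  rcases lt_or_ge (y + 1) (14 * P.L) with hy' | hy'
  · obtain ⟨r, k, hr, hk, rfl⟩ : ∃ r k : ℕ, r < P.L ∧ k < 14 ∧ y = 14 * r + k :=
      ⟨(y / 14).toNat, (y % 14).toNat, by omega, by omega, by omega⟩
    rw [site_of_block hr hk rfl, time_of_block hr hk rfl]
    rcases Nat.lt_or_ge k 13 with hk' | hk'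
    · rw [site_of_block (k := k + 1) hr (by omega) (by push_cast; ring),
        time_of_block (k := k + 1) hr (by omega) (by push_cast; ring)]
      exact meetsNorth_block C r hk' x
    · obtain rfl : k = 13 := by omega
      rw [site_of_block (r := r + 1) (k := 0) (by omega) (by omega) (by push_cast; ring),
        time_of_block (r := r + 1) (k := 0) (by omega) (by omega) (by push_cast; ring)]
      rcases eq_or_ne x (-1) with rfl | hx'
      · have := meets_left_top (s := (P.datum r (2 * P.L)).s) (m := P.entry r)
          (n' := P.known (r + 1))
          (s' := (P.datum (r + 1) (2 * P.L)).s) (c := (P.datum r 0).c) (C.known_lt r)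
        rw [← C.carry r] at this
        exact this
      · exact .of_isSeed (isSeed_block (Or.inr rfl) (by omega) (by omega))
          (isSeed_block (Or.inl rfl) (by omega) (by omega))
  have hcapN : face Tile.north (P.cap true x) = none := by
    unfold cap
    split_ifs <;> first | rfl | simp_all
  have hcapN' : (P.cap true x).ins.north = false := by
    unfold cap
    split_ifs <;> rfl
  have hvoid : ∀ y : ℤ, 14 * P.L < y → P.site x y = void := by
    intro y hy
    unfold site
    rw [if_neg (by omega), if_neg (by omega), if_neg (by omega)]
  have htop : P.site x (14 * P.L) = P.cap true x := by
    unfold site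
    rw [if_neg (by omega), if_pos rfl]
  rcases eq_or_lt_of_le hy' with hy' | hy'
  · rw [← hy', htop, site_of_block (r := P.L - 1) (k := 13) (by omega) (by omega) (by omega),
      time_of_block (r := P.L - 1) (k := 13) (y := y) (by omega) (by omega) (by omega)]
    rcases eq_or_ne x (-1) with rfl | hx'
    -- The column of the topmost hairpin ends below a frame tile, so its last glue does not face an
    -- empty point.
    · have h1 : ∀ s c, Site.meets Tile.north Tile.south Faces.north Faces.south
        (leftSite 13 s c) (frame false true false false) := by decide +kernel
      exact ⟨h1 _ _, by simp [block, leftSite, ins], by simp [cap, ins]⟩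
    · exact .of_isSeed (isSeed_block (Or.inr rfl) (by omega) (by omega))
        (isSeed_cap (by omega) (by omega))
  · rw [hvoid (y + 1) (by omega)]
    rcases eq_or_lt_of_le (show 14 * P.L ≤ y by omega) with h | h
    · subst h
      rw [htop]
      exact .of_none hcapN rfl hcapN' rfl
    · rw [hvoid y h]
      exact .of_none rfl rfl rfl rfl

end Layout
theorem weight_mk (str : Glue → ℕ) (A : ℤ × ℤ → Option (Tile Glue)) (x y : ℤ) (t : Tile Glue) :
    weight str A (x, y) t = contact str t.north ((A (x, y + 1)).bind Tile.south) +
      contact str t.east ((A (x + 1, y)).bind Tile.west) +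
      contact str t.south ((A (x, y - 1)).bind Tile.north) +
      contact str t.west ((A (x - 1, y)).bind Tile.east) := by
  unfold weight
  rw [Prod.mk_add_mk, Prod.mk_add_mk, Prod.mk_add_mk, Prod.mk_add_mk, add_zero, add_zero,
    ← sub_eq_add_neg, ← sub_eq_add_neg]

/-- The tiles of the adder. -/
def tileSet : Finset (Tile Glue) := (all.filterMap tile).toFinset

theorem mem_tileSet {t : Tile Glue} : t ∈ tileSet ↔ ∃ σ ∈ all, σ.tile = some t := by
  simp [tileSet]

theorem Site.ins_of_isSeed {σ : Site} (h : σ.IsSeed) : σ.ins = ⟨false, false, false, false⟩ := by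
  cases σ <;> first | rfl | cases h

theorem Site.tile_ne_none_of_isSeed {σ : Site} (h : σ.IsSeed) : σ.tile ≠ none := by
  cases σ <;> first | exact Option.some_ne_none _ | cases h

/-! ### The certificate of a coherent layout. -/

namespace Layout

variable (P : Layout)

/-- The tile at a point of the final assembly. -/
def tileAt (p : ℤ × ℤ) : Option (Tile Glue) := (P.site p.1 p.2).tile

variable {P}

theorem site_eq_void {x y : ℤ} (h : x < -1 ∨ 3 * P.L + 3 < x ∨ y < -1 ∨ 14 * P.L < y) :
    P.site x y = void := by
  unfold site
  by_cases hx : x < -1 ∨ 3 * P.L + 3 < x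
  · rw [cap_eq_void hx, cap_eq_void hx, block_eq_void hx]
    simp
  · rw [if_neg (by omega), if_neg (by omega), if_neg (by omega)]

theorem mem_box_of_site {x y : ℤ} (h : P.site x y ≠ void) :
    (x, y) ∈ Set.Icc (-1 : ℤ) (3 * P.L + 3) ×ˢ Set.Icc (-1 : ℤ) (14 * P.L) := by
  by_contra hc
  apply h
  apply site_eq_void
  simp only [Set.mem_prod, Set.mem_Icc] at hc
  omega

variable (P)

/-- The final assembly. -/
def assembly : Assembly Glue where
  tile := P.tileAt
  finite := by
    refine ((Set.finite_Icc (-1 : ℤ) (3 * P.L + 3)).prod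
      (Set.finite_Icc (-1 : ℤ) (14 * P.L))).subset fun p hp => ?_
    exact mem_box_of_site fun h => hp (by rw [tileAt, h]; rfl)

/-- The part of the final assembly that belongs to the seed. -/
def seedAt (p : ℤ × ℤ) : Option (Tile Glue) :=
  if (P.site p.1 p.2).IsSeed then P.tileAt p else none

/-- The tile at `q` attaches only after the one at the neighbouring point `p`. -/
def dep (q p : ℤ × ℤ) : Prop :=
  (p = q + (0, 1) ∧ (P.site q.1 q.2).ins.north) ∨ (p = q + (1, 0) ∧ (P.site q.1 q.2).ins.east) ∨
  (p = q + (0, -1) ∧ (P.site q.1 q.2).ins.south) ∨ (p = q + (-1, 0) ∧ (P.site q.1 q.2).ins.west)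

variable {P}

theorem meetsSouth (C : P.Coherent) (x y : ℤ) :
    MeetsNorth (P.site x (y - 1)) (P.time x (y - 1)) (P.site x y) (P.time x y) := by
  simpa using meetsNorth C x (y - 1)

theorem meetsWest (C : P.Coherent) (x y : ℤ) :
    MeetsEast (P.site (x - 1) y) (P.time (x - 1) y) (P.site x y) (P.time x y) := by
  simpa using meetsEast C (x - 1) y

/-- A neighbour that is present shows either nothing or the expected glue, so the latter dominates
the bond available through this face. -/
theorem contact_le_of_view {A : ℤ × ℤ → Option (Tile Glue)} (hA : Sub A P.tileAt) {q : ℤ × ℤ}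
    {f : Tile Glue → Option Glue} {a b : Option Glue}
    (h : A q ≠ none → face f (P.site q.1 q.2) = none ∨ face f (P.site q.1 q.2) = b) :
    contact strength a ((A q).bind f) ≤ contact strength a b := by
  cases hq : A q with
  | none => simp [contact_none_right]
  | some u =>
    have hu : face f (P.site q.1 q.2) = f u := by
      have := hA q u hq
      rw [tileAt] at this
      rw [face, this]
      rfl
    rcases h (by simp [hq]) with h | h
    · rw [hu] at h
      simp [h, contact_none_right]
    · rw [hu] at h
      simp [h]

section View

variable (C : P.Coherent) {A : ℤ × ℤ → Option (Tile Glue)} (hA : Sub A P.tileAt)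
  (hcl : Closed P.dep A) {x y : ℤ} (hp : A (x, y) = none) (hs : (P.site x y).IsSeed = false)

include C hA hcl hp hs

/-- A neighbour held by its face towards the empty point cannot be there, by closedness. For every
other neighbour, `meets` guarantees that the view accounts for its glue. The other three directions
are alike. -/
theorem contact_north_le (a : Option Glue) :
    contact strength a ((A (x, y + 1)).bind Tile.south) ≤
      contact strength a (P.site x y).view.north := by
  refine contact_le_of_view hA fun hq => ?_
  have h := (meetsNorth C x y).meets
  simp only [Site.meets, hs, Bool.and_eq_true, Bool.or_eq_true, decide_eq_true_eq] at h
  rcases h.1.1.1 with ((h | h) | h) | h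
  · cases h
  · exact absurd hp (hcl (x, y + 1) (x, y) hq (by simp [dep, h]))
  · exact Or.inl h
  · exact Or.inr h

theorem contact_east_le (a : Option Glue) :
    contact strength a ((A (x + 1, y)).bind Tile.west) ≤
      contact strength a (P.site x y).view.east := by
  refine contact_le_of_view hA fun hq => ?_
  have h := (meetsEast C x y).meets
  simp only [Site.meets, hs, Bool.and_eq_true, Bool.or_eq_true, decide_eq_true_eq] at h
  rcases h.1.1.1 with ((h | h) | h) | h
  · cases h
  · exact absurd hp (hcl (x + 1, y) (x, y) hq (by simp [dep, h]))
  · exact Or.inl h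
  · exact Or.inr h

theorem contact_south_le (a : Option Glue) :
    contact strength a ((A (x, y - 1)).bind Tile.north) ≤
      contact strength a (P.site x y).view.south := by
  refine contact_le_of_view hA fun hq => ?_
  have h := (meetsSouth C x y).meets
  simp only [Site.meets, hs, Bool.and_eq_true, Bool.or_eq_true, decide_eq_true_eq] at h
  rcases h.1.1.2 with ((h | h) | h) | h
  · cases h
  · exact absurd hp (hcl (x, y - 1) (x, y) hq (by simp [dep, h]))
  · exact Or.inl h
  · exact Or.inr h

theorem contact_west_le (a : Option Glue) :
    contact strength a ((A (x - 1, y)).bind Tile.east) ≤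
      contact strength a (P.site x y).view.west := by
  refine contact_le_of_view hA fun hq => ?_
  have h := (meetsWest C x y).meets
  simp only [Site.meets, hs, Bool.and_eq_true, Bool.or_eq_true, decide_eq_true_eq] at h
  rcases h.1.1.2 with ((h | h) | h) | h
  · cases h
  · exact absurd hp (hcl (x - 1, y) (x, y) hq (by simp [dep, h]))
  · exact Or.inl h
  · exact Or.inr h

/-- The view bounds the actual bonds, so unambiguity leaves only the intended tile. If one of its
supports were missing, tightness would leave a strength below 3. -/
theorem tileAt_of_le_weight {t : Tile Glue} (ht : t ∈ tileSet)
    (hw : 3 ≤ weight strength A (x, y) t) :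
    P.tileAt (x, y) = some t ∧ ∀ q, P.dep (x, y) q → A q ≠ none := by
  have hN := contact_north_le C hA hcl hp hs t.north
  have hE := contact_east_le C hA hcl hp hs t.east
  have hS := contact_south_le C hA hcl hp hs t.south
  have hW := contact_west_le C hA hcl hp hs t.west
  rw [weight_mk] at hw
  have hσ : P.site x y ∈ all := mem_all (inRange_site x y)
  obtain ⟨τ, hτ, hτt⟩ := mem_tileSet.1 ht
  have ht' : (P.site x y).tile = some t := by
    have := unambiguous_of_mem hσ hτ
    simp only [Unambiguous, hτt, hs, Bool.or_eq_true, decide_eq_true_eq] at this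
    rcases this with (h | h) | h
    · cases h
    · unfold fit at h; omega
    · exact h
  refine ⟨ht', fun q hq hAq => ?_⟩
  have htight := tight_of_mem hσ
  simp only [Tight, ht', hs, Bool.false_or, Bool.and_eq_true, Bool.or_eq_true, Bool.not_eq_true',
    decide_eq_true_eq, fit, mask, held, if_true, if_false, contact_none_right,
    Bool.false_eq_true] at htight
  obtain ⟨⟨⟨⟨-, h1⟩, h2⟩, h3⟩, h4⟩ := htight
  rcases hq with ⟨rfl, h⟩ | ⟨rfl, h⟩ | ⟨rfl, h⟩ | ⟨rfl, h⟩ <;>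
    simp only [Prod.mk_add_mk, add_zero, ← sub_eq_add_neg] at hAq <;>
    rw [hAq, Option.bind_none, contact_none_right] at hw
  · rcases h1 with h1 | h1
    · rw [h] at h1; cases h1
    · omega
  · rcases h2 with h2 | h2
    · rw [h] at h2; cases h2
    · omega
  · rcases h3 with h3 | h3
    · rw [h] at h3; cases h3
    · omega
  · rcases h4 with h4 | h4
    · rw [h] at h4; cases h4
    · omega

end View

theorem contact_held_le {A : ℤ × ℤ → Option (Tile Glue)} {q : ℤ × ℤ} {f : Tile Glue → Option Glue}
    {a : Option Glue} {b : Bool} (h : b → face f (P.site q.1 q.2) = a)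
    (hA : ∀ u, b → P.tileAt q = some u → A q = some u) :
    contact strength a (held b a) ≤ contact strength a ((A q).bind f) := by
  cases b with
  | false => simp [held, contact_none_right]
  | true =>
    cases hq : P.tileAt q with
    | none =>
      have : a = none := by
        rw [← h rfl, face]
        rw [tileAt] at hq
        rw [hq]
        rfl
      subst this
      simp [contact]
    | some u =>
      rw [hA u rfl hq]
      have : f u = a := by
        rw [← h rfl, face]
        rw [tileAt] at hq
        rw [hq]
        rfl
      simp [held, this]

/-- The faces by which a place is held suffice for strength 3, and the neighbours beyond them have
smaller times. -/
theorem le_weight_of_time (C : P.Coherent) {x y : ℤ} {t : Tile Glue}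
    (ht : P.tileAt (x, y) = some t) (hs : (P.site x y).IsSeed = false)
    {A : ℤ × ℤ → Option (Tile Glue)}
    (hA : ∀ q u, P.tileAt q = some u → P.time q.1 q.2 < P.time x y → A q = some u) :
    3 ≤ weight strength A (x, y) t := by
  have htight := tight_of_mem (mem_all (inRange_site (P := P) x y))
  have ht' : (P.site x y).tile = some t := ht
  simp only [Tight, ht', hs, Bool.false_or, Bool.and_eq_true, decide_eq_true_eq] at htight
  refine htight.1.1.1.1.trans ?_
  rw [weight_mk]
  simp only [fit, grip, ht']
  have hN := meetsNorth C x y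
  have hE := meetsEast C x y
  have hS := meetsSouth C x y
  have hW := meetsWest C x y
  have hN' := hN.meets
  have hE' := hE.meets
  have hS' := hS.meets
  have hW' := hW.meets
  simp only [Site.meets, Bool.and_eq_true, Bool.or_eq_true, Bool.not_eq_true',
    decide_eq_true_eq] at hN' hE' hS' hW'
  have hf : ∀ f : Tile Glue → Option Glue, face f (P.site x y) = f t := by
    intro f
    rw [face, ht']
    rfl
  gcongr
  · refine contact_held_le (fun h => ?_) fun u h hu => hA _ _ hu (hN.left h)
    rw [← hf Tile.north]
    simpa [h] using hN'.1.2
  · refine contact_held_le (fun h => ?_) fun u h hu => hA _ _ hu (hE.left h)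
    rw [← hf Tile.east]
    simpa [h] using hE'.1.2
  · refine contact_held_le (fun h => ?_) fun u h hu => hA _ _ hu (hS.right h)
    rw [← hf Tile.south]
    simpa [h] using hS'.2
  · refine contact_held_le (fun h => ?_) fun u h hu => hA _ _ hu (hW.right h)
    rw [← hf Tile.west]
    simpa [h] using hW'.2

/-- Otherwise the tile would fit with no neighbours at all, that is, with weight 0. -/
theorem isSeed_of_time_eq_zero (C : P.Coherent) {x y : ℤ} {t : Tile Glue}
    (ht : P.tileAt (x, y) = some t) (h : P.time x y = 0) : (P.site x y).IsSeed := by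
  by_contra hs
  have := le_weight_of_time C ht (by simpa using hs) (A := fun _ => none) fun q u _ hlt => by
    omega
  simp [weight, contact_none_right] at this

/-- A system of the tiles of the adder that starts with the seed of the layout assembles it. -/
theorem certificate (C : P.Coherent) (S : TileSystem Glue) (hstr : S.str = strength)
    (htiles : S.tiles = tileSet) (htemp : S.temp = 3) (hseed : S.seed.tile = P.seedAt) :
    S.Certificate P.assembly (fun p => P.time p.1 p.2) P.dep where
  nonempty := ⟨(-1, -1), by rw [hseed]; simp [seedAt, tileAt, site, cap, IsSeed, tile]⟩
  seed_sub p t h := by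
    rw [hseed, seedAt] at h
    split_ifs at h with hs
    exact h
  seed_of_time p t h h0 := by
    rw [hseed, seedAt, if_pos (isSeed_of_time_eq_zero C h h0)]
    exact h
  not_dep_seed q p h := by
    rw [hseed, seedAt] at h
    split_ifs at h with hs
    · simp [dep, ins_of_isSeed hs]
    · exact absurd rfl h
  unique A hSA hAF hcl p hp t ht hw := by
    have hs : (P.site p.1 p.2).IsSeed = false := by
      by_contra hs
      simp only [Bool.not_eq_false] at hs
      obtain ⟨u, hu⟩ := Option.ne_none_iff_exists'.1 (tile_ne_none_of_isSeed hs)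
      rw [hSA p u (by rw [hseed, seedAt, if_pos hs]; exact hu)] at hp
      cases hp
    rw [htiles] at ht
    rw [htemp, hstr] at hw
    exact tileAt_of_le_weight C hAF hcl hp hs ht hw
  mem p t h := by
    rw [htiles]
    exact mem_tileSet.2 ⟨_, mem_all (inRange_site _ _), h⟩
  ready p t hp h A hA := by
    rw [htemp, hstr]
    refine le_weight_of_time C h ?_ fun q u hq hlt => hA q u hq hlt
    rw [hseed, seedAt] at hp
    split_ifs at hp with hs
    · have h' : P.tileAt p = some t := h
      rw [hp] at h'
      cases h'
    · simpa using hs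

end Layout
end Adder

/-! ### Stability of the seed. -/

theorem add_le_sum_bond {G : Type} [DecidableEq G] (str : G → ℕ) (A : Assembly G)
    {X Y : Finset (ℤ × ℤ)} {p q p' q' : ℤ × ℤ} (hp : p ∈ X) (hq : q ∈ Y) (hp' : p' ∈ X)
    (hq' : q' ∈ Y) (hne : (p, q) ≠ (p', q')) :
    bond str A p q + bond str A p' q' ≤ ∑ a ∈ X, ∑ b ∈ Y, bond str A a b := by
  rw [← Finset.sum_product']
  rw [← Finset.sum_pair (f := fun z : (ℤ × ℤ) × (ℤ × ℤ) => bond str A z.1 z.2) hne]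
  refine Finset.sum_le_sum_of_subset fun z hz => ?_
  simp only [Finset.mem_insert, Finset.mem_singleton] at hz
  rcases hz with rfl | rfl
  · exact Finset.mem_product.2 ⟨hp, hq⟩
  · exact Finset.mem_product.2 ⟨hp', hq'⟩

theorem bond_le_sum_bond {G : Type} [DecidableEq G] (str : G → ℕ) (A : Assembly G)
    {X Y : Finset (ℤ × ℤ)} {p q : ℤ × ℤ} (hp : p ∈ X) (hq : q ∈ Y) :
    bond str A p q ≤ ∑ a ∈ X, ∑ b ∈ Y, bond str A a b :=
  (Finset.single_le_sum (f := fun b => bond str A p b) (fun _ _ => Nat.zero_le _) hq).trans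
    (Finset.single_le_sum (f := fun a => ∑ b ∈ Y, bond str A a b) (fun _ _ => Nat.zero_le _) hp)

namespace Adder

open Site

namespace Layout

variable (P : Layout)

/-- The point in the `u`-th column of row `v` of the arm `d` of the `r`-th hairpin. -/
def point (r : ℕ) (d : Bool) (v u : ℕ) : ℤ × ℤ :=
  if d then (3 * P.L - u, 14 * r + 13 - v) else (u, 14 * r + v)

variable {P}

theorem site_point {r v u : ℕ} (d : Bool) (hr : r < P.L) (hv : v < 7) (hu : u ≤ 3 * P.L) :
    P.site (P.point r d v u).1 (P.point r d v u).2 = P.arm r d v u := by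
  cases d
  · change P.site u (14 * r + v) = _
    rw [site_of_block (r := r) (k := v) hr (by omega) (by ring)]
    exact (block_arm_false r hv hu rfl).1
  · change P.site (3 * P.L - u) (14 * r + 13 - v) = _
    rw [site_of_block (r := r) (k := 13 - v) hr (by omega) (by omega)]
    rw [(block_arm_true r (k := 13 - v) (by omega) hu rfl).1]
    congr 1
    omega

/-- Every point of the seed lies in the frame or carries an input bit of some position. -/
theorem seed_cases {x y : ℤ} (h : (P.site x y).IsSeed) :
    (∃ t, P.site x y = P.cap t x ∧ -1 ≤ x ∧ x ≤ 3 * P.L + 3 ∧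
      y = if t then (14 * P.L : ℤ) else -1) ∨
    (∃ r k : ℕ, r < P.L ∧ k < 14 ∧ y = 14 * r + k ∧ 3 * P.L + 1 ≤ x ∧ x ≤ 3 * P.L + 3) ∨
    (∃ r d v u, r < P.L ∧ v < 3 ∧ u ≤ 3 * P.L ∧ (x, y) = P.point r d v u) := by
  by_cases hx : x < -1 ∨ 3 * P.L + 3 < x
  · rw [site_eq_void (by omega)] at h
    cases h
  by_cases h1 : y = -1
  · exact Or.inl ⟨false, by simp [site, h1], by omega, by omega, h1⟩
  by_cases h2 : y = 14 * P.L
  · refine Or.inl ⟨true, ?_, by omega, by omega, h2⟩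
    unfold site
    rw [if_neg h1, if_pos h2]
  by_cases hy : 0 ≤ y ∧ y < 14 * P.L
  · obtain ⟨r, k, hr, hk, rfl⟩ : ∃ r k : ℕ, r < P.L ∧ k < 14 ∧ y = 14 * r + k :=
      ⟨(y / 14).toNat, (y % 14).toNat, by omega, by omega, by omega⟩
    by_cases hx' : 3 * P.L + 1 ≤ x
    · exact Or.inr (Or.inl ⟨r, k, hr, hk, rfl, hx', by omega⟩)
    rw [site_of_block hr hk rfl] at h
    rcases eq_or_ne x (-1) with rfl | hx1
    · rw [(block_left r k).1, leftSite] at h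
      split_ifs at h <;> cases h
    obtain ⟨d, v, u, hv, hu, hp⟩ : ∃ d v u, v < 7 ∧ u ≤ 3 * P.L ∧
        (x, (14 * r + k : ℤ)) = P.point r d v u := by
      rcases Nat.lt_or_ge k 7 with h7 | h7
      · refine ⟨false, k, x.toNat, h7, by omega, ?_⟩
        simp [point]
        omega
      · refine ⟨true, 13 - k, (3 * P.L - x).toNat, by omega, by omega, ?_⟩
        simp [point]
        omega
    have hs := site_point (P := P) d hr hv hu
    rw [← hp] at hs
    dsimp only at hs
    rw [← site_of_block hr hk rfl, hs] at h
    refine Or.inr (Or.inr ⟨r, d, v, u, hr, ?_, hu, hp⟩)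
    by_contra hv3
    have : (P.arm r d v u).IsSeed = false := by
      have hm : u % 3 < 3 := Nat.mod_lt _ (by norm_num)
      unfold arm
      generalize u % 3 = j at hm
      interval_cases v <;> interval_cases j <;>
        simp only [armSite] <;> (try split_ifs) <;> rfl
    rw [this] at h
    cases h
  · unfold site at h
    rw [if_neg h1, if_neg h2, if_neg hy] at h
    cases h

/-- The inputs are in the second rows of the arms. -/
theorem exists_point_of_site_eq_input {x y : ℤ} {b : Bool} (h : P.site x y = input b) :
    ∃ r d u, r < P.L ∧ u < 3 * P.L ∧ u % 3 ≠ 0 ∧ (P.datum r (P.index d u)).pad = false ∧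
      (x, y) = P.point r d 1 u := by
  have hseed : (P.site x y).IsSeed := by
    rw [h]
    rfl
  rcases seed_cases hseed with ⟨t, h', -⟩ | ⟨r, k, hr, hk, rfl, h0, h1⟩ |
    ⟨r, d, v, u, hr, hv, hu, hp⟩
  · rw [h', cap] at h
    split_ifs at h
  · rw [site_of_block hr hk rfl] at h
    obtain h2 | h2 | h2 : x = 3 * P.L + 1 ∨ x = 3 * P.L + 2 ∨ x = 3 * P.L + 3 := by omega
    · rw [(block_carry r k h2).1] at h
      interval_cases k <;> cases h
    · rw [(block_rel r k h2).1] at h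
      interval_cases k <;> cases h
    · rw [block_wall r k h2, wallSite] at h
      split_ifs at h
  have e := site_point (P := P) d hr (show v < 7 by omega) hu
  rw [← hp] at e
  dsimp only at e
  rw [e] at h
  have hm : u % 3 < 3 := Nat.mod_lt _ (by norm_num)
  obtain ⟨rfl, hj, hpad⟩ : v = 1 ∧ u % 3 ≠ 0 ∧ (P.datum r (P.index d u)).pad = false := by
    revert h
    unfold arm
    generalize u % 3 = j at hm
    interval_cases v <;> interval_cases j <;> intro h <;>
      cases hp : (P.datum r (P.index d u)).pad <;> simp [armSite, hp] at h ⊢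
  exact ⟨r, d, u, hr, by omega, hj, hpad, hp⟩

theorem Site.isSeed_of_face {σ : Site} (hσ : σ.InRange)
    (h : face Tile.north σ = some .frame ∨ face Tile.east σ = some .frame ∨
      face Tile.south σ = some .frame ∨ face Tile.west σ = some .frame) : σ.IsSeed := by
  have key : ∀ σ ∈ all, (decide (face Tile.north σ = some .frame) ||
      decide (face Tile.east σ = some .frame) || decide (face Tile.south σ = some .frame) ||
      decide (face Tile.west σ = some .frame)) = true → σ.IsSeed = true := by
    decide +kernel
  exact key σ (mem_all hσ) (by simpa [or_assoc] using h)

theorem Site.exists_tile_of_face {f : Tile Glue → Option Glue} {σ : Site} {g : Glue}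
    (h : face f σ = some g) : ∃ t, σ.tile = some t ∧ f t = some g := by
  unfold face at h
  cases ht : σ.tile with
  | none => rw [ht] at h; cases h
  | some t => rw [ht] at h; exact ⟨t, rfl, h⟩

section Cut

variable {A : Assembly Glue} (hA : A.tile = P.seedAt) {X Y : Finset (ℤ × ℤ)}
  (hXY : ∀ p, A.tile p ≠ none ↔ p ∈ X ∨ p ∈ Y)
  (hsum : ∑ p ∈ X, ∑ q ∈ Y, bond strength A p q < 3)

include hA in
theorem tile_eq_of_isSeed {p : ℤ × ℤ} (h : (P.site p.1 p.2).IsSeed) :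
    A.tile p = (P.site p.1 p.2).tile := by
  rw [hA, seedAt, if_pos h]
  rfl

include hA hXY in
theorem mem_or_mem {p : ℤ × ℤ} (h : (P.site p.1 p.2).IsSeed) : p ∈ X ∨ p ∈ Y := by
  rw [← hXY, tile_eq_of_isSeed hA h]
  exact tile_ne_none_of_isSeed h

include hA in
theorem bond_east {x y : ℤ} {g : Glue} (h1 : (P.site x y).IsSeed)
    (h2 : (P.site (x + 1) y).IsSeed) (h3 : face Tile.east (P.site x y) = some g)
    (h4 : face Tile.west (P.site (x + 1) y) = some g) :
    bond strength A (x, y) (x + 1, y) = strength g := by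
  obtain ⟨t, ht, ht'⟩ := Site.exists_tile_of_face h3
  obtain ⟨u, hu, hu'⟩ := Site.exists_tile_of_face h4
  have e1 : A.tile (x, y) = some t := by rw [tile_eq_of_isSeed hA h1, ht]
  have e2 : A.tile (x + 1, y) = some u := by rw [tile_eq_of_isSeed hA h2, hu]
  simp only [bond, e1, e2]
  simp [ht', hu', contact_self]

include hA in
theorem bond_north {x y : ℤ} {g : Glue} (h1 : (P.site x y).IsSeed)
    (h2 : (P.site x (y + 1)).IsSeed) (h3 : face Tile.north (P.site x y) = some g)
    (h4 : face Tile.south (P.site x (y + 1)) = some g) :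
    bond strength A (x, y) (x, y + 1) = strength g := by
  obtain ⟨t, ht, ht'⟩ := Site.exists_tile_of_face h3
  obtain ⟨u, hu, hu'⟩ := Site.exists_tile_of_face h4
  have e1 : A.tile (x, y) = some t := by rw [tile_eq_of_isSeed hA h1, ht]
  have e2 : A.tile (x, y + 1) = some u := by rw [tile_eq_of_isSeed hA h2, hu]
  simp only [bond, e1, e2]
  simp [ht', hu', contact_self]


include hA hXY hsum

/-- One bond of strength 3 already exceeds the assumed cost of the cut, so its ends lie on the same
side. The seed without the inputs is connected by such bonds; the lemmas that follow walk along them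
to the corner `(3 * P.L + 3, -1)`. -/
theorem mem_iff_of_bond {p q : ℤ × ℤ} (hp : (P.site p.1 p.2).IsSeed)
    (hq : (P.site q.1 q.2).IsSeed) (h : bond strength A p q = 3) : p ∈ X ↔ q ∈ X := by
  constructor <;> intro hX <;> by_contra hX'
  · have := (mem_or_mem hA hXY hq).resolve_left hX'
    exact absurd (bond_le_sum_bond strength A hX this) (by omega)
  · have := (mem_or_mem hA hXY hp).resolve_left hX'
    rw [bond_comm] at h
    exact absurd (bond_le_sum_bond strength A hX this) (by omega)

theorem mem_iff_east {x y : ℤ} (h1 : face Tile.east (P.site x y) = some .frame)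
    (h2 : face Tile.west (P.site (x + 1) y) = some .frame) :
    (x, y) ∈ X ↔ (x + 1, y) ∈ X := by
  have hp := Site.isSeed_of_face (inRange_site x y) (.inr (.inl h1))
  have hq := Site.isSeed_of_face (inRange_site (x + 1) y) (.inr (.inr (.inr h2)))
  exact mem_iff_of_bond hA hXY hsum hp hq (bond_east hA hp hq h1 h2)

theorem mem_iff_north {x y : ℤ} (h1 : face Tile.north (P.site x y) = some .frame)
    (h2 : face Tile.south (P.site x (y + 1)) = some .frame) :
    (x, y) ∈ X ↔ (x, y + 1) ∈ X := by
  have hp := Site.isSeed_of_face (inRange_site x y) (.inl h1)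
  have hq := Site.isSeed_of_face (inRange_site x (y + 1)) (.inr (.inr (.inl h2)))
  exact mem_iff_of_bond hA hXY hsum hp hq (bond_north hA hp hq h1 h2)

theorem wall_mem_iff {j : ℕ} (hj : j ≤ 14 * P.L + 1) :
    ((3 * P.L + 3, j - 1) : ℤ × ℤ) ∈ X ↔ ((3 * P.L + 3, -1) : ℤ × ℤ) ∈ X := by
  have hcap : ∀ t, P.cap t (3 * P.L + 3) = frame (!t) false t true := by
    intro t
    unfold cap
    rw [if_neg (by omega), if_neg (by omega), if_pos rfl]
  have hwall : ∀ y : ℤ, 0 ≤ y → y < 14 * P.L →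
      face Tile.north (P.site (3 * P.L + 3) y) = some .frame ∧
      face Tile.south (P.site (3 * P.L + 3) y) = some .frame := by
    intro y h0 h1
    rw [site_of_block (r := (y / 14).toNat) (k := (y % 14).toNat) (by omega) (by omega) (by omega),
      block_wall _ _ rfl, wallSite]
    split_ifs <;> exact ⟨rfl, rfl⟩
  have hbot : face Tile.north (P.site (3 * P.L + 3) (-1)) = some .frame := by
    change face Tile.north (P.cap false (3 * P.L + 3)) = _
    rw [hcap]
    rfl
  have htop : face Tile.south (P.site (3 * P.L + 3) (14 * P.L)) = some .frame := by
    unfold site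
    rw [if_neg (by omega), if_pos rfl, hcap]
    rfl
  induction j with
  | zero => simp
  | succ j ih =>
    refine Iff.trans ?_ (ih (by omega))
    have h := mem_iff_north hA hXY hsum (x := 3 * P.L + 3) (y := j - 1) ?_ ?_
    · rw [h]
      congr! 2
      push_cast
      ring
    · rcases Nat.eq_zero_or_pos j with rfl | h0
      · exact hbot
      · exact (hwall _ (by omega) (by omega)).1
    · rcases eq_or_lt_of_le hj with h0 | h0
      · rw [show (j - 1 + 1 : ℤ) = 14 * P.L by omega]
        exact htop
      · exact (hwall _ (by omega) (by omega)).2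

/-- A run of frame tiles that starts at the wall. -/
theorem mem_iff_of_run {y : ℤ} {m : ℕ}
    (hE : ∀ j < m, face Tile.east (P.site (3 * P.L + 3 - (j + 1 : ℕ)) y) = some .frame)
    (hW : ∀ j < m, face Tile.west (P.site (3 * P.L + 3 - j) y) = some .frame)
    {j : ℕ} (hj : j ≤ m) :
    ((3 * P.L + 3 - j, y) : ℤ × ℤ) ∈ X ↔ ((3 * P.L + 3, y) : ℤ × ℤ) ∈ X := by
  induction j with
  | zero => simp
  | succ j ih =>
    rw [← ih (by omega)]
    have e : (3 * P.L + 3 - (j + 1 : ℕ) + 1 : ℤ) = 3 * P.L + 3 - j := by push_cast; ring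
    have h := mem_iff_east hA hXY hsum (hE j (by omega)) (by rw [e]; exact hW j (by omega))
    rw [h, e]

theorem wall_mem_iff' {y : ℤ} (h0 : -1 ≤ y) (h1 : y ≤ 14 * P.L) :
    ((3 * P.L + 3, y) : ℤ × ℤ) ∈ X ↔ ((3 * P.L + 3, -1) : ℤ × ℤ) ∈ X := by
  rw [← wall_mem_iff hA hXY hsum (j := (y + 1).toNat) (by omega)]
  congr! 2
  omega

theorem cap_mem_iff (t : Bool) {x : ℤ} (h0 : -1 ≤ x) (h1 : x ≤ 3 * P.L + 3) :
    (x, if t then (14 * P.L : ℤ) else -1) ∈ X ↔ ((3 * P.L + 3, -1) : ℤ × ℤ) ∈ X := by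
  have hs : ∀ x, P.site x (if t then (14 * P.L : ℤ) else -1) = P.cap t x := by
    intro x
    cases t
    · rfl
    · unfold site
      rw [if_pos rfl, if_neg (by omega), if_pos rfl]
  rw [← wall_mem_iff' hA hXY hsum (y := if t then (14 * P.L : ℤ) else -1)
    (by split_ifs <;> omega) (by split_ifs <;> omega)]
  have := mem_iff_of_run hA hXY hsum (y := if t then (14 * P.L : ℤ) else -1) (m := 3 * P.L + 4)
    (fun j hj => ?_) (fun j hj => ?_) (j := (3 * P.L + 3 - x).toNat) (by omega)
  · rw [← this]
    congr! 2
    omega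
  · rw [hs]
    unfold cap
    rcases eq_or_lt_of_le (show j ≤ 3 * P.L + 3 by omega) with rfl | h
    · rw [if_pos (by push_cast; ring)]
      cases t <;> rfl
    · rw [if_neg (by omega), if_pos (by omega)]
      rfl
  · rw [hs]
    unfold cap
    rw [if_neg (by omega)]
    split_ifs with h2 h3
    · rfl
    · rfl
    · omega

theorem row_mem_iff {r k : ℕ} (hr : r < P.L) (hk : k = 0 ∨ k = 13) {x : ℤ} (h0 : 0 ≤ x)
    (h1 : x ≤ 3 * P.L + 3) :
    (x, (14 * r + k : ℤ)) ∈ X ↔ ((3 * P.L + 3, -1) : ℤ × ℤ) ∈ X := by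
  rw [← wall_mem_iff' hA hXY hsum (y := 14 * r + k) (by omega) (by omega)]
  have hE : ∀ x : ℤ, 0 ≤ x → x ≤ 3 * P.L + 2 →
      face Tile.east (P.block r k x) = some .frame := by
    intro x h2 h3
    unfold block
    rw [if_neg (by omega)]
    rcases hk with rfl | rfl <;> split_ifs <;> first | rfl | omega
  have hW : ∀ x : ℤ, 0 < x → x ≤ 3 * P.L + 3 →
      face Tile.west (P.block r k x) = some .frame := by
    intro x h2 h3
    unfold block
    rw [if_neg (by omega)]
    rcases hk with rfl | rfl <;> split_ifs <;> first | rfl | omega | skip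
    · simp only [arm, armSite, face, tile, frameFace, Option.bind_some, Bool.false_eq_true,
        if_false]
      rw [decide_eq_false (by omega)]
      rfl
    · simp only [arm, armSite, face, tile, frameFace, Option.bind_some, if_true]
      rw [decide_eq_false (by omega)]
      rfl
  have := mem_iff_of_run hA hXY hsum (y := 14 * r + k) (m := 3 * P.L + 3)
    (fun j hj => ?_) (fun j hj => ?_) (j := (3 * P.L + 3 - x).toNat) (by omega)
  · rw [← this]
    congr! 2
    omega
  · rw [site_of_block hr (by omega) rfl]
    exact hE _ (by omega) (by omega)
  · rw [site_of_block hr (by omega) rfl]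
    exact hW _ (by omega) (by omega)

/-- At the turn, rows 0, 1, 12 and 13 are tied to the wall, and the seed tiles in rows 2 and 11 hang
on those in rows 1 and 12. -/
theorem tip_mem_iff {r k : ℕ} (hr : r < P.L) (hk : k < 14) {x : ℤ} (h0 : 3 * P.L + 1 ≤ x)
    (h1 : x ≤ 3 * P.L + 3) (h : (P.site x (14 * r + k)).IsSeed) :
    (x, (14 * r + k : ℤ)) ∈ X ↔ ((3 * P.L + 3, -1) : ℤ × ℤ) ∈ X := by
  have hs : ∀ k : ℕ, k < 14 → ∀ x, P.site x (14 * r + k) = P.block r k x :=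
    fun k hk x => site_of_block hr hk rfl
  have key : ∀ k : ℕ, k = 1 ∨ k = 12 → ∀ x : ℤ, 3 * P.L + 1 ≤ x → x ≤ 3 * P.L + 3 →
      ((x, (14 * r + k : ℤ)) ∈ X ↔ ((3 * P.L + 3, -1) : ℤ × ℤ) ∈ X) := by
    intro k hk x h0 h1
    rw [← wall_mem_iff' hA hXY hsum (y := 14 * r + k) (by omega) (by omega)]
    have := mem_iff_of_run hA hXY hsum (y := 14 * r + k) (m := 2)
      (fun j hj => ?_) (fun j hj => ?_) (j := (3 * P.L + 3 - x).toNat) (by omega)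
    · rw [← this]
      congr! 2
      omega
    · rw [hs k (by omega)]
      interval_cases j
      · rw [(block_rel r k (by push_cast; ring)).1]
        rcases hk with rfl | rfl <;> rfl
      · rw [(block_carry r k (by push_cast; ring)).1]
        rcases hk with rfl | rfl <;> rfl
    · rw [hs k (by omega)]
      interval_cases j
      · rw [block_wall r k (by push_cast; ring)]
        rcases hk with rfl | rfl <;> rfl
      · rw [(block_rel r k (by push_cast; ring)).1]
        rcases hk with rfl | rfl <;> rfl
  rcases eq_or_lt_of_le h1 with rfl | h2
  · exact wall_mem_iff' hA hXY hsum (by omega) (by omega)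
  by_cases hk0 : k = 0 ∨ k = 13
  · exact row_mem_iff hA hXY hsum hr hk0 (by omega) h1
  by_cases hk1 : k = 1 ∨ k = 12
  · exact key k hk1 x h0 h1
  have hcol : ∀ k : ℕ, ∃ σ, P.block r k x = σ ∧
      (σ = carrySite k (P.datum r P.L).s (P.datum r P.L).c ∨ σ = relSite k (P.datum r P.L).s) := by
    intro k
    refine ⟨_, rfl, ?_⟩
    rcases eq_or_ne x (3 * P.L + 1) with hx | hx
    · exact Or.inl (block_carry r k hx).1
    · exact Or.inr (block_rel r k (by omega)).1
  by_cases hk2 : k = 2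
  · subst hk2
    rw [← key 1 (Or.inl rfl) x h0 h1]
    obtain ⟨σ, hσ, hσ'⟩ := hcol 1
    obtain ⟨τ, hτ, hτ'⟩ := hcol 2
    have e : (14 * r + (2 : ℕ) : ℤ) = 14 * r + (1 : ℕ) + 1 := by push_cast; ring
    rw [e]
    refine (mem_iff_north hA hXY hsum ?_ ?_).symm
    · rw [hs 1 (by omega), hσ]
      rcases hσ' with rfl | rfl <;> rfl
    · rw [← e, hs 2 (by omega), hτ]
      rcases hτ' with rfl | rfl <;> rfl
  by_cases hk3 : k = 11
  · subst hk3
    rw [← key 12 (Or.inr rfl) x h0 h1]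
    obtain ⟨σ, hσ, hσ'⟩ := hcol 11
    obtain ⟨τ, hτ, hτ'⟩ := hcol 12
    have e : (14 * r + (12 : ℕ) : ℤ) = 14 * r + (11 : ℕ) + 1 := by push_cast; ring
    rw [e]
    refine mem_iff_north hA hXY hsum ?_ ?_
    · rw [hs 11 (by omega), hσ]
      rcases hσ' with rfl | rfl <;> rfl
    · rw [← e, hs 12 (by omega), hτ]
      rcases hτ' with rfl | rfl <;> rfl
  · exfalso
    rw [hs k hk] at h
    obtain ⟨σ, hσ, hσ'⟩ := hcol k
    rw [hσ] at h
    interval_cases k <;> first | omega | rcases hσ' with rfl | rfl <;> cases h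

theorem mem_iff_inner {r : ℕ} (hr : r < P.L) (d : Bool) {v u : ℕ} (hv : v < 6)
    (hu : u ≤ 3 * P.L)
    (h1 : face (if d then Tile.south else Tile.north) (P.arm r d v u) = some .frame)
    (h2 : face (if d then Tile.north else Tile.south) (P.arm r d (v + 1) u) = some .frame) :
    P.point r d v u ∈ X ↔ P.point r d (v + 1) u ∈ X := by
  rw [← site_point d hr (by omega) hu] at h1 h2
  cases d
  · have e : P.point r false (v + 1) u = ((u : ℤ), 14 * r + (v : ℤ) + 1) := by
      simp [point, add_assoc]
    rw [e] at h2 ⊢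
    exact mem_iff_north hA hXY hsum h1 h2
  · have e : P.point r true v u = ((3 * P.L - u : ℤ), 14 * r + 13 - ((v + 1 : ℕ) : ℤ) + 1) := by
      simp [point]
      ring
    rw [e] at h1 ⊢
    exact (mem_iff_north hA hXY hsum h2 h1).symm

/-- Feet, pads and `lift` tiles hang on the edge row by frame bonds. Inputs carry no frame glue and
are treated separately. -/
theorem arm_mem_iff {r : ℕ} (hr : r < P.L) (d : Bool) {v u : ℕ} (hv : v < 3)
    (hu : u ≤ 3 * P.L) (h : (P.arm r d v u).IsSeed) (hb : ∀ b, P.arm r d v u ≠ input b) :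
    P.point r d v u ∈ X ↔ ((3 * P.L + 3, -1) : ℤ × ℤ) ∈ X := by
  have h0 : P.point r d 0 u ∈ X ↔ ((3 * P.L + 3, -1) : ℤ × ℤ) ∈ X := by
    have := row_mem_iff hA hXY hsum hr (k := if d then 13 else 0) (by cases d <;> simp)
      (x := (P.point r d 0 u).1) (by cases d <;> simp [point]; omega)
      (by cases d <;> simp [point] <;> omega)
    rw [← this]
    cases d <;> simp [point]
  rcases Nat.eq_zero_or_pos v with rfl | hv0
  · exact h0
  have hout : face (if d then Tile.south else Tile.north) (P.arm r d 0 u) = some .frame := by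
    cases d <;> rfl
  have hm : u % 3 < 3 := Nat.mod_lt _ (by norm_num)
  obtain hv1 | hv2 : v = 1 ∨ v = 2 := by omega
  · subst hv1
    rw [← h0]
    refine (mem_iff_inner hA hXY hsum hr d (by norm_num) hu hout ?_).symm
    revert hb
    unfold arm
    generalize u % 3 = j at hm
    intro hb
    interval_cases j
    · cases d <;> rfl
    all_goals
      simp only [armSite, zero_add] at hb ⊢
      cases hp : (P.datum r (P.index d u)).pad
      · simp [hp] at hb
      · cases d <;> rfl
  · subst hv2
    have hj : u % 3 = 0 := by
      revert h
      unfold arm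
      generalize u % 3 = j at hm
      interval_cases j <;> intro h <;> first | rfl | cases h
    rw [← h0, mem_iff_inner hA hXY hsum hr d (by norm_num) hu hout
      (by unfold arm; rw [hj]; cases d <;> rfl)]
    refine (mem_iff_inner hA hXY hsum hr d (by norm_num) hu
      (by unfold arm; rw [hj]; cases d <;> rfl) ?_).symm
    unfold arm
    rw [hj]
    cases d <;> rfl

/-- A cut of little strength does not separate the tiles of the frame. -/
theorem mem_iff_of_not_input {x y : ℤ} (h : (P.site x y).IsSeed)
    (hb : ∀ b, P.site x y ≠ input b) : (x, y) ∈ X ↔ ((3 * P.L + 3, -1) : ℤ × ℤ) ∈ X := by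
  rcases seed_cases h with ⟨t, -, h0, h1, rfl⟩ | ⟨r, k, hr, hk, rfl, h0, h1⟩ |
    ⟨r, d, v, u, hr, hv, hu, hp⟩
  · exact cap_mem_iff hA hXY hsum t h0 h1
  · exact tip_mem_iff hA hXY hsum hr hk h0 h1 h
  · have e := site_point (P := P) d hr (show v < 7 by omega) hu
    rw [← hp] at e
    rw [hp]
    dsimp only at e
    rw [e] at h hb
    exact arm_mem_iff hA hXY hsum hr d hv hu h hb

omit hXY hsum in
theorem bond_front {r : ℕ} (hr : r < P.L) (d : Bool) {v u : ℕ} (hv : v < 7) (hu : u < 3 * P.L)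
    {g : Glue} (h1 : (P.arm r d v u).IsSeed) (h2 : (P.arm r d v (u + 1)).IsSeed)
    (h3 : face (if d then Tile.west else Tile.east) (P.arm r d v u) = some g)
    (h4 : face (if d then Tile.east else Tile.west) (P.arm r d v (u + 1)) = some g) :
    bond strength A (P.point r d v u) (P.point r d v (u + 1)) = strength g := by
  rw [← site_point d hr hv (by omega)] at h1 h2 h3 h4
  cases d
  · exact bond_east hA h1 h2 h3 h4
  · have e : P.point r true v u = (3 * P.L - ((u + 1 : ℕ) : ℤ) + 1, 14 * r + 13 - (v : ℤ)) := by
      simp [point]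
      ring
    rw [e] at h1 h3 ⊢
    rw [bond_comm]
    exact bond_east hA h2 h1 h4 h3

omit hsum in
/-- A cut with the frame on one side has some input on the other side, which costs two bonds. -/
theorem le_sum_bond_of_root_mem (hd : Disjoint X Y) (hY : Y.Nonempty)
    (hroot : ((3 * P.L + 3, -1) : ℤ × ℤ) ∈ X) : 3 ≤ ∑ p ∈ X, ∑ q ∈ Y, bond strength A p q := by
  by_contra hsum
  rw [not_le] at hsum
  obtain ⟨⟨x, y⟩, hy⟩ := hY
  have hyX : (x, y) ∉ X := fun h => Finset.disjoint_left.1 hd h hy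
  have hseed : (P.site x y).IsSeed := by
    have h := (hXY (x, y)).2 (Or.inr hy)
    rw [hA, seedAt] at h
    by_contra hs
    exact h (if_neg hs)
  have hin : ∃ b, P.site x y = input b := by
    by_contra! h
    exact hyX ((mem_iff_of_not_input hA hXY hsum hseed h).2 hroot)
  obtain ⟨b, hb⟩ := hin
  obtain ⟨r, d, u, hr, hu, hj, hpad, hp⟩ := exists_point_of_site_eq_input hb
  rw [hp] at hy
  obtain ⟨i, hi⟩ : ∃ i, i = u / 3 := ⟨_, rfl⟩
  have harm : ∀ u', u' / 3 = i → P.arm r d 1 u' = armSite d 1 (u' % 3)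
      (u' = if d then 3 * P.L else 0) (P.datum r (P.index d u)) := by
    rintro u' rfl
    rw [arm, index, index, hi]
  have a0 : P.arm r d 1 (3 * i) = foot := by
    rw [harm _ (by omega), show 3 * i % 3 = 0 by omega]
    rfl
  have a3 : P.arm r d 1 (3 * i + 3) = foot := by
    rw [arm, show (3 * i + 3) % 3 = 0 by omega]
    rfl
  have a1 : P.arm r d 1 (3 * i + 1) = input (P.datum r (P.index d u)).a := by
    rw [harm _ (by omega), show (3 * i + 1) % 3 = 1 by omega]
    simp [armSite, hpad]
  have a2 : P.arm r d 1 (3 * i + 2) = input (P.datum r (P.index d u)).b := by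
    rw [harm _ (by omega), show (3 * i + 2) % 3 = 2 by omega]
    simp [armSite, hpad]
  have b0 : bond strength A (P.point r d 1 (3 * i)) (P.point r d 1 (3 * i + 1)) = 2 := by
    rw [bond_front hA hr d (g := .anchor) (by norm_num) (by omega) (by rw [a0]; rfl)
      (by rw [a1]; rfl) (by rw [a0]; cases d <;> rfl) (by rw [a1]; cases d <;> rfl)]
    rfl
  have b1 : bond strength A (P.point r d 1 (3 * i + 1)) (P.point r d 1 (3 * i + 2)) = 2 := by
    rw [bond_front hA hr d (g := .anchor) (by norm_num) (by omega) (by rw [a1]; rfl)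
      (by rw [a2]; rfl) (by rw [a1]; cases d <;> rfl) (by rw [a2]; cases d <;> rfl)]
    rfl
  have b2 : bond strength A (P.point r d 1 (3 * i + 2)) (P.point r d 1 (3 * i + 3)) = 2 := by
    rw [bond_front hA hr d (g := .anchor) (by norm_num) (by omega) (by rw [a2]; rfl)
      (by rw [a3]; rfl) (by rw [a2]; cases d <;> rfl) (by rw [a3]; cases d <;> rfl)]
    rfl
  have m0 : P.point r d 1 (3 * i) ∈ X :=
    (arm_mem_iff hA hXY hsum hr d (by norm_num) (by omega) (by rw [a0]; rfl)
      (by rw [a0]; simp)).2 hroot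
  have m3 : P.point r d 1 (3 * i + 3) ∈ X :=
    (arm_mem_iff hA hXY hsum hr d (by norm_num) (by omega) (by rw [a3]; rfl)
      (by rw [a3]; simp)).2 hroot
  have hmem : ∀ u', u' ≤ 3 * P.L → (P.arm r d 1 u').IsSeed →
      P.point r d 1 u' ∈ X ∨ P.point r d 1 u' ∈ Y := fun u' h h' =>
    mem_or_mem hA hXY (by rw [site_point d hr (by norm_num) h]; exact h')
  have hne : ∀ j k, j ≠ k → P.point r d 1 j ≠ P.point r d 1 k := by
    intro j k hjk h
    cases d <;> simp [point] at h <;> omega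
  have hne' : ∀ {p q p' q' : ℤ × ℤ}, q ≠ q' → (p, q) ≠ (p', q') := by
    rintro p q p' q' h h'
    exact h (Prod.ext_iff.1 h').2
  have hne'' : ∀ {p q p' q' : ℤ × ℤ}, p ≠ p' → (p, q) ≠ (p', q') := by
    rintro p q p' q' h h'
    exact h (Prod.ext_iff.1 h').1
  rw [bond_comm] at b2
  have b1' := b1
  rw [bond_comm] at b1'
  -- The two inputs form a chain between two feet, with three bonds of strength 2. Both feet are in
  -- `X`, so as soon as an input is in `Y`, two of the bonds are cut, and `2 + 2 ≥ 3`.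
  rcases hmem (3 * i + 1) (by omega) (by rw [a1]; rfl) with h1 | h1 <;>
    rcases hmem (3 * i + 2) (by omega) (by rw [a2]; rfl) with h2 | h2
  · refine absurd hy (Finset.disjoint_left.1 hd ?_)
    obtain hu | hu : u = 3 * i + 1 ∨ u = 3 * i + 2 := by omega
    · rwa [hu]
    · rwa [hu]
  · have := add_le_sum_bond strength A h1 h2 m3 h2 (hne'' (hne _ _ (by omega)))
    omega
  · have := add_le_sum_bond strength A m0 h1 h2 h1 (hne'' (hne _ _ (by omega)))
    omega
  · have := add_le_sum_bond strength A m0 h1 m3 h2 (hne' (hne _ _ (by omega)))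
    omega

end Cut

/-- The seed of a layout is stable at temperature 3. -/
theorem isStable_of_tile_eq_seedAt {A : Assembly Glue} (hA : A.tile = P.seedAt) :
    A.IsStable strength 3 := by
  intro X Y hX hY hd hXY
  have hroot : (P.site (3 * P.L + 3) (-1)).IsSeed := by
    change (P.cap false (3 * P.L + 3)).IsSeed = true
    exact isSeed_cap (by omega) (by omega)
  rcases mem_or_mem hA hXY (p := (3 * P.L + 3, -1)) hroot with h | h
  · exact le_sum_bond_of_root_mem hA hXY hd hY h
  · rw [Finset.sum_comm]
    simp only [bond_comm strength A]
    exact le_sum_bond_of_root_mem hA (fun p => (hXY p).trans or_comm) hd.symm hX h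

end Layout

/-! ### Carries, their arrival times and the binary sum. -/

section Bits

variable (A B : ℕ → Bool)

/-- The carry that the position `q` generates, or `none` if it propagates the carry into it. -/
def typeAt (q : ℕ) : Option Bool := if A q = B q then some (A q) else none

/-- The carry into a position. -/
def carryAt : ℕ → Bool
  | 0 => false
  | q + 1 => (typeAt A B q).getD (carryAt q)

/-- The carry into the position `p + i`, relative to the position `p`. -/
def relAt (p : ℕ) : ℕ → Option Bool
  | 0 => none
  | i + 1 => (typeAt A B (p + i)).or (relAt p i)

/-- The time at which the relative carry arrives at position `i` of the hairpin that starts at the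
position `p`. -/
def relTimeAt (p : ℕ) : ℕ → ℕ
  | 0 => 1
  | i + 1 => if typeAt A B (p + i) = none then relTimeAt p i + 3 else 4

/-- The time at which the carry out of a hairpin with relative carry `s` is known, if the absolute
carry arrives at time `m` and the relative carry at time `k`. -/
def knownTime (s : Option Bool) (m k : ℕ) : ℕ := if s = none then max (m + 10) (k + 12) else k + 12

/-- The time at which the carry into the `r`-th hairpin arrives. -/
def entryTime (L : ℕ) : ℕ → ℕ
  | 0 => 1
  | r + 1 => knownTime (relAt A B (2 * L * r) (2 * L)) (entryTime L r)
      (relTimeAt A B (2 * L * r) (2 * L)) + 4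

/-- The layout with `L` hairpins that adds two numbers with the binary digits `A q` and `B q`. The
positions from `n` on do not belong to the input. -/
def bitLayout (n L : ℕ) : Layout where
  L := L
  datum r i := ⟨A (2 * L * r + i), B (2 * L * r + i), relAt A B (2 * L * r) i,
    carryAt A B (2 * L * r + i), n ≤ 2 * L * r + i⟩
  relArrival r i := relTimeAt A B (2 * L * r) i
  arrival r i := if relAt A B (2 * L * r) i = none then entryTime A B L r + 5 + 3 * i else
    relTimeAt A B (2 * L * r) i + 1
  entry := entryTime A B L
  known r := knownTime (relAt A B (2 * L * r) (2 * L)) (entryTime A B L r)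
    (relTimeAt A B (2 * L * r) (2 * L))

variable {A B}

/-- This is the meaning of the relative carry: the value generated last since position `p`, and
failing that, the carry into `p`. -/
theorem carryAt_add (p i : ℕ) : carryAt A B (p + i) = (relAt A B p i).getD (carryAt A B p) := by
  induction i with
  | zero => rfl
  | succ i ih =>
    rw [← add_assoc, carryAt, relAt, ih]
    cases typeAt A B (p + i) <;> rfl

theorem relAt_eq_none_of_succ {p i : ℕ} (h : relAt A B p (i + 1) = none) :
    typeAt A B (p + i) = none ∧ relAt A B p i = none := by
  rw [relAt] at h
  cases ht : typeAt A B (p + i) with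
  | none => exact ⟨rfl, by simpa [ht] using h⟩
  | some t => simp [ht] at h

theorem relTimeAt_of_relAt {p i : ℕ} (h : relAt A B p i = none) :
    relTimeAt A B p i = 1 + 3 * i := by
  induction i with
  | zero => rfl
  | succ i ih =>
    obtain ⟨h1, h2⟩ := relAt_eq_none_of_succ h
    rw [relTimeAt, if_pos h1, ih h2]
    ring

theorem relTimeAt_pos (p i : ℕ) : 1 ≤ relTimeAt A B p i := by
  cases i with
  | zero => exact le_rfl
  | succ i =>
    rw [relTimeAt]
    split_ifs <;> omega

/-- The constants reflect the geometry. A position has three columns; a generating position is read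
in three steps, so its carry arrives at the next one at time 4. The carry leaves the western column
in row 4 and enters its lane one step later, at `entry + 5`. It reaches `skip` in row 10 after 10
steps; a relative carry needs 11 for the turn and one more to `skip`, and four further rows lead to
the next hairpin. -/
theorem coherent_bitLayout {n L : ℕ} (hL : 0 < L) (hA : ∀ q, n ≤ q → A q = false)
    (hB : ∀ q, n ≤ q → B q = false) : (bitLayout A B n L).Coherent where
  pos := hL
  valid r i := by
    change (relAt A B (2 * L * r) i).getD (carryAt A B (2 * L * r + i)) = _
    change _ = carryAt A B (2 * L * r + i)
    rw [carryAt_add]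
    cases relAt A B (2 * L * r) i <;> rfl
  next r i _ := ⟨rfl, rfl⟩
  start r := rfl
  pad r i h := by
    have h : n ≤ 2 * L * r + i := by simpa [bitLayout] using h
    exact ⟨hA _ h, hB _ h⟩
  carry r := by
    change carryAt A B (2 * L * (r + 1) + 0) = _
    rw [show 2 * L * (r + 1) + 0 = 2 * L * r + 2 * L by ring, carryAt_add]
    rfl
  zero := rfl
  relArrival_pos r i := relTimeAt_pos _ _
  relArrival_lt r i := by
    change relTimeAt A B _ _ < ite _ _ _
    split_ifs with h
    · rw [relTimeAt_of_relAt h]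
      omega
    · omega
  relArrival_succ r i _ := rfl
  arrival_succ r i _ h := by
    have h : relAt A B (2 * L * r) (i + 1) = none := h
    have h' := (relAt_eq_none_of_succ h).2
    change ite _ _ _ = ite _ _ _ + 3
    rw [if_pos h, if_pos h']
    ring
  entry_pos := Nat.one_pos
  entry_lt r := by
    change entryTime A B L r + 4 < entryTime A B L r + 5 + 3 * 0
    omega
  relArrival_lt_known r := by
    change relTimeAt A B (2 * L * r) (2 * L) + 11 < knownTime _ _ _
    unfold knownTime
    split_ifs <;> omega
  entry_lt_known r h := by
    change entryTime A B L r + 9 < knownTime _ _ _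
    have h : relAt A B (2 * L * r) (2 * L) = none := h
    rw [knownTime, if_pos h]
    omega
  known_lt r := Nat.lt_succ_self _

/-- The sum bit at a position. -/
def sumAt (A B : ℕ → Bool) (q : ℕ) : Bool := (typeAt A B q = none) ^^ carryAt A B q

/-- The number with the binary digits `A q` for `q < m`, the first digit being the least
significant. -/
def value (A : ℕ → Bool) (m : ℕ) : ℕ := ∑ q ∈ Finset.range m, (A q).toNat * 2 ^ q

theorem value_succ (m : ℕ) : value A (m + 1) = value A m + (A m).toNat * 2 ^ m :=
  Finset.sum_range_succ _ _

theorem value_lt (m : ℕ) : value A m < 2 ^ m := by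
  induction m with
  | zero => simp [value]
  | succ m ih =>
    rw [value_succ, pow_succ]
    have := (A m).toNat_le
    nlinarith

theorem testBit_value {m q : ℕ} (h : q < m) : (value A m).testBit q = A q := by
  induction m with
  | zero => omega
  | succ m ih =>
    rw [value_succ]
    rcases eq_or_lt_of_le (Nat.lt_succ_iff.1 h) with rfl | h
    · have := Nat.testBit_lt_two_pow (value_lt (A := A) q)
      cases A q
      · simpa using this
      · rw [Bool.toNat_true, one_mul, add_comm, Nat.testBit_two_pow_add_eq, this]
        rfl
    · rw [← ih h]
      cases A m
      · simp
      · rw [Bool.toNat_true, one_mul, add_comm, Nat.testBit_two_pow_add_gt h]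

/-- Induction with the identity of the full adder at position `m`, weighted by `2 ^ m`. -/
theorem value_add (m : ℕ) :
    value A m + value B m = value (sumAt A B) m + (carryAt A B m).toNat * 2 ^ m := by
  induction m with
  | zero => simp [value, carryAt]
  | succ m ih =>
    have key : (A m).toNat + (B m).toNat + (carryAt A B m).toNat =
        (sumAt A B m).toNat + (carryAt A B (m + 1)).toNat * 2 := by
      rw [carryAt, sumAt, typeAt]
      cases A m <;> cases B m <;> cases carryAt A B m <;> rfl
    rw [value_succ, value_succ, value_succ, pow_succ]
    linear_combination ih + 2 ^ m * key

/-- Both digits at position `n` vanish, so no carry leaves it and the sum bits up to `n` are the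
whole sum. -/
theorem testBit_value_add {n q : ℕ} (hA : A n = false) (hB : B n = false) (hq : q ≤ n) :
    (value A n + value B n).testBit q = sumAt A B q := by
  have h := value_add (A := A) (B := B) (n + 1)
  rw [value_succ, value_succ, hA, hB] at h
  have hc : carryAt A B (n + 1) = false := by simp [carryAt, typeAt, hA, hB]
  rw [hc] at h
  simp only [Bool.toNat_false, zero_mul, add_zero] at h
  rw [h, testBit_value (by omega)]

/-- The digits of a bit string that starts with the most significant bit. -/
def digit {n : ℕ} (x : Fin n → Bool) (q : ℕ) : Bool :=
  if h : q < n then x (Fin.rev ⟨q, h⟩) else false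

theorem bitsValue_eq {n : ℕ} (x : Fin n → Bool) : bitsValue x = value (digit x) n := by
  rw [bitsValue, value, ← Equiv.sum_comp Fin.revPerm, Finset.sum_range]
  refine Finset.sum_congr rfl fun i _ => ?_
  simp [digit]

end Bits

/-! ### Independence of the frame from the input. -/

theorem label_eq_singleton (c : Bool) (t : Tile Glue) (ht : t ∈ tileSet) :
    t.label = [c] ↔ t = bitTile c := by
  have key : ∀ σ ∈ all, ∀ c, σ.tile.all (fun t => decide (t.label = [c] → t = bitTile c)) := by
    decide +kernel
  obtain ⟨σ, hσ, hσt⟩ := mem_tileSet.1 ht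
  refine ⟨fun h => ?_, fun h => by rw [h]; rfl⟩
  have := key σ hσ c
  rw [hσt] at this
  simpa [h] using this

/-- The tile at a place of the frame. -/
def Site.frameTile : Site → Option (Tile Glue)
  | input _ => none
  | σ => if σ.IsSeed then σ.tile else none

theorem Site.frameTile_eq {σ : Site} (h : ∀ b, σ ≠ input b) :
    σ.frameTile = if σ.IsSeed then σ.tile else none := by
  cases σ <;> first | rfl | exact absurd rfl (h _)

theorem Site.tile_of_frameTile {σ : Site} {t : Tile Glue} (h : σ.frameTile = some t) :
    σ.tile = some t ∧ t.label = [] := by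
  cases σ with
  | lift d => cases d <;> cases h <;> exact ⟨rfl, rfl⟩
  | pad d => cases d <;> cases h <;> exact ⟨rfl, rfl⟩
  | _ => cases h <;> exact ⟨rfl, rfl⟩

/-- Apart from the inputs, the seed tiles in an arm see of a datum only the pad flag, which depends
on `n` and not on the addends. So one template serves all inputs. -/
theorem frameTile_armSite {d : Bool} {v j : ℕ} {e : Bool} {D D' : Datum} (h : D.pad = D'.pad) :
    (armSite d v j e D).frameTile = (armSite d v j e D').frameTile := by
  unfold armSite
  rw [h]
  split <;> (try split_ifs) <;> rfl

theorem frameTile_leftSite {k : ℕ} {s : Option Bool} {c : Bool} :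
    (leftSite k s c).frameTile = none := by
  unfold leftSite
  split_ifs <;> rfl

theorem frameTile_carrySite {k : ℕ} {s s' : Option Bool} {c c' : Bool} :
    (carrySite k s c).frameTile = (carrySite k s' c').frameTile := by
  unfold carrySite
  split <;> rfl

theorem frameTile_relSite {k : ℕ} {s s' : Option Bool} :
    (relSite k s).frameTile = (relSite k s').frameTile := by
  unfold relSite
  split <;> rfl

/-- The frame does not depend on the input. -/
theorem frameTile_site_bitLayout (A B A' B' : ℕ → Bool) (n L : ℕ) (x y : ℤ) :
    ((bitLayout A B n L).site x y).frameTile = ((bitLayout A' B' n L).site x y).frameTile := by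
  unfold Layout.site Layout.block Layout.arm
  have hL : ∀ A B, (bitLayout A B n L).L = L := fun _ _ => rfl
  have hi : ∀ A B d u, (bitLayout A B n L).index d u = (if d then L else 0) + u / 3 :=
    fun _ _ _ _ => rfl
  simp only [hL, hi]
  split_ifs <;> first
    | rfl | exact frameTile_armSite rfl | exact frameTile_carrySite | exact frameTile_relSite
    | rw [frameTile_leftSite, frameTile_leftSite]

namespace Layout

variable (P : Layout)

/-- The point in row `v` and column `j` of the position `q`. -/
def spot (q v j : ℕ) : ℤ × ℤ :=
  P.point (q / (2 * P.L)) (P.L ≤ q % (2 * P.L)) v (3 * (q % (2 * P.L) % P.L) + j)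

variable {P}

theorem index_spot (hL : 0 < P.L) (q : ℕ) {j : ℕ} (hj : j < 3) :
    P.index (P.L ≤ q % (2 * P.L)) (3 * (q % (2 * P.L) % P.L) + j) = q % (2 * P.L) := by
  have h := Nat.mod_lt q (show 0 < 2 * P.L by omega)
  rw [index]
  generalize q % (2 * P.L) = i at *
  rw [show (3 * (i % P.L) + j) / 3 = i % P.L by omega]
  rcases lt_or_ge i P.L with h' | h'
  · rw [Nat.mod_eq_of_lt h']
    simp [h']
  · rw [Nat.mod_eq_sub_mod h', Nat.mod_eq_of_lt (by omega)]
    simp [h']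

theorem site_spot {q v j : ℕ} (hq : q < 2 * P.L * P.L) (hv : v < 7) (hj0 : 0 < j) (hj : j < 3) :
    P.site (P.spot q v j).1 (P.spot q v j).2 =
      armSite (P.L ≤ q % (2 * P.L)) v j false (P.datum (q / (2 * P.L)) (q % (2 * P.L))) := by
  have hL : 0 < P.L := Nat.pos_of_ne_zero fun h => by simp [h] at hq
  have hr : q / (2 * P.L) < P.L := Nat.div_lt_of_lt_mul hq
  have hu := Nat.mod_lt (q % (2 * P.L)) hL
  rw [spot, site_point _ hr hv (by omega), arm, index_spot hL q hj]
  congr 1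
  · omega
  · rw [decide_eq_false]
    split_ifs <;> omega

theorem point_eq_spot {r u v : ℕ} (d : Bool) (hu : u < 3 * P.L) :
    P.point r d v u = P.spot (2 * P.L * r + P.index d u) v (u % 3) := by
  have h3 : u / 3 < P.L := by omega
  have hi : P.index d u < 2 * P.L := by
    unfold index
    split_ifs <;> omega
  rw [spot, Nat.mul_add_div (by omega), Nat.div_eq_of_lt hi, Nat.mul_add_mod,
    Nat.mod_eq_of_lt hi, add_zero, index]
  cases d
  · simp only [Bool.false_eq_true, if_false, zero_add]
    rw [decide_eq_false (by omega), Nat.mod_eq_of_lt h3, Nat.div_add_mod]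
  · simp only [if_true]
    rw [decide_eq_true (by omega), Nat.add_mod_left, Nat.mod_eq_of_lt h3, Nat.div_add_mod]

theorem point_injective {r r' v v' u u' : ℕ} {d d' : Bool} (hv : v < 7) (hv' : v' < 7)
    (h : P.point r d v u = P.point r' d' v' u') :
    r = r' ∧ d = d' ∧ v = v' ∧ u = u' := by
  cases d <;> cases d' <;> simp [point] at h ⊢ <;> omega

theorem spot_injective {q q' v j j' : ℕ} (hL : 0 < P.L) (hv : v < 7) (hj : j < 3) (hj' : j' < 3)
    (h : P.spot q v j = P.spot q' v j') : q = q' ∧ j = j' := by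
  obtain ⟨h1, h2, -, h3⟩ := point_injective hv hv h
  have h4 := index_spot hL q hj
  rw [h2, h3, index_spot hL q' hj'] at h4
  have h5 := Nat.div_add_mod q (2 * P.L)
  have h6 := Nat.div_add_mod q' (2 * P.L)
  rw [h1, ← h4, h6] at h5
  exact ⟨h5.symm, by omega⟩

end Layout

/-! ### The adder and its correctness. -/

section Computer

variable (n : ℕ)

/-- The digits of the first addend. -/
def firstDigit {n : ℕ} (b : Fin (n + n) → Bool) : ℕ → Bool := digit fun j => b (Fin.castAdd n j)

/-- The digits of the second addend. -/
def secondDigit {n : ℕ} (b : Fin (n + n) → Bool) : ℕ → Bool := digit fun j => b (Fin.natAdd n j)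

/-- The number of hairpins of the `n`-bit adder. -/
def size : ℕ := Nat.sqrt n + 1

/-- The layout of the `n`-bit adder. -/
def layout {n : ℕ} (b : Fin (n + n) → Bool) : Layout :=
  bitLayout (firstDigit b) (secondDigit b) n (size n)

variable {n}

/-- There has to be room for position `n`, beyond the input, where the leading bit of the sum
appears. -/
theorem lt_size_mul_size : n < 2 * size n * size n := by
  have := Nat.lt_succ_sqrt n
  unfold size
  rw [Nat.succ_eq_add_one] at this
  nlinarith

theorem digit_of_le {x : Fin n → Bool} {q : ℕ} (h : n ≤ q) : digit x q = false :=
  dif_neg (by omega)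

theorem coherent_layout (b : Fin (n + n) → Bool) : (layout b).Coherent :=
  coherent_bitLayout (Nat.succ_pos _) (fun _ => digit_of_le) fun _ => digit_of_le

variable (n) in
/-- The point for an input bit. -/
def wild : Fin (n + n) → ℤ × ℤ :=
  Fin.addCases (fun i => (layout (n := n) fun _ => false).spot (Fin.rev i) 1 1)
    fun i => (layout (n := n) fun _ => false).spot (Fin.rev i) 1 2

theorem wild_injective : Function.Injective (wild n) := by
  have hL : 0 < (layout (n := n) fun _ => false).L := Nat.succ_pos _
  intro k k' h
  induction k using Fin.addCases <;> induction k' using Fin.addCases <;>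
    simp only [wild, Fin.addCases_left, Fin.addCases_right] at h <;>
    have := Layout.spot_injective hL (by norm_num) (by norm_num) (by norm_num) h <;>
    simp [Fin.ext_iff] at this ⊢ <;> omega

theorem datum_layout (b : Fin (n + n) → Bool) (q : ℕ) :
    (layout b).datum (q / (2 * (layout b).L)) (q % (2 * (layout b).L)) =
      ⟨firstDigit b q, secondDigit b q, relAt (firstDigit b) (secondDigit b)
        (2 * size n * (q / (2 * size n))) (q % (2 * size n)),
        carryAt (firstDigit b) (secondDigit b) q, n ≤ q⟩ := by
  have h := Nat.div_add_mod q (2 * size n)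
  change (⟨_, _, _, _, _⟩ : Datum) = _
  change (⟨firstDigit b (2 * size n * (q / (2 * size n)) + q % (2 * size n)),
    secondDigit b (2 * size n * (q / (2 * size n)) + q % (2 * size n)), _,
    carryAt _ _ (2 * size n * (q / (2 * size n)) + q % (2 * size n)),
    decide (n ≤ (2 * size n * (q / (2 * size n)) + q % (2 * size n)))⟩ : Datum) = _
  rw [h]
  rfl

theorem digit_rev (x : Fin n → Bool) (i : Fin n) : digit x (Fin.rev i) = x i := by
  have h : digit x (Fin.rev i) = x (Fin.rev ⟨i.rev, i.rev.2⟩) := dif_pos i.rev.2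
  rw [h, Fin.eta, Fin.rev_rev]

theorem firstDigit_rev (b : Fin (n + n) → Bool) (i : Fin n) :
    firstDigit b (Fin.rev i) = b (Fin.castAdd n i) := digit_rev _ i

theorem secondDigit_rev (b : Fin (n + n) → Bool) (i : Fin n) :
    secondDigit b (Fin.rev i) = b (Fin.natAdd n i) := digit_rev _ i

theorem site_wild (b : Fin (n + n) → Bool) (k : Fin (n + n)) :
    (layout b).site (wild n k).1 (wild n k).2 = input (b k) := by
  have hn := lt_size_mul_size (n := n)
  induction k using Fin.addCases with
  | left i =>
    have hi : (i.rev : ℕ) < n := i.rev.2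
    rw [wild, Fin.addCases_left]
    refine (Layout.site_spot (P := layout b) (hi.trans hn) (by norm_num) (by norm_num)
      (by norm_num)).trans ?_
    rw [datum_layout]
    simp only [armSite, firstDigit_rev, decide_eq_false (not_le.2 hi), Bool.false_eq_true, if_false]
  | right i =>
    have hi : (i.rev : ℕ) < n := i.rev.2
    rw [wild, Fin.addCases_right]
    refine (Layout.site_spot (P := layout b) (hi.trans hn) (by norm_num) (by norm_num)
      (by norm_num)).trans ?_
    rw [datum_layout]
    simp only [armSite, secondDigit_rev, decide_eq_false (not_le.2 hi), Bool.false_eq_true,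
      if_false]

theorem exists_wild_eq {b : Fin (n + n) → Bool} {x y : ℤ} {c : Bool}
    (h : (layout b).site x y = input c) : ∃ k, wild n k = (x, y) := by
  obtain ⟨r, d, u, hr, hu, hj, hpad, hp⟩ := Layout.exists_point_of_site_eq_input h
  rw [hp, Layout.point_eq_spot d hu]
  have hq : 2 * (layout b).L * r + (layout b).index d u < n := by
    simpa [layout, bitLayout] using hpad
  generalize 2 * (layout b).L * r + (layout b).index d u = q at hq
  obtain hj | hj : u % 3 = 1 ∨ u % 3 = 2 := by omega
  · refine ⟨Fin.castAdd n (Fin.rev ⟨q, hq⟩), ?_⟩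
    rw [hj, wild, Fin.addCases_left, Fin.rev_rev]
    rfl
  · refine ⟨Fin.natAdd n (Fin.rev ⟨q, hq⟩), ?_⟩
    rw [hj, wild, Fin.addCases_right, Fin.rev_rev]
    rfl

variable (n) in
/-- The input template of the `n`-bit adder. -/
def template : InputTemplate tileSet (n + n) where
  zero := bitTile false
  one := bitTile true
  zero_mem := mem_tileSet.2 ⟨input false, mem_all rfl, rfl⟩
  one_mem := mem_tileSet.2 ⟨input true, mem_all rfl, rfl⟩
  label_zero := label_eq_singleton false
  label_one := label_eq_singleton true
  frame :=
    { tile := fun p => ((layout (n := n) fun _ => false).site p.1 p.2).frameTile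
      finite := (layout (n := n) fun _ => false).assembly.finite.subset fun p hp h => hp <| by
        have h : ((layout (n := n) fun _ => false).site p.1 p.2).tile = none := h
        revert h
        change _ → Site.frameTile _ = none
        generalize (layout (n := n) fun _ => false).site p.1 p.2 = σ
        intro h
        unfold Site.frameTile
        split
        · rfl
        · rw [h, ite_self] }
  frame_over p t h := by
    obtain ⟨h1, h2⟩ := Site.tile_of_frameTile h
    refine ⟨mem_tileSet.2 ⟨_, mem_all (Layout.inRange_site _ _), h1⟩, ?_, ?_⟩ <;> rintro rfl <;>
      cases h2
  wild := wild n
  wild_injective := wild_injective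
  frame_wild k := by
    change Site.frameTile _ = none
    rw [site_wild]
    rfl

theorem fill_template (b : Fin (n + n) → Bool) :
    ((template n).fill b).tile = (layout b).seedAt := by
  funext p
  change Function.extend (wild n) (fun i => some (if b i then bitTile true else bitTile false))
    (template n).frame.tile p = _
  by_cases h : ∃ k, wild n k = p
  · obtain ⟨k, rfl⟩ := h
    rw [wild_injective.extend_apply, Layout.seedAt, Layout.tileAt, site_wild]
    cases b k <;> rfl
  · rw [Function.extend_apply' _ _ _ h]
    change ((layout (n := n) fun _ => false).site p.1 p.2).frameTile = _
    rw [layout, frameTile_site_bitLayout _ _ (firstDigit b) (secondDigit b)]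
    exact Site.frameTile_eq fun c hc => h (exists_wild_eq hc)

variable (n) in
/-- The `n`-bit adder. -/
def computer : TAC Glue (n + n) (n + 1) where
  str := strength
  tiles := tileSet
  temp := 3
  temp_pos := by norm_num
  input := template n
  input_stable b := Layout.isStable_of_tile_eq_seedAt (fill_template b)
  output i := (layout (n := n) fun _ => false).spot (Fin.rev i) 5 2

theorem certificate_computer (b : Fin (n + n) → Bool) :
    ((computer n).system b).Certificate (layout b).assembly
      (fun p => (layout b).time p.1 p.2) (layout b).dep :=
  Layout.certificate (coherent_layout b) _ rfl rfl rfl (fill_template b)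

theorem addBits_eq (b : Fin (n + n) → Bool) (i : Fin (n + 1)) :
    addBits n b i = sumAt (firstDigit b) (secondDigit b) (Fin.rev i) := by
  rw [addBits, bitsValue_eq, bitsValue_eq]
  exact testBit_value_add (digit_of_le le_rfl) (digit_of_le le_rfl) (Nat.lt_succ_iff.1 i.rev.2)

theorem isAdder_computer : (computer n).IsAdder := by
  intro b
  refine ⟨_, (certificate_computer b).uniquelyAssembles, fun i =>
    ⟨bitTile (addBits n b i), ?_, rfl⟩⟩
  change ((layout b).site ((layout b).spot (Fin.rev i) 5 2).1
    ((layout b).spot (Fin.rev i) 5 2).2).tile = _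
  have hi : (i.rev : ℕ) < n + 1 := i.rev.2
  have hn := lt_size_mul_size (n := n)
  rw [Layout.site_spot (P := layout b) (lt_of_lt_of_le hi hn) (by norm_num) (by norm_num)
    (by norm_num), datum_layout, addBits_eq]
  rfl

end Computer

/-! ### Times bounded by the lengths of propagating runs. -/

section Times

variable {A B : ℕ → Bool} {L M : ℕ}

theorem relAt_eq_none_iff {p i : ℕ} :
    relAt A B p i = none ↔ ∀ j < i, typeAt A B (p + j) = none := by
  induction i with
  | zero => simp [relAt]
  | succ i ih =>
    rw [relAt, Option.or_eq_none_iff, ih, Nat.forall_lt_succ_right, and_comm]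

/-- The relative carry waits only for the propagating positions since the last generating one, or
since `p`, at three steps each. Runs longer than `2 * L` are left out of `hM` so that `M = 2 * L` is
always admissible. -/
theorem relTimeAt_le
    (hM : ∀ p, ∀ i ≤ 2 * L, (∀ j < i, typeAt A B (p + j) = none) → i ≤ M) (p : ℕ) {i : ℕ}
    (hi : i ≤ 2 * L) : relTimeAt A B p i ≤ 4 + 3 * M := by
  have key : ∀ i, ∃ m ≤ i, (∀ j < m, typeAt A B (p + (i - m) + j) = none) ∧
      relTimeAt A B p i ≤ 4 + 3 * m := by
    intro i
    induction i with
    | zero => exact ⟨0, le_rfl, by simp, by simp [relTimeAt]⟩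
    | succ i ih =>
      obtain ⟨m, hm, h1, h2⟩ := ih
      by_cases h : typeAt A B (p + i) = none
      · refine ⟨m + 1, by omega, fun j hj => ?_, ?_⟩
        · rcases eq_or_lt_of_le (Nat.lt_succ_iff.1 hj) with rfl | hj
          · rw [show p + (i + 1 - (j + 1)) + j = p + i by omega]
            exact h
          · rw [show i + 1 - (m + 1) = i - m by omega]
            exact h1 j hj
        · rw [relTimeAt, if_pos h]
          omega
      · exact ⟨0, by omega, by simp, by simp [relTimeAt, h]⟩
  obtain ⟨m, hm, h1, h2⟩ := key i
  have := hM _ m (by omega) h1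
  omega

/-- Trace the entering carry back over the `m` hairpins in succession that propagate throughout,
which cost at most 14 steps each, to one with a known relative carry or to the bottom. The skipped
hairpins contain a run of length `m`, so even their number is at most `M`. -/
theorem entryTime_le (hL : 0 < L)
    (hM : ∀ p, ∀ i ≤ 2 * L, (∀ j < i, typeAt A B (p + j) = none) → i ≤ M) {r : ℕ} (hr : r ≤ L) :
    entryTime A B L r ≤ 20 + 17 * M := by
  -- Here `20 + 3 * M` is the `4 + 3 * M` of a relative carry, 12 more steps to `skip` and 4 to the
  -- next entry.
  have key : ∀ r, ∃ m ≤ r, (∀ j < 2 * L * m, typeAt A B (2 * L * (r - m) + j) = none) ∧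
      entryTime A B L r ≤ 20 + 3 * M + 14 * m := by
    intro r
    induction r with
    | zero => exact ⟨0, le_rfl, by simp, by simp [entryTime]; omega⟩
    | succ r ih =>
      obtain ⟨m, hm, h1, h2⟩ := ih
      have hT := relTimeAt_le hM (2 * L * r) (i := 2 * L) le_rfl
      rw [entryTime, knownTime]
      split_ifs with h
      · refine ⟨m + 1, by omega, fun j hj => ?_, by omega⟩
        rw [show r + 1 - (m + 1) = r - m by omega]
        rcases lt_or_ge j (2 * L * m) with hj' | hj'
        · exact h1 j hj'
        · have e : 2 * L * (r - m) + 2 * L * m = 2 * L * r := by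
            rw [← mul_add, Nat.sub_add_cancel hm]
          rw [mul_add, mul_one] at hj
          have := relAt_eq_none_iff.1 h (j - 2 * L * m) (by omega)
          rwa [show 2 * L * r + (j - 2 * L * m) = 2 * L * (r - m) + j by omega] at this
      · exact ⟨0, by omega, by simp, by omega⟩
  obtain ⟨m, hm, h1, h2⟩ := key r
  -- Only the first `m` of the `2 * L * m` positions are used: `m ≤ r ≤ L` keeps this run within the
  -- range of `hM`.
  have := hM _ m (by omega) fun j hj => h1 j (by nlinarith)
  omega

/-- If all runs of propagating positions have length at most `M`, then all times are bounded
by a linear function of `M`. -/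
theorem time_bitLayout_le {n : ℕ} (hL : 0 < L)
    (hM : ∀ p, ∀ i ≤ 2 * L, (∀ j < i, typeAt A B (p + j) = none) → i ≤ M) (x y : ℤ) :
    (bitLayout A B n L).time x y ≤ 40 + 20 * M := by
  have hrel : ∀ r i, i ≤ 2 * L → (bitLayout A B n L).relArrival r i ≤ 4 + 3 * M :=
    fun r i hi => relTimeAt_le hM _ hi
  have hentry : ∀ r ≤ L, (bitLayout A B n L).entry r ≤ 20 + 17 * M :=
    fun r hr => entryTime_le hL hM hr
  have harr : ∀ r ≤ L, ∀ i, i ≤ 2 * L → (bitLayout A B n L).arrival r i ≤ 25 + 20 * M := by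
    intro r hr i hi
    have h1 := hentry r hr
    have h2 := hrel r i hi
    change ite _ _ _ ≤ _
    change entryTime A B L r ≤ _ at h1
    change relTimeAt A B _ _ ≤ _ at h2
    split_ifs with h
    · have := hM _ i hi (relAt_eq_none_iff.1 h)
      omega
    · omega
  have hknown : ∀ r ≤ L, (bitLayout A B n L).known r ≤ 30 + 17 * M := by
    intro r hr
    have h1 := hentry r hr
    have h2 := hrel r (2 * L) le_rfl
    change knownTime _ _ _ ≤ _
    change entryTime A B L r ≤ _ at h1
    change relTimeAt A B _ _ ≤ _ at h2
    unfold knownTime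
    split_ifs <;> omega
  have harm : ∀ r ≤ L, ∀ d v u, u ≤ 3 * L → (bitLayout A B n L).armAt r d v u ≤ 40 + 20 * M := by
    intro r hr d v u hu
    have hi : (bitLayout A B n L).index d u ≤ 2 * L := by
      change (if d then L else 0) + u / 3 ≤ _
      split_ifs <;> omega
    have h1 := hrel r _ hi
    have h2 := harr r hr _ hi
    unfold Layout.armAt armTime
    split <;> (try split_ifs) <;> omega
  unfold Layout.time
  split_ifs with hy
  · change 0 ≤ y ∧ y < 14 * (L : ℤ) at hy
    obtain ⟨r, hr⟩ : ∃ r, r = (y / 14).toNat := ⟨_, rfl⟩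
    rw [← hr]
    have hr : r ≤ L := by omega
    have h1 := hrel r L (by omega)
    have h2 := harr r hr L (by omega)
    have h3 := hentry r hr
    have h4 := hknown r hr
    unfold Layout.blockAt
    have hPL : (bitLayout A B n L).L = L := rfl
    rw [hPL]
    split_ifs
    · unfold leftTime
      split_ifs <;> omega
    · exact harm r hr _ _ _ (by omega)
    · exact harm r hr _ _ _ (by omega)
    · unfold carryTime
      split_ifs <;> omega
    · unfold relTime
      split_ifs <;> omega
    · omega
  · omega

end Times

/-! ### Long runs are rare. -/

section Runs

variable {n : ℕ}

/-- All of the `k` positions from `p` on propagate carries. -/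
def IsRun (b : Fin (n + n) → Bool) (p k : ℕ) : Prop :=
  ∀ j < k, typeAt (firstDigit b) (secondDigit b) (p + j) = none

instance (b : Fin (n + n) → Bool) (p k : ℕ) : Decidable (IsRun b p k) :=
  inferInstanceAs (Decidable (∀ j < k, _))

theorem lt_of_typeAt {b : Fin (n + n) → Bool} {q : ℕ}
    (h : typeAt (firstDigit b) (secondDigit b) q = none) : q < n := by
  by_contra hq
  rw [typeAt, firstDigit, secondDigit, digit_of_le (not_lt.1 hq), digit_of_le (not_lt.1 hq)] at h
  cases h

theorem typeAt_eq_none {A B : ℕ → Bool} {q : ℕ} : typeAt A B q = none ↔ A q ≠ B q := by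
  simp [typeAt]

/-- The input with one bit of the second addend flipped. -/
def flipSecond (i : Fin n) (b : Fin (n + n) → Bool) : Fin (n + n) → Bool :=
  Function.update b (Fin.natAdd n i) (!b (Fin.natAdd n i))

theorem flipSecond_injective (i : Fin n) : Function.Injective (flipSecond i) := by
  have h : Function.Involutive (flipSecond i) := by
    intro b
    simp [flipSecond]
  exact h.injective

theorem firstDigit_flipSecond (i : Fin n) (b : Fin (n + n) → Bool) :
    firstDigit (flipSecond i b) = firstDigit b := by
  unfold firstDigit
  congr 1
  funext j
  refine Function.update_of_ne (fun h => ?_) _ _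
  simp [Fin.ext_iff] at h
  omega

theorem secondDigit_flipSecond_of_ne {i : Fin n} {q : ℕ} (h : q ≠ i.rev)
    (b : Fin (n + n) → Bool) : secondDigit (flipSecond i b) q = secondDigit b q := by
  unfold secondDigit digit
  split_ifs with hq
  · refine Function.update_of_ne (fun h' => h ?_) _ _
    have := (Fin.natAdd_injective _ _ h')
    rw [← this, Fin.rev_rev]
  · rfl

theorem secondDigit_flipSecond (i : Fin n) (b : Fin (n + n) → Bool) :
    secondDigit (flipSecond i b) i.rev = !secondDigit b i.rev := by
  rw [secondDigit_rev, secondDigit_rev, flipSecond, Function.update_self]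

/-- A given run of length `k` occurs in at most a fraction of `1 / 2 ^ k` of all inputs. -/
theorem pow_mul_card_isRun_le (p k : ℕ) :
    2 ^ k * (Finset.univ.filter fun b : Fin (n + n) → Bool => IsRun b p k).card ≤ 2 ^ (n + n) := by
  induction k with
  | zero =>
    rw [pow_zero, one_mul]
    refine (Finset.card_filter_le _ _).trans ?_
    simp
  | succ k ih =>
    refine le_trans ?_ ih
    rw [pow_succ, mul_assoc]
    refine Nat.mul_le_mul_left _ ?_
    rcases Nat.lt_or_ge (p + k) n with hk | hk
    · set i : Fin n := Fin.rev ⟨p + k, hk⟩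
      have hi : (i.rev : ℕ) = p + k := by simp [i]
      set s := Finset.univ.filter fun b : Fin (n + n) → Bool => IsRun b p (k + 1)
      have hs : ∀ b ∈ s, IsRun b p (k + 1) := fun b hb => (Finset.mem_filter.1 hb).2
      -- Flipping a digit at position `p + k` destroys a run of length `k + 1` but keeps its first
      -- `k` positions. So the inputs with the longer run and their flips are disjoint sets of equal
      -- size among those with the shorter run.
      have hdisj : Disjoint s (s.image (flipSecond i)) := by
        rw [Finset.disjoint_left]
        intro b hb hb'
        obtain ⟨b', hb'', rfl⟩ := Finset.mem_image.1 hb'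
        have h1 := typeAt_eq_none.1 (hs _ hb k (by omega))
        have h2 := typeAt_eq_none.1 (hs _ hb'' k (by omega))
        rw [← hi, firstDigit_flipSecond, secondDigit_flipSecond] at h1
        rw [← hi] at h2
        revert h1 h2
        cases firstDigit b' i.rev <;> cases secondDigit b' i.rev <;> simp
      have hcard : (s.image (flipSecond i)).card = s.card :=
        Finset.card_image_of_injective _ (flipSecond_injective i)
      rw [two_mul]
      nth_rewrite 2 [← hcard]
      rw [← Finset.card_union_of_disjoint hdisj]
      refine Finset.card_le_card (Finset.union_subset ?_ ?_)
      · intro b hb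
        exact Finset.mem_filter.2 ⟨Finset.mem_univ _, fun j hj =>
          hs _ hb j (by omega)⟩
      · intro b hb
        obtain ⟨b', hb', rfl⟩ := Finset.mem_image.1 hb
        refine Finset.mem_filter.2 ⟨Finset.mem_univ _, fun j hj => ?_⟩
        have := hs _ hb' j (by omega)
        rw [typeAt_eq_none] at this ⊢
        rwa [firstDigit_flipSecond, secondDigit_flipSecond_of_ne (by omega)]
    -- Positions from `n` on have equal digits and belong to no run.
    · rw [Finset.card_eq_zero.2 (Finset.filter_eq_empty_iff.2 fun b _ h =>
        absurd (lt_of_typeAt (h k (by omega))) (by omega))]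
      omega

end Runs

/-! ### Average and worst-case run times. -/

section RunTime

variable {n : ℕ}

variable (n) in
/-- Most inputs have no run that is longer than this. -/
def typicalRun : ℕ := 2 * (Nat.log 2 n + 1)

open Classical in
/-- A bound for the length of the runs in a hairpin. -/
noncomputable def runBound (b : Fin (n + n) → Bool) : ℕ :=
  if ∃ p, IsRun b p (typicalRun n + 1) then 2 * size n else min (2 * size n) (typicalRun n)

theorem le_runBound (b : Fin (n + n) → Bool) (p i : ℕ) (hi : i ≤ 2 * size n) (h : IsRun b p i) :
    i ≤ runBound b := by
  unfold runBound
  split_ifs with hlong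
  · exact hi
  · refine le_min hi (le_of_not_gt fun hlt => hlong ⟨p, fun j hj => h j ?_⟩)
    omega

theorem runBound_le (b : Fin (n + n) → Bool) : runBound b ≤ 2 * size n := by
  unfold runBound
  split_ifs
  · exact le_rfl
  · exact min_le_left _ _

theorem exists_runTime_computer (b : Fin (n + n) → Bool) :
    ∃ k ≤ 40 + 20 * runBound b, ((computer n).system b).HasParallelRunTime k :=
  (certificate_computer b).exists_runTime fun p _ =>
    time_bitLayout_le (Nat.succ_pos _) (le_runBound b) p.1 p.2

/-- The run time of the `n`-bit adder. -/
noncomputable def runTime (b : Fin (n + n) → Bool) : ℕ := (exists_runTime_computer b).choose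

theorem runTime_le (b : Fin (n + n) → Bool) : runTime b ≤ 40 + 20 * runBound b :=
  (exists_runTime_computer b).choose_spec.1

theorem hasParallelRunTime_runTime (b : Fin (n + n) → Bool) :
    ((computer n).system b).HasParallelRunTime (runTime b) :=
  (exists_runTime_computer b).choose_spec.2

/-- If there is a long run, its starting point contributes at least 1 to the sum, which pays for the
trivial bound `2 * size n`. This is the union bound in a form that can be summed over `b`. -/
theorem runBound_le_add_sum (b : Fin (n + n) → Bool) : runBound b ≤
    typicalRun n + 2 * size n *
      ∑ p ∈ Finset.range n, if IsRun b p (typicalRun n + 1) then 1 else 0 := by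
  unfold runBound
  split_ifs with h
  · obtain ⟨p, hp⟩ := h
    have hpn : p ∈ Finset.range n := Finset.mem_range.2 (lt_of_typeAt (hp 0 (Nat.succ_pos _)))
    have h1 := Finset.single_le_sum (f := fun p => if IsRun b p (typicalRun n + 1) then 1 else 0)
      (fun _ _ => Nat.zero_le _) hpn
    simp only [if_pos hp] at h1
    nlinarith
  · exact (min_le_right _ _).trans (Nat.le_add_right _ _)

/-- As `2 ^ typicalRun n ≥ n * n`, a long run starts at a given position in at most a fraction `1 /
(2 * n * n)` of the inputs. The `n` starting points, each weighted by `2 * size n ≤ 4 * n`, add at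
most 2 to the average. -/
theorem sum_runBound_le (hn : 1 ≤ n) :
    ∑ b : Fin (n + n) → Bool, runBound b ≤ (typicalRun n + 2) * 2 ^ (n + n) := by
  have hN : ∀ p, n * n * (Finset.univ.filter fun b : Fin (n + n) → Bool =>
      IsRun b p (typicalRun n + 1)).card * 2 ≤ 2 ^ (n + n) := by
    intro p
    refine le_trans ?_ (pow_mul_card_isRun_le p (typicalRun n + 1))
    have h1 : n < 2 ^ (Nat.log 2 n + 1) := Nat.lt_pow_succ_log_self (by norm_num) n
    have h2 : n * n ≤ 2 ^ typicalRun n := by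
      rw [typicalRun, two_mul, pow_add]
      exact Nat.mul_le_mul h1.le h1.le
    rw [pow_succ]
    nlinarith [Nat.mul_le_mul_right (Finset.univ.filter fun b : Fin (n + n) → Bool =>
      IsRun b p (typicalRun n + 1)).card h2]
  have hsize : size n ≤ 2 * n := by
    have := Nat.sqrt_le_self n
    unfold size
    omega
  calc ∑ b : Fin (n + n) → Bool, runBound b
      ≤ ∑ b : Fin (n + n) → Bool, (typicalRun n + 2 * size n *
          ∑ p ∈ Finset.range n, if IsRun b p (typicalRun n + 1) then 1 else 0) :=
        Finset.sum_le_sum fun b _ => runBound_le_add_sum b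
    _ = 2 ^ (n + n) * typicalRun n + 2 * size n * ∑ p ∈ Finset.range n,
          (Finset.univ.filter fun b : Fin (n + n) → Bool => IsRun b p (typicalRun n + 1)).card := by
        rw [Finset.sum_add_distrib, ← Finset.mul_sum, Finset.sum_comm]
        simp
    _ ≤ 2 ^ (n + n) * typicalRun n + 2 * 2 ^ (n + n) := by
        refine Nat.add_le_add_left ?_ _
        have h : n * ∑ p ∈ Finset.range n, (Finset.univ.filter fun b : Fin (n + n) → Bool =>
            IsRun b p (typicalRun n + 1)).card * (n * 2) ≤ n * 2 ^ (n + n) := by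
          rw [Finset.mul_sum]
          refine (Finset.sum_le_card_nsmul (Finset.range n) _ (2 ^ (n + n)) fun p _ => ?_).trans_eq
            (by simp)
          linarith [hN p]
        rw [← Finset.sum_mul] at h
        have h := Nat.le_of_mul_le_mul_left h hn
        have h' := Nat.mul_le_mul_right (∑ p ∈ Finset.range n,
          (Finset.univ.filter fun b : Fin (n + n) → Bool =>
            IsRun b p (typicalRun n + 1)).card) hsize
        linarith
    _ = (typicalRun n + 2) * 2 ^ (n + n) := by ring

theorem averageTime_runTime_le (hn : 1 ≤ n) :
    averageTime (fun b : Fin (n + n) → Bool => runTime b) ≤ 120 + 40 * Nat.log 2 n := by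
  have h : (∑ b : Fin (n + n) → Bool, (runTime b : ℝ)) ≤
      (120 + 40 * Nat.log 2 n : ℕ) * (2 ^ (n + n) : ℕ) := by
    rw [← Nat.cast_sum]
    norm_cast
    calc ∑ b : Fin (n + n) → Bool, runTime b
        ≤ ∑ b : Fin (n + n) → Bool, (40 + 20 * runBound b) :=
          Finset.sum_le_sum fun b _ => runTime_le b
      _ = 2 ^ (n + n) * 40 + 20 * ∑ b : Fin (n + n) → Bool, runBound b := by
          rw [Finset.sum_add_distrib, ← Finset.mul_sum]
          simp
      _ ≤ 2 ^ (n + n) * 40 + 20 * ((typicalRun n + 2) * 2 ^ (n + n)) := by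
          gcongr
          exact sum_runBound_le hn
      _ = (120 + 40 * Nat.log 2 n) * 2 ^ (n + n) := by
          rw [typicalRun]
          ring
  rw [averageTime, div_le_iff₀ (by positivity)]
  refine h.trans_eq ?_
  simp

theorem worstTime_runTime_le :
    worstTime (fun b : Fin (n + n) → Bool => runTime b) ≤ 80 + 40 * Nat.sqrt n := by
  refine Finset.sup_le fun b _ => (runTime_le b).trans ?_
  have := runBound_le b
  unfold size at this
  omega

theorem isBigO_averageTime :
    (fun n : ℕ => averageTime fun b : Fin (n + n) → Bool => runTime b)
      =O[Filter.atTop] (fun n : ℕ => Real.log (n : ℝ)) := by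
  -- For `n ≥ 2` both 1 and `Nat.log 2 n` are at most `log n / log 2`, and `160 = 120 + 40`.
  refine Asymptotics.IsBigO.of_bound (160 / Real.log 2) ?_
  filter_upwards [Filter.eventually_ge_atTop 2] with n hn
  have hlog2 : 0 < Real.log 2 := Real.log_pos (by norm_num)
  have hn2 : (2 : ℝ) ≤ n := by exact_mod_cast hn
  have h1 : Real.log 2 ≤ Real.log n := Real.log_le_log (by norm_num) hn2
  have h2 : (Nat.log 2 n : ℝ) * Real.log 2 ≤ Real.log n := by
    rw [← Real.log_pow]
    refine Real.log_le_log (by positivity) ?_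
    exact_mod_cast Nat.pow_log_le_self 2 (by omega)
  have h0 : 0 ≤ averageTime (fun b : Fin (n + n) → Bool => runTime b) := by
    unfold averageTime
    positivity
  rw [Real.norm_of_nonneg h0, Real.norm_of_nonneg (hlog2.le.trans h1), div_mul_eq_mul_div,
    le_div_iff₀ hlog2]
  nlinarith [averageTime_runTime_le (n := n) (by omega)]

theorem isBigO_worstTime :
    (fun n : ℕ => (worstTime fun b : Fin (n + n) → Bool => runTime b : ℝ))
      =O[Filter.atTop] (fun n : ℕ => Real.sqrt (n : ℝ)) := by
  -- From `80 + 40 * Nat.sqrt n`, with `1 ≤ √n` absorbing the constant.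
  refine Asymptotics.IsBigO.of_bound 120 ?_
  filter_upwards [Filter.eventually_ge_atTop 1] with n hn
  have h1 : (1 : ℝ) ≤ Real.sqrt n := Real.one_le_sqrt.2 (by exact_mod_cast hn)
  have h2 : (Nat.sqrt n : ℝ) ≤ Real.sqrt n := Real.nat_sqrt_le_real_sqrt
  have h3 : (worstTime (fun b : Fin (n + n) → Bool => runTime b) : ℝ) ≤
      80 + 40 * Nat.sqrt n := by exact_mod_cast worstTime_runTime_le
  rw [Real.norm_of_nonneg (by positivity), Real.norm_of_nonneg (by positivity)]
  linarith

end RunTime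

end Adder
end TileAssembly

theorem mainTheorem1 :
    ∃ (G : Type) (_ : DecidableEq G) (str : G → ℕ) (T : Finset (TileAssembly.Tile G)) (τ : ℕ)
      (time : (n : ℕ) → (Fin (n + n) → Bool) → ℕ),
      (∀ n : ℕ, 1 ≤ n → ∃ M : TileAssembly.TAC G (n + n) (n + 1),
        M.str = str ∧ M.tiles = T ∧ M.temp = τ ∧ M.IsAdder ∧
        ∀ b, (M.system b).HasParallelRunTime (time n b)) ∧
      (fun n : ℕ => TileAssembly.averageTime (time n))
        =O[Filter.atTop] (fun n : ℕ => Real.log (n : ℝ)) ∧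
      (fun n : ℕ => (TileAssembly.worstTime (time n) : ℝ))
        =O[Filter.atTop] (fun n : ℕ => Real.sqrt (n : ℝ)) := by
  exact ⟨TileAssembly.Adder.Glue, inferInstance, TileAssembly.Adder.strength,
    TileAssembly.Adder.tileSet, 3, fun _ b => TileAssembly.Adder.runTime b,
    fun n _ => ⟨TileAssembly.Adder.computer n, rfl, rfl, rfl, TileAssembly.Adder.isAdder_computer,
      TileAssembly.Adder.hasParallelRunTime_runTime⟩,
    TileAssembly.Adder.isBigO_averageTime, TileAssembly.Adder.isBigO_worstTime⟩
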